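/- Let $\Gamma$ be a finite group and $\Gamma'\subseteq\Gamma$ a subgroup. For a subgroup $\Delta$ of $\Gamma$ let $a_{\Gamma/\Delta}=-1+\operatorname{Ind}_\Delta^\Gamma 1$ and $a_\Gamma=a_{\Gamma/1}$. Let $e_{\Gamma/\Gamma'}$ be the minimal central idempotent of $\mathbb Q[\Gamma]$ acting as the identity on a $\mathbb Q$-representation with character $a_{\Gamma/\Gamma'}$, and let $e_1'=|\Gamma'|^{-1}\sum_{\tau\in\Gamma'}\tau$. For a set $S$ of primes let $\mathbb Z_S$ be the localization of $\mathbb Z$ at the nonzero integers not divisible by any prime in $S$ (so $\mathbb Z_{\{p\}}=\mathbb Z_{(p)}$). A prime $p$ is called good if $e_{\Gamma/\Gamma'}\in\mathbb Z_{(p)}[\Gamma]$ and $e_{\Gamma/\Gamma'}\mathbb Z_{(p)}[\Gamma]$ is a maximal $\mathbb Z_{(p)}$-order in $e_{\Gamma/\Gamma'}\mathbb Q[\Gamma]$. Let $S$ be a nonempty finite set of good primes (for instance $S=\{p\}$), and put $R=e_{\Gamma/\Gamma'}\mathbb Z_S[\Gamma]$, a ring with identity $e_{\Gamma/\Gamma'}$.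 Let $\mathfrak o={}^{\Gamma'}(Re_1')$ be the set of elements of $Re_1'\subseteq\mathbb Q[\Gamma]$ fixed by left multiplication by $\Gamma'$; it is a ring with identity $e_{\Gamma/\Gamma'}e_1'$. For an $R$-module $G$, the group ${}^{\Gamma'}G$ of elements fixed by $\Gamma'$ is an $\mathfrak o$-module via $(\sigma e_1')\cdot g=\sigma g$ for $\sigma\in R$ with $\sigma e_1'\in\mathfrak o$. (1) For every finite $\mathfrak o$-module $H$ there is a finite $R$-module $G$, unique up to isomorphism, with ${}^{\Gamma'}G\cong H$ as $\mathfrak o$-modules; moreover $\operatorname{Aut}_R(G)\cong\operatorname{Aut}_{\mathfrak o}(H)$ as groups. (2) Let $e_2,\dots,e_k$ be the distinct irreducible central idempotents $e_i$ of $\mathbb Q[\Gamma]$ with $e_ie_{\Gamma/\Gamma'}=e_i$ (so $e_{\Gamma/\Gamma'}=e_2+\cdots+e_k$), let $\chi_i$ be the $\mathbb Q$-irreducible character associated to $e_i$, and let $\varphi_i$ be any absolutely irreducible character contained in $\chi_i$. For $u,v\in\mathbb Q^{k-1}$, a finite $R$-module $G$ and a finite $\mathfrak o$-module $H$ put $$|G|^{u}=\prod_{i=2}^k|e_iG|^{u_i},\qquad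 |H|^{v}=\prod_{i=2}^k|e_ie_1'H|^{v_i}.$$ Suppose that $\sum_G \frac1{|G|^u|\operatorname{Aut}_R(G)|}$, over the isomorphism classes of finite $R$-modules, converges, and let $X$ be the random finite $R$-module with $\mathbb P(X\cong G)$ proportional to $\frac1{|G|^u|\operatorname{Aut}_R(G)|}$. Then the following are equivalent: (a) the sum $\sum_H\frac1{|H|^v|\operatorname{Aut}_{\mathfrak o}(H)|}$ over the isomorphism classes of finite $\mathfrak o$-modules converges, and the random $\mathfrak o$-module ${}^{\Gamma'}X$ has the same distribution as the random finite $\mathfrak o$-module $Y$ with $\mathbb P(Y\cong H)$ proportional to $\frac1{|H|^v|\operatorname{Aut}_{\mathfrak o}(H)|}$; (b) for all $i=2,\dots,k$, $$v_i=\frac{\langle\varphi_i,a_\Gamma\rangle}{\langle\varphi_i,a_{\Gamma/\Gamma'}\rangle}\,u_i.$$ -/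

import Mathlib

universe w

/-- The ring `ℤ_S`, the localization of `ℤ` at the nonzero integers not divisible by any `p ∈ S`,
as a subring of `ℚ`. -/
def ZS (S : Set ℕ) : Subring ℚ where
  carrier := {q | ∀ p ∈ S, p.Prime → ¬ p ∣ q.den}
  zero_mem' := by
    intro p _ hp h
    exact hp.one_lt.ne' (Nat.dvd_one.mp (by simpa using h))
  one_mem' := by
    intro p _ hp h
    exact hp.one_lt.ne' (Nat.dvd_one.mp (by simpa using h))
  add_mem' := by
    intro a b ha hb p hpS hp h
    rcases hp.dvd_mul.mp (h.trans (Rat.add_den_dvd a b)) with h | h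
    · exact ha p hpS hp h
    · exact hb p hpS hp h
  mul_mem' := by
    intro a b ha hb p hpS hp h
    rcases hp.dvd_mul.mp (h.trans (Rat.mul_den_dvd a b)) with h | h
    · exact ha p hpS hp h
    · exact hb p hpS hp h
  neg_mem' := by
    intro a ha p hpS hp h
    exact ha p hpS hp (by simpa using h)

/-- A central idempotent of a ring. -/
def IsCentralIdem {B : Type*} [Ring B] (ε : B) : Prop :=
  IsIdempotentElem ε ∧ ∀ x : B, ε * x = x * ε

/-- An irreducible (primitive) central idempotent of a ring. -/
def IsIrredCentralIdem {B : Type*} [Ring B] (ε : B) : Prop :=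
  IsCentralIdem ε ∧ ε ≠ 0 ∧ ∀ δ : B, IsCentralIdem δ → δ * ε = δ → δ = 0 ∨ δ = ε

theorem IsCentralIdem.mul {B : Type*} [Ring B] {ε δ : B} (hε : IsCentralIdem ε)
    (hδ : IsCentralIdem δ) : IsCentralIdem (ε * δ) := by
  refine ⟨?_, fun x => ?_⟩
  · show ε * δ * (ε * δ) = ε * δ
    rw [mul_assoc, ← mul_assoc δ, hδ.2 ε, mul_assoc ε δ δ, hδ.1.eq, ← mul_assoc, hε.1.eq]
  · rw [mul_assoc, hδ.2, ← mul_assoc, hε.2, mul_assoc]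

section Idempotents

variable {Γ : Type*} [Group Γ] (Γ' : Subgroup Γ)

/-- `ε ∈ ℚ[Γ]` acts as the identity on the augmentation representation
`{x ∈ ℚ[Γ/Γ'] | the coefficients of x sum to 0}`, whose character is `a_{Γ/Γ'}`. -/
def ActsAsOneOnAug (ε : MonoidAlgebra ℚ Γ) : Prop :=
  ∀ x : MonoidAlgebra ℚ (Γ ⧸ Γ'), (x.coeff.sum fun _ a => a) = 0 →
    (Representation.ofMulAction ℚ Γ (Γ ⧸ Γ')).asAlgebraHom ε x = x

theorem exists_augIdem [Finite Γ] : ∃ e : MonoidAlgebra ℚ Γ,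
    (IsCentralIdem e ∧ ActsAsOneOnAug Γ' e) ∧
      ∀ ε, IsCentralIdem ε → ActsAsOneOnAug Γ' ε → e * ε = e := by
  classical
  let d : MonoidAlgebra ℚ Γ → ℕ := fun e =>
    Module.finrank ℚ (LinearMap.range (LinearMap.mulLeft ℚ e))
  have hne : {e : MonoidAlgebra ℚ Γ | IsCentralIdem e ∧ ActsAsOneOnAug Γ' e}.Nonempty :=
    ⟨1, ⟨IsIdempotentElem.one, fun x => by simp⟩, fun x _ => by simp⟩
  obtain ⟨e, he, hmin⟩ : ∃ e ∈ {e : MonoidAlgebra ℚ Γ | IsCentralIdem e ∧ ActsAsOneOnAug Γ' e},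
      ∀ e' ∈ {e : MonoidAlgebra ℚ Γ | IsCentralIdem e ∧ ActsAsOneOnAug Γ' e}, d e ≤ d e' := by
    obtain ⟨e, he, hd⟩ := WellFounded.has_min (measure d).wf _ hne
    exact ⟨e, he, fun e' he' => not_lt.mp (hd e' he')⟩
  refine ⟨e, he, fun ε hε hact => ?_⟩
  have : Module.Finite ℚ (MonoidAlgebra ℚ Γ) :=
    Module.Finite.equiv (MonoidAlgebra.coeffLinearEquiv (S := ℚ) (M := Γ) ℚ).symm
  have hmem : IsCentralIdem (e * ε) ∧ ActsAsOneOnAug Γ' (e * ε) := by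
    refine ⟨he.1.mul hε, fun x hx => ?_⟩
    rw [map_mul, Module.End.mul_apply, hact x hx, he.2 x hx]
  have hle : LinearMap.range (LinearMap.mulLeft ℚ (e * ε)) ≤
      LinearMap.range (LinearMap.mulLeft ℚ e) := by
    rintro _ ⟨x, rfl⟩
    exact ⟨ε * x, by simp⟩
  have heq := Submodule.eq_of_le_of_finrank_le hle (hmin _ hmem)
  have : e ∈ LinearMap.range (LinearMap.mulLeft ℚ (e * ε)) := by
    rw [heq]; exact ⟨1, by simp⟩
  obtain ⟨x, hx⟩ := this
  have hx' : e * ε * x = e := hx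
  calc e * ε = ε * e := (hε.2 e).symm
    _ = ε * (e * ε * x) := by rw [hx']
    _ = e * ε * x := by
      rw [← mul_assoc, ← mul_assoc, hε.2 e, mul_assoc e ε ε, hε.1.eq]
    _ = e := hx'

variable [Finite Γ]

/-- The central idempotent `e_{Γ/Γ'}` of `ℚ[Γ]`: the minimal central idempotent that acts as the
identity on the representation with character `a_{Γ/Γ'}`. -/
noncomputable def augIdem : MonoidAlgebra ℚ Γ := (exists_augIdem Γ').choose

theorem augIdem_isCentralIdem : IsCentralIdem (augIdem Γ') :=
  (exists_augIdem Γ').choose_spec.1.1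

theorem augIdem_idem : IsIdempotentElem (augIdem Γ') := (augIdem_isCentralIdem Γ').1

/-- The idempotent `e₁' = |Γ'|⁻¹ ∑_{τ ∈ Γ'} τ` of `ℚ[Γ]`. -/
noncomputable def avgIdem : MonoidAlgebra ℚ Γ :=
  ∑ᶠ τ : Γ', MonoidAlgebra.single (τ : Γ) ((Nat.card Γ' : ℚ)⁻¹)

theorem single_mul_avgIdem {γ : Γ} (hγ : γ ∈ Γ') :
    MonoidAlgebra.single γ 1 * avgIdem Γ' = avgIdem Γ' := by
  classical
  have := Fintype.ofFinite Γ'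
  unfold avgIdem
  rw [finsum_eq_sum_of_fintype, Finset.mul_sum]
  simp only [MonoidAlgebra.single_mul_single, one_mul]
  exact Fintype.sum_equiv (Equiv.mulLeft (⟨γ, hγ⟩ : Γ')) _ _ (fun τ => rfl)

theorem avgIdem_mul_of_fixed {x : MonoidAlgebra ℚ Γ}
    (hx : ∀ γ ∈ Γ', MonoidAlgebra.single γ 1 * x = x) : avgIdem Γ' * x = x := by
  classical
  have := Fintype.ofFinite Γ'
  have h : ∀ τ : Γ', MonoidAlgebra.single (τ : Γ) ((Nat.card Γ' : ℚ)⁻¹) * x =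
      (Nat.card Γ' : ℚ)⁻¹ • x := by
    intro τ
    have : MonoidAlgebra.single (τ : Γ) ((Nat.card Γ' : ℚ)⁻¹) =
        (Nat.card Γ' : ℚ)⁻¹ • MonoidAlgebra.single (τ : Γ) (1 : ℚ) := by simp
    rw [this, smul_mul_assoc, hx τ τ.2]
  unfold avgIdem
  rw [finsum_eq_sum_of_fintype, Finset.sum_mul, Finset.sum_congr rfl (fun τ _ => h τ),
    Finset.sum_const, Finset.card_univ, ← Nat.card_eq_fintype_card, ← Nat.cast_smul_eq_nsmul ℚ,
    smul_smul, mul_inv_cancel₀ (by exact_mod_cast Nat.card_pos.ne'), one_smul]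

theorem avgIdem_idem : IsIdempotentElem (avgIdem Γ') :=
  avgIdem_mul_of_fixed Γ' fun _ hγ => single_mul_avgIdem Γ' hγ

theorem augIdem_mul_avgIdem_idem : IsIdempotentElem (augIdem Γ' * avgIdem Γ') := by
  show augIdem Γ' * avgIdem Γ' * (augIdem Γ' * avgIdem Γ') = augIdem Γ' * avgIdem Γ'
  rw [mul_assoc, ← mul_assoc (avgIdem Γ'), ← (augIdem_isCentralIdem Γ').2 (avgIdem Γ'),
    mul_assoc (augIdem Γ') (avgIdem Γ'), (avgIdem_idem Γ').eq, ← mul_assoc, (augIdem_idem Γ').eq]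

/-- The ring `e_{Γ/Γ'} ℚ[Γ]`, with identity `e_{Γ/Γ'}`. -/
abbrev AugAlg : Type _ := (augIdem_idem Γ').Corner

/-- The Hecke-type algebra `e₁' e_{Γ/Γ'} ℚ[Γ] e₁'`, with identity `e_{Γ/Γ'} e₁'`. -/
abbrev HeckeAlg : Type _ := (augIdem_mul_avgIdem_idem Γ').Corner

end Idempotents

section Orders

variable {Γ : Type*} [Group Γ]

/-- The group ring `ℤ_S[Γ]` inside `ℚ[Γ]`. -/
noncomputable def groupRing (Γ : Type*) [Group Γ] (S : Set ℕ) : Subring (MonoidAlgebra ℚ Γ) :=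
  (MonoidAlgebra.mapRingHom Γ (ZS S).subtype).range

/-- `Λ` is a `ℤ_S`-order of the algebra `f ℚ[Γ] f`: a subring (with the same identity `f`) that is
finitely generated as a `ℤ_S`-module and spans the algebra over `ℚ`. -/
def IsZSOrder (S : Set ℕ) {f : MonoidAlgebra ℚ Γ} {hf : IsIdempotentElem f}
    (Λ : Subring hf.Corner) : Prop :=
  (∃ T : Finset (MonoidAlgebra ℚ Γ),
    (fun x : hf.Corner => x.1) '' (Λ : Set hf.Corner) =
      (Submodule.span (ZS S) (T : Set (MonoidAlgebra ℚ Γ)) : Set (MonoidAlgebra ℚ Γ))) ∧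
  ∀ x : hf.Corner, x.1 ∈ Submodule.span ℚ ((fun x : hf.Corner => x.1) '' (Λ : Set hf.Corner))

/-- A maximal `ℤ_S`-order of `f ℚ[Γ] f`. -/
def IsMaximalZSOrder (S : Set ℕ) {f : MonoidAlgebra ℚ Γ} {hf : IsIdempotentElem f}
    (Λ : Subring hf.Corner) : Prop :=
  IsZSOrder S Λ ∧ ∀ Λ' : Subring hf.Corner, IsZSOrder S Λ' → Λ ≤ Λ' → Λ' = Λ

variable [Finite Γ] (Γ' : Subgroup Γ)

/-- The ring `e_{Γ/Γ'} ℤ_S[Γ]`, with identity `e_{Γ/Γ'}`. -/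
def augRing (S : Set ℕ) : Subring (AugAlg Γ') where
  carrier := {x | ∃ y ∈ groupRing Γ S, x.1 = augIdem Γ' * y}
  zero_mem' := ⟨0, zero_mem _, by rw [mul_zero]; rfl⟩
  one_mem' := ⟨1, one_mem _, by rw [mul_one]; rfl⟩
  add_mem' := by
    rintro a b ⟨y, hy, ha⟩ ⟨z, hz, hb⟩
    exact ⟨y + z, add_mem hy hz, by rw [mul_add, ← ha, ← hb]; rfl⟩
  neg_mem' := by
    rintro a ⟨y, hy, ha⟩
    exact ⟨-y, neg_mem hy, by rw [mul_neg, ← ha]; rfl⟩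
  mul_mem' := by
    rintro a b ⟨y, hy, ha⟩ ⟨z, hz, hb⟩
    refine ⟨y * z, mul_mem hy hz, ?_⟩
    show a.1 * b.1 = _
    rw [ha, hb, mul_assoc, ← mul_assoc y, ← (augIdem_isCentralIdem Γ').2 y, mul_assoc (augIdem Γ'),
      ← mul_assoc, (augIdem_idem Γ').eq]

/-- The ring `𝔬 = ^{Γ'}(e_{Γ/Γ'} ℤ_S[Γ] e₁')` of the elements of `e_{Γ/Γ'} ℤ_S[Γ] e₁'` fixed by left
multiplication by `Γ'`, with identity `e_{Γ/Γ'} e₁'`. -/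
def heckeOrder (S : Set ℕ) : Subring (HeckeAlg Γ') where
  carrier := {x | (∃ y ∈ groupRing Γ S, x.1 = augIdem Γ' * y * avgIdem Γ') ∧
    ∀ γ ∈ Γ', MonoidAlgebra.single γ 1 * x.1 = x.1}
  zero_mem' := ⟨⟨0, zero_mem _, by rw [mul_zero, zero_mul]; rfl⟩, fun γ _ => mul_zero _⟩
  one_mem' := ⟨⟨1, one_mem _, by rw [mul_one]; rfl⟩, fun γ hγ => by
    show _ * (augIdem Γ' * avgIdem Γ') = augIdem Γ' * avgIdem Γ'
    rw [← mul_assoc, ← (augIdem_isCentralIdem Γ').2, mul_assoc, single_mul_avgIdem Γ' hγ]⟩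
  add_mem' := by
    rintro a b ⟨⟨y, hy, ha⟩, ha'⟩ ⟨⟨z, hz, hb⟩, hb'⟩
    refine ⟨⟨y + z, add_mem hy hz, by rw [mul_add, add_mul, ← ha, ← hb]; rfl⟩, fun γ hγ => ?_⟩
    show _ * (a.1 + b.1) = a.1 + b.1
    rw [mul_add, ha' γ hγ, hb' γ hγ]
  neg_mem' := by
    rintro a ⟨⟨y, hy, ha⟩, ha'⟩
    refine ⟨⟨-y, neg_mem hy, by rw [mul_neg, neg_mul, ← ha]; rfl⟩, fun γ hγ => ?_⟩
    show _ * (-a.1) = -a.1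
    rw [mul_neg, ha' γ hγ]
  mul_mem' := by
    rintro a b ⟨⟨y, hy, ha⟩, ha'⟩ ⟨⟨z, hz, hb⟩, hb'⟩
    have hfix : avgIdem Γ' * b.1 = b.1 := avgIdem_mul_of_fixed Γ' hb'
    refine ⟨⟨y * z, mul_mem hy hz, ?_⟩, fun γ hγ => ?_⟩
    · show a.1 * b.1 = _
      rw [ha, mul_assoc, hfix, hb, mul_assoc (augIdem Γ') y, ← mul_assoc y, ← mul_assoc y,
        ← (augIdem_isCentralIdem Γ').2 y, mul_assoc (augIdem Γ') y z, ← mul_assoc, ← mul_assoc,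
        (augIdem_idem Γ').eq]
    · show _ * (a.1 * b.1) = a.1 * b.1
      rw [← mul_assoc, ha' γ hγ]

/-- `p` is a good prime for `e_{Γ/Γ'}`: `e_{Γ/Γ'} ∈ ℤ_(p)[Γ]` and `e_{Γ/Γ'} ℤ_(p)[Γ]` is a maximal
`ℤ_(p)`-order of `e_{Γ/Γ'} ℚ[Γ]`. -/
def IsGoodPrime (p : ℕ) : Prop :=
  p.Prime ∧ augIdem Γ' ∈ groupRing Γ {p} ∧ IsMaximalZSOrder {p} (augRing Γ' {p})

/-- All elements of `S` are good primes for `e_{Γ/Γ'}`. -/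
def AllGood (S : Set ℕ) : Prop := ∀ p ∈ S, IsGoodPrime Γ' p

theorem mem_groupRing_iff {S : Set ℕ} {x : MonoidAlgebra ℚ Γ} :
    x ∈ groupRing Γ S ↔ ∀ γ, x.coeff γ ∈ ZS S := by
  constructor
  · rintro ⟨y, rfl⟩ γ
    simp
  · intro h
    refine ⟨MonoidAlgebra.ofCoeff (Finsupp.equivFunOnFinite.symm fun γ => ⟨x.coeff γ, h γ⟩), ?_⟩
    ext γ
    simp

theorem AllGood.augIdem_mem {Γ' : Subgroup Γ} {S : Set ℕ} (hS : AllGood Γ' S) :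
    augIdem Γ' ∈ groupRing Γ S := by
  rw [mem_groupRing_iff]
  intro γ p hpS hp
  exact mem_groupRing_iff.mp (hS p hpS).2.1 γ p rfl hp

end Orders

section Invariants

variable {Γ : Type*} [Group Γ] [Finite Γ] (Γ' : Subgroup Γ)

/-- The ring homomorphism `ℤ_S[Γ] → e_{Γ/Γ'} ℤ_S[Γ]`, `y ↦ e_{Γ/Γ'} y`, through which `Γ` acts on
`e_{Γ/Γ'} ℤ_S[Γ]`-modules. -/
noncomputable def toAugRing (S : Set ℕ) : MonoidAlgebra (ZS S) Γ →+* augRing Γ' S where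
  toFun y := ⟨⟨augIdem Γ' * MonoidAlgebra.mapRingHom Γ (ZS S).subtype y, by
    refine (Subsemigroup.mem_corner_iff (augIdem_idem Γ')).mpr ⟨?_, ?_⟩
    · rw [← mul_assoc, (augIdem_idem Γ').eq]
    · rw [← (augIdem_isCentralIdem Γ').2, ← mul_assoc, (augIdem_idem Γ').eq]⟩, _, ⟨y, rfl⟩, rfl⟩
  map_one' := Subtype.ext (Subtype.ext (by
    show augIdem Γ' * MonoidAlgebra.mapRingHom Γ (ZS S).subtype 1 = augIdem Γ'
    rw [map_one, mul_one]))
  map_zero' := Subtype.ext (Subtype.ext (by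
    show augIdem Γ' * MonoidAlgebra.mapRingHom Γ (ZS S).subtype 0 = 0
    rw [map_zero, mul_zero]))
  map_add' x y := Subtype.ext (Subtype.ext (by
    show augIdem Γ' * MonoidAlgebra.mapRingHom Γ (ZS S).subtype (x + y) =
      augIdem Γ' * MonoidAlgebra.mapRingHom Γ (ZS S).subtype x +
      augIdem Γ' * MonoidAlgebra.mapRingHom Γ (ZS S).subtype y
    rw [map_add, mul_add]))
  map_mul' x y := Subtype.ext (Subtype.ext (by
    show augIdem Γ' * MonoidAlgebra.mapRingHom Γ (ZS S).subtype (x * y) =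
      augIdem Γ' * MonoidAlgebra.mapRingHom Γ (ZS S).subtype x *
      (augIdem Γ' * MonoidAlgebra.mapRingHom Γ (ZS S).subtype y)
    rw [map_mul, mul_assoc, ← mul_assoc (MonoidAlgebra.mapRingHom Γ (ZS S).subtype x),
      ← (augIdem_isCentralIdem Γ').2 (MonoidAlgebra.mapRingHom Γ (ZS S).subtype x),
      mul_assoc (augIdem Γ') (MonoidAlgebra.mapRingHom Γ (ZS S).subtype x),
      ← mul_assoc (augIdem Γ') (augIdem Γ'), (augIdem_idem Γ').eq]))

variable {Γ'} {S : Set ℕ}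

/-- The subgroup `^{Γ'}G` of the elements of an `e_{Γ/Γ'} ℤ_S[Γ]`-module `G` fixed by `Γ'`. -/
def invSubgroup (Γ' : Subgroup Γ) (S : Set ℕ) (G : Type*) [AddCommGroup G]
    [Module (augRing Γ' S) G] : AddSubgroup G where
  carrier := {g | ∀ γ ∈ Γ', toAugRing Γ' S (MonoidAlgebra.single γ 1) • g = g}
  zero_mem' := fun γ _ => smul_zero _
  add_mem' := fun ha hb γ hγ => by rw [smul_add, ha γ hγ, hb γ hγ]
  neg_mem' := fun ha γ hγ => by rw [smul_neg, ha γ hγ]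

/-- Projection of coefficients along `Γ → Γ/Γ'` does not change under right multiplication
by `e₁'`. -/
theorem mapDomain_mul_avgIdem (x : MonoidAlgebra ℚ Γ) :
    Finsupp.mapDomain (QuotientGroup.mk : Γ → Γ ⧸ Γ') (x * avgIdem Γ').coeff =
      Finsupp.mapDomain (QuotientGroup.mk : Γ → Γ ⧸ Γ') x.coeff := by
  classical
  have := Fintype.ofFinite Γ'
  induction x using MonoidAlgebra.induction_linear with
  | zero => simp
  | add f g hf hg => simp [add_mul, Finsupp.mapDomain_add, hf, hg]
  | single γ a =>
    unfold avgIdem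
    rw [finsum_eq_sum_of_fintype, Finset.mul_sum]
    simp only [MonoidAlgebra.single_mul_single, MonoidAlgebra.coeff_sum,
      MonoidAlgebra.coeff_single, Finsupp.mapDomain_finsetSum, Finsupp.mapDomain_single]
    have : ∀ τ : Γ', (QuotientGroup.mk (γ * (τ : Γ)) : Γ ⧸ Γ') = QuotientGroup.mk γ := fun τ =>
      QuotientGroup.mk_mul_of_mem γ τ.2
    simp only [this, Finset.sum_const, Finset.card_univ, ← Nat.card_eq_fintype_card]
    rw [← Nat.cast_smul_eq_nsmul ℚ, Finsupp.smul_single, smul_eq_mul]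
    congr 1
    have : (Nat.card Γ' : ℚ) ≠ 0 := by exact_mod_cast Nat.card_pos.ne'
    field_simp

/-- If `σ ∈ e_{Γ/Γ'} ℤ_S[Γ]` satisfies `σ e₁' = 0`, then `σ` kills `^{Γ'}G`. -/
theorem smul_eq_zero_of_mul_avgIdem (he : augIdem Γ' ∈ groupRing Γ S) {G : Type*} [AddCommGroup G]
    [Module (augRing Γ' S) G] (σ : augRing Γ' S) (hσ : σ.1.1 * avgIdem Γ' = 0) {g : G}
    (hg : g ∈ invSubgroup Γ' S G) : σ • g = 0 := by
  classical
  obtain ⟨z, hz, hσz⟩ := σ.2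
  obtain ⟨y, hy⟩ : σ.1.1 ∈ groupRing Γ S := by rw [hσz]; exact mul_mem he hz
  have hσy : σ = toAugRing Γ' S y := by
    apply Subtype.ext; apply Subtype.ext
    show σ.1.1 = augIdem Γ' * MonoidAlgebra.mapRingHom Γ (ZS S).subtype y
    rw [hy]
    exact ((Subsemigroup.mem_corner_iff (augIdem_idem Γ')).mp σ.1.2).1.symm
  have h0 : Finsupp.mapDomain (QuotientGroup.mk : Γ → Γ ⧸ Γ') y.coeff = 0 := by
    have h1 := mapDomain_mul_avgIdem (Γ' := Γ') σ.1.1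
    rw [hσ] at h1
    ext q
    have h2 : Finsupp.mapDomain (QuotientGroup.mk : Γ → Γ ⧸ Γ') σ.1.1.coeff =
        Finsupp.mapRange (ZS S).subtype (map_zero _)
          (Finsupp.mapDomain (QuotientGroup.mk : Γ → Γ ⧸ Γ') y.coeff) := by
      rw [← Finsupp.mapDomain_mapRange _ _ _ _ (map_add (ZS S).subtype)]
      congr 1
      rw [← hy]
      ext γ
      simp
    have h3 := DFunLike.congr_fun (h2.symm.trans h1.symm) q
    simpa using h3
  have hcoset : ∀ (γ : Γ) (a : ZS S), toAugRing Γ' S (MonoidAlgebra.single γ a) • g =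
      toAugRing Γ' S (MonoidAlgebra.single ((QuotientGroup.mk γ : Γ ⧸ Γ').out) a) • g := by
    intro γ a
    obtain ⟨τ, hτ⟩ := QuotientGroup.mk_out_eq_mul Γ' γ
    rw [hτ]
    have : (MonoidAlgebra.single (γ * (τ : Γ)) a : MonoidAlgebra (ZS S) Γ) =
        MonoidAlgebra.single γ a * MonoidAlgebra.single (τ : Γ) 1 := by
      rw [MonoidAlgebra.single_mul_single, mul_one]
    rw [this, map_mul, mul_smul, hg τ τ.2]
  have hsum : ∀ w : MonoidAlgebra (ZS S) Γ, toAugRing Γ' S w • g =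
      (Finsupp.mapDomain (QuotientGroup.mk : Γ → Γ ⧸ Γ') w.coeff).sum
        (fun q a => toAugRing Γ' S (MonoidAlgebra.single q.out a) • g) := by
    intro w
    rw [Finsupp.sum_mapDomain_index (by simp) (by intro q a b; rw [MonoidAlgebra.single_add, map_add, add_smul])]
    induction w using MonoidAlgebra.induction_linear with
    | zero => simp
    | add f h hf hh =>
      rw [map_add, add_smul, hf, hh, MonoidAlgebra.coeff_add, Finsupp.sum_add_index' (by simp)
        (by intro q a b; rw [MonoidAlgebra.single_add, map_add, add_smul])]
    | single γ a =>
      rw [hcoset, MonoidAlgebra.coeff_single, Finsupp.sum_single_index (by simp)]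
  rw [hσy, hsum, h0, Finsupp.sum_zero_index]

/-- The group `^{Γ'}G` of `Γ'`-invariants of an `e_{Γ/Γ'} ℤ_S[Γ]`-module `G`, to be equipped with its
`𝔬`-module structure. -/
def GammaInv (_hS : AllGood Γ' S) (G : Type*) [AddCommGroup G] [Module (augRing Γ' S) G] : Type _ :=
  invSubgroup Γ' S G

variable (hS : AllGood Γ' S) (G : Type*) [AddCommGroup G] [Module (augRing Γ' S) G]

instance : AddCommGroup (GammaInv hS G) := inferInstanceAs (AddCommGroup (invSubgroup Γ' S G))

instance [Finite G] : Finite (GammaInv hS G) := inferInstanceAs (Finite (invSubgroup Γ' S G))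

theorem exists_lift (x : heckeOrder Γ' S) :
    ∃ σ : augRing Γ' S, σ.1.1 * avgIdem Γ' = x.1.1 := by
  obtain ⟨⟨y, ⟨w, hw⟩, hx⟩, -⟩ := x.2
  refine ⟨toAugRing Γ' S w, ?_⟩
  rw [hx, ← hw]
  rfl

theorem smul_eq_smul_of_mul_avgIdem (hS : AllGood Γ' S) {G : Type*} [AddCommGroup G]
    [Module (augRing Γ' S) G] {σ τ : augRing Γ' S}
    (h : σ.1.1 * avgIdem Γ' = τ.1.1 * avgIdem Γ') {g : G} (hg : g ∈ invSubgroup Γ' S G) :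
    σ • g = τ • g := by
  rw [← sub_eq_zero, ← sub_smul]
  refine smul_eq_zero_of_mul_avgIdem hS.augIdem_mem _ ?_ hg
  show (σ.1.1 - τ.1.1) * avgIdem Γ' = 0
  rw [sub_mul, h, sub_self]

theorem smul_mem_invSubgroup (hS : AllGood Γ' S) {G : Type*} [AddCommGroup G]
    [Module (augRing Γ' S) G] (x : heckeOrder Γ' S) {σ : augRing Γ' S}
    (h : σ.1.1 * avgIdem Γ' = x.1.1) {g : G} (hg : g ∈ invSubgroup Γ' S G) :
    σ • g ∈ invSubgroup Γ' S G := by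
  intro γ hγ
  rw [← mul_smul]
  refine smul_eq_smul_of_mul_avgIdem hS ?_ hg
  show augIdem Γ' * MonoidAlgebra.mapRingHom Γ (ZS S).subtype (MonoidAlgebra.single γ 1) *
    σ.1.1 * avgIdem Γ' = σ.1.1 * avgIdem Γ'
  rw [mul_assoc, h, MonoidAlgebra.mapRingHom_single, map_one, mul_assoc, x.2.2 γ hγ, ← h,
    ← mul_assoc, ((Subsemigroup.mem_corner_iff (augIdem_idem Γ')).mp σ.1.2).1]

theorem avgIdem_mul_heckeOrder (x : heckeOrder Γ' S) : avgIdem Γ' * x.1.1 = x.1.1 := by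
  have h := ((Subsemigroup.mem_corner_iff (augIdem_mul_avgIdem_idem Γ')).mp x.1.2).1
  rw [← h, ← mul_assoc, ← mul_assoc, ← (augIdem_isCentralIdem Γ').2 (avgIdem Γ'),
    mul_assoc (augIdem Γ') (avgIdem Γ') (avgIdem Γ'), (avgIdem_idem Γ').eq]

/-- The `𝔬`-action on `^{Γ'}G`: `(σ e₁') • g = σ • g` for `σ ∈ e_{Γ/Γ'} ℤ_S[Γ]` with `σ e₁' ∈ 𝔬`. -/
noncomputable instance : SMul (heckeOrder Γ' S) (GammaInv hS G) where
  smul x g := ⟨(exists_lift x).choose • g.1,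
    smul_mem_invSubgroup hS x (exists_lift x).choose_spec g.2⟩

theorem GammaInv.smul_val (x : heckeOrder Γ' S) (σ : augRing Γ' S) (h : σ.1.1 * avgIdem Γ' = x.1.1)
    (g : GammaInv hS G) : (x • g).1 = σ • g.1 :=
  smul_eq_smul_of_mul_avgIdem hS ((exists_lift x).choose_spec.trans h.symm) g.2

noncomputable instance : Module (heckeOrder Γ' S) (GammaInv hS G) where
  one_smul g := Subtype.ext (by
    rw [GammaInv.smul_val hS G 1 1 rfl, one_smul])
  mul_smul x y g := Subtype.ext (by
    obtain ⟨σ, hσ⟩ := exists_lift x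
    obtain ⟨τ, hτ⟩ := exists_lift y
    rw [GammaInv.smul_val hS G (x * y) (σ * τ) ?_, GammaInv.smul_val hS G x σ hσ,
      GammaInv.smul_val hS G y τ hτ, mul_smul]
    show σ.1.1 * τ.1.1 * avgIdem Γ' = x.1.1 * y.1.1
    rw [mul_assoc, hτ, ← hσ, mul_assoc, avgIdem_mul_heckeOrder])
  smul_zero x := Subtype.ext (by
    obtain ⟨σ, hσ⟩ := exists_lift x
    rw [GammaInv.smul_val hS G x σ hσ]
    exact smul_zero σ)
  smul_add x g h := Subtype.ext (by
    obtain ⟨σ, hσ⟩ := exists_lift x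
    rw [GammaInv.smul_val hS G x σ hσ]
    show σ • (g.1 + h.1) = (x • g).1 + (x • h).1
    rw [GammaInv.smul_val hS G x σ hσ, GammaInv.smul_val hS G x σ hσ, smul_add])
  add_smul x y g := Subtype.ext (by
    obtain ⟨σ, hσ⟩ := exists_lift x
    obtain ⟨τ, hτ⟩ := exists_lift y
    rw [GammaInv.smul_val hS G (x + y) (σ + τ) ?_, add_smul]
    · show _ = (x • g).1 + (y • g).1
      rw [GammaInv.smul_val hS G x σ hσ, GammaInv.smul_val hS G y τ hτ]
    · show (σ.1.1 + τ.1.1) * avgIdem Γ' = x.1.1 + y.1.1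
      rw [add_mul, hσ, hτ])
  zero_smul g := Subtype.ext (by
    rw [GammaInv.smul_val hS G 0 0 (zero_mul _), zero_smul]
    rfl)

end Invariants

section RandomModules

/-- A finite module over a ring `R`. -/
structure FinMod (R : Type*) [Ring R] where
  carrier : Type
  [addCommGroup : AddCommGroup carrier]
  [module : Module R carrier]
  [finite : Finite carrier]

attribute [instance] FinMod.addCommGroup FinMod.module FinMod.finite

instance FinMod.setoid (R : Type*) [Ring R] : Setoid (FinMod R) where
  r M N := Nonempty (M.carrier ≃ₗ[R] N.carrier)
  iseqv := ⟨fun _ => ⟨LinearEquiv.refl _ _⟩, fun ⟨f⟩ => ⟨f.symm⟩, fun ⟨f⟩ ⟨g⟩ => ⟨f.trans g⟩⟩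

/-- The isomorphism classes of finite `R`-modules. -/
def FinModClass (R : Type*) [Ring R] : Type _ := Quotient (FinMod.setoid R)

variable {B : Type*} [Ring B] (Λ : Subring B) {ι : Type*} [Fintype ι] (ε : ι → B) (u : ι → ℚ)

/-- The subgroup `ε G` of a `Λ`-module `G`, for an element `ε` of `Λ`. -/
def idemPart (δ : B) (G : Type*) [AddCommGroup G] [Module Λ G] : AddSubgroup G :=
  AddSubgroup.closure {x | ∃ r : Λ, (r : B) = δ ∧ ∃ g : G, r • g = x}

open scoped ENNReal in
/-- `|G|^u = ∏ i, |ε i G| ^ (u i)`. -/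
noncomputable def cardPow (G : Type*) [AddCommGroup G] [Module Λ G] : ℝ≥0∞ :=
  ∏ i, (Nat.card (idemPart Λ (ε i) G) : ℝ≥0∞) ^ (u i : ℝ)

open scoped ENNReal in
/-- The weight `1 / (|G|^u |Aut_Λ(G)|)`. -/
noncomputable def modWeight (G : Type*) [AddCommGroup G] [Module Λ G] : ℝ≥0∞ :=
  (cardPow Λ ε u G * (Nat.card (G ≃ₗ[Λ] G) : ℝ≥0∞))⁻¹

theorem card_idemPart_congr (δ : B) {G H : Type*} [AddCommGroup G] [Module Λ G] [AddCommGroup H]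
    [Module Λ H] (f : G ≃ₗ[Λ] H) :
    Nat.card (idemPart Λ δ G) = Nat.card (idemPart Λ δ H) := by
  have h : idemPart Λ δ H = (idemPart Λ δ G).map (f : G →+ H) := by
    unfold idemPart
    rw [AddMonoidHom.map_closure]
    congr 1
    ext x
    constructor
    · rintro ⟨r, hr, g, rfl⟩
      exact ⟨r • f.symm g, ⟨r, hr, _, rfl⟩, by simp⟩
    · rintro ⟨_, ⟨r, hr, g, rfl⟩, rfl⟩
      exact ⟨r, hr, f g, by simp⟩
  rw [h]
  exact Nat.card_congr ((idemPart Λ δ G).equivMapOfInjective (f : G →+ H) f.injective).toEquiv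

theorem modWeight_congr {G H : Type*} [AddCommGroup G] [Module Λ G] [AddCommGroup H]
    [Module Λ H] (f : G ≃ₗ[Λ] H) : modWeight Λ ε u G = modWeight Λ ε u H := by
  unfold modWeight cardPow
  simp only [card_idemPart_congr Λ _ f]
  have h : (G ≃ₗ[Λ] G) ≃ (H ≃ₗ[Λ] H) :=
    ⟨fun a => f.symm.trans (a.trans f), fun b => f.trans (b.trans f.symm),
      fun a => by ext; simp, fun b => by ext; simp⟩
  rw [Nat.card_congr h]

open scoped ENNReal in
/-- The weight `1 / (|G|^u |Aut_Λ(G)|)` of an isomorphism class of finite `Λ`-modules. -/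
noncomputable def classWeight : FinModClass Λ → ℝ≥0∞ :=
  Quotient.lift (fun M : FinMod Λ => modWeight Λ ε u M.carrier)
    (fun _ _ ⟨f⟩ => modWeight_congr Λ ε u f)

open scoped ENNReal in
theorem tsum_classWeight_ne_zero : ∑' c, classWeight Λ ε u c ≠ 0 := by
  intro h
  have h0 := ENNReal.tsum_eq_zero.mp h (Quotient.mk _ ⟨PUnit⟩)
  refine ENNReal.inv_ne_zero.mpr ?_ h0
  refine ENNReal.mul_ne_top (ENNReal.prod_ne_top fun i _ => ?_) (ENNReal.natCast_ne_top _)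
  exact ENNReal.rpow_ne_top_of_ne_zero (by exact_mod_cast Nat.card_pos.ne')
    (ENNReal.natCast_ne_top _)

open scoped ENNReal in
/-- The distribution of the random finite `Λ`-module attached to `u`, as a probability distribution
on isomorphism classes: `G` has probability proportional to `1 / (|G|^u |Aut_Λ(G)|)`. It is defined
whenever the sum of these weights is finite. -/
noncomputable def randomModule (h : ∑' c, classWeight Λ ε u c ≠ ∞) : PMF (FinModClass Λ) :=
  PMF.normalize (classWeight Λ ε u) (tsum_classWeight_ne_zero Λ ε u) h

end RandomModules

section Components

variable {Γ : Type*} [Group Γ] [Finite Γ] (Γ' : Subgroup Γ)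

/-- The index set `{2, …, k}`: the irreducible central idempotents `e_i` of `ℚ[Γ]` with
`e_i e_{Γ/Γ'} = e_i`. -/
def AugIndex : Type _ :=
  {ε : MonoidAlgebra ℚ Γ // IsIrredCentralIdem ε ∧ ε * augIdem Γ' = ε}

theorem IsIrredCentralIdem.mul_eq_zero {B : Type*} [Ring B] {ε δ : B} (hε : IsIrredCentralIdem ε)
    (hδ : IsIrredCentralIdem δ) (h : ε ≠ δ) : ε * δ = 0 := by
  by_contra h0
  have h1 : ε * δ = δ := (hδ.2.2 _ (hε.1.mul hδ.1) (by rw [mul_assoc, hδ.1.1.eq])).resolve_left h0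
  have h2 : ε * δ = ε := (hε.2.2 _ (hε.1.mul hδ.1)
    (by rw [mul_assoc, hδ.1.2, ← mul_assoc, hε.1.1.eq])).resolve_left h0
  exact h (h2.symm.trans h1)

instance : Finite (AugIndex Γ') := by
  classical
  have : Module.Finite ℚ (MonoidAlgebra ℚ Γ) :=
    Module.Finite.equiv (MonoidAlgebra.coeffLinearEquiv (S := ℚ) (M := Γ) ℚ).symm
  have hli : LinearIndependent ℚ (fun i : AugIndex Γ' => i.1) := by
    rw [linearIndependent_iff']
    intro s a hs j hj
    have h := congrArg (· * j.1) hs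
    simp only [Finset.sum_mul, zero_mul, smul_mul_assoc] at h
    rw [Finset.sum_eq_single_of_mem j hj] at h
    · rw [j.2.1.1.1.eq] at h
      exact (smul_eq_zero.mp h).resolve_right j.2.1.2.1
    · intro i _ hij
      rw [i.2.1.mul_eq_zero j.2.1 (fun h => hij (Subtype.ext h)), smul_zero]
  exact hli.finite

noncomputable instance : Fintype (AugIndex Γ') := Fintype.ofFinite _

variable {Γ'}

/-- `e_i` as an element of `e_{Γ/Γ'} ℚ[Γ]`. -/
noncomputable def AugIndex.toAug (i : AugIndex Γ') : AugAlg Γ' :=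
  ⟨i.1, (Subsemigroup.mem_corner_iff (augIdem_idem Γ')).mpr
    ⟨by rw [(augIdem_isCentralIdem Γ').2, i.2.2], i.2.2⟩⟩

/-- `e_i e₁'` as an element of `e₁' e_{Γ/Γ'} ℚ[Γ] e₁'`. -/
noncomputable def AugIndex.toHecke (i : AugIndex Γ') : HeckeAlg Γ' :=
  ⟨i.1 * avgIdem Γ', (Subsemigroup.mem_corner_iff (augIdem_mul_avgIdem_idem Γ')).mpr ⟨by
      rw [mul_assoc, ← mul_assoc (avgIdem Γ'), ← i.2.1.1.2, mul_assoc i.1, (avgIdem_idem Γ').eq,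
        ← mul_assoc, (augIdem_isCentralIdem Γ').2, i.2.2], by
      rw [mul_assoc, ← mul_assoc (avgIdem Γ'), ← (augIdem_isCentralIdem Γ').2 (avgIdem Γ'),
        mul_assoc (augIdem Γ'), (avgIdem_idem Γ').eq, ← mul_assoc, i.2.2]⟩⟩

variable {S : Set ℕ} (hS : AllGood Γ' S)

/-- An isomorphism `G ≃ G'` induces an isomorphism `^{Γ'}G ≃ ^{Γ'}G'` of `𝔬`-modules. -/
noncomputable def GammaInv.congr {G G' : Type*} [AddCommGroup G] [Module (augRing Γ' S) G] [AddCommGroup G']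
    [Module (augRing Γ' S) G'] (f : G ≃ₗ[augRing Γ' S] G') :
    GammaInv hS G ≃ₗ[heckeOrder Γ' S] GammaInv hS G' where
  toFun g := ⟨f g.1, fun γ hγ => by rw [← map_smul, g.2 γ hγ]⟩
  invFun g := ⟨f.symm g.1, fun γ hγ => by rw [← map_smul, g.2 γ hγ]⟩
  left_inv g := Subtype.ext (f.symm_apply_apply g.1)
  right_inv g := Subtype.ext (f.apply_symm_apply g.1)
  map_add' g h := Subtype.ext (map_add f g.1 h.1)
  map_smul' x g := Subtype.ext (by
    obtain ⟨σ, hσ⟩ := exists_lift x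
    show f (x • g).1 = _
    rw [GammaInv.smul_val hS G x σ hσ]
    exact (map_smul f σ g.1).trans (GammaInv.smul_val hS G' x σ hσ ⟨f g.1, _⟩).symm)

/-- The map `G ↦ ^{Γ'}G` on isomorphism classes of finite modules. -/
noncomputable def invClass : FinModClass (augRing Γ' S) → FinModClass (heckeOrder Γ' S) :=
  Quotient.map (fun M : FinMod (augRing Γ' S) =>
    (⟨GammaInv hS M.carrier⟩ : FinMod (heckeOrder Γ' S)))
    (fun _ _ ⟨f⟩ => ⟨GammaInv.congr hS f⟩)

end Components

section Characters

variable {Γ : Type*} [Group Γ] [Finite Γ]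

/-- The inner product `⟨φ, ψ⟩ = |Γ|⁻¹ ∑ φ(γ) conj ψ(γ)` of complex class functions. -/
noncomputable def charInner (φ ψ : Γ → ℂ) : ℂ :=
  (Nat.card Γ : ℂ)⁻¹ * ∑ᶠ γ : Γ, φ γ * (starRingEnd ℂ) (ψ γ)

/-- The augmentation character `a_{Γ/Δ} = -1 + Ind_Δ^Γ 1`; the induced character `Ind_Δ^Γ 1` is the
character of the permutation representation on `Γ/Δ`. -/
noncomputable def augChar (Δ : Subgroup Γ) : Γ → ℂ :=
  fun γ => -1 + (Representation.ofMulAction ℂ Γ (Γ ⧸ Δ)).character γ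

/-- `χ` is the `ℚ`-irreducible character associated to the irreducible central idempotent `ε`:
the character of an irreducible representation over `ℚ` on which `ε` acts as the identity. -/
def IsRatCharOf (ε : MonoidAlgebra ℚ Γ) (χ : Γ → ℚ) : Prop :=
  ∃ (n : ℕ) (ρ : Representation ℚ Γ (Fin n → ℚ)), ρ.IsIrreducible ∧ ρ.asAlgebraHom ε = 1 ∧
    ρ.character = χ

/-- `φ` is an absolutely irreducible character, i.e. that of an irreducible representation
over `ℂ`. -/
def IsAbsIrredChar (φ : Γ → ℂ) : Prop :=
  ∃ (n : ℕ) (ρ : Representation ℂ Γ (Fin n → ℂ)), ρ.IsIrreducible ∧ ρ.character = φ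

/-- `φ` is an absolutely irreducible character contained in the `ℚ`-irreducible character
associated to `ε`. -/
def IsAbsIrredCharIn (ε : MonoidAlgebra ℚ Γ) (φ : Γ → ℂ) : Prop :=
  IsAbsIrredChar φ ∧ ∃ χ : Γ → ℚ, IsRatCharOf ε χ ∧ charInner φ (fun γ => (χ γ : ℂ)) ≠ 0

end Characters

/-! Write e = e_{Γ/Γ'}, N = ∑_{τ ∈ Γ'} τ and R = e ℤ_S[Γ].

Part (1) is a Morita equivalence between R and 𝔬. The order |Γ'| need not be invertible in ℤ_S, so
e₁' need not be integral; N takes its place, and maximality of R makes up for the missing inverse.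
The criterion is that a full two-sided ideal of a maximal order with trivial inverse is the unit
ideal, because every maximal two-sided ideal has a non-integral inverse (`IsMaxIdeal.exists_notMem`,
`IsFullIdeal.one_mem_of_forall`). The right Γ'-invariants of R are R N, so x R N R ⊆ R forces x R N
R ⊆ R N R, hence x ∈ R; therefore R N R = R (`augIdem_mem_mul_normElt_mul`). It follows that 𝔬 is a
maximal order too (`heckeLat_isMaxOrder`), and the same criterion for its ideal N R e₁' yields z ∈ R
with N z e₁' = e e₁' (`exists_normElt_mul_mul`). So η = e N z is an idempotent of R with ^{Γ'}G =
ηG, and a relation ∑ x_i N y_i = 1 recovers G from its invariants: G is the image of the idempotent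
matrix (N y_j x_l e₁') on a power of H (`exists_extension`, `exists_gammaInv_equiv`).

For part (2), G ↦ ^{Γ'}G is a bijection on isomorphism classes that preserves automorphism groups,
and the zero module has weight 1 on both sides, so (a) says exactly that |G|^u = |^{Γ'}G|^v for all
G (`map_randomModule_eq_iff`). One has |e_i e₁' ^{Γ'}G| = |e_i η G|, so |e_i G| has to be compared
with |e_i η G|. Over ℚ, (ℚ[Γ] e_i)^b ≅ (ℚ[Γ] e_i η)^a for some a, b > 0 (`exists_matrices`), and
traces in φ_i identify a/b with the ratio in (b). The claim is |e_i G|^b = |e_i η G|^a for every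
finite G. Both sides are multiplicative in exact sequences, so G may be a simple module V. Ideal
theory of maximal orders gives a non zero divisor y such that R/Ry is nonzero, finite, and has only
V as composition factor (`exists_uniform_quotient`). For R/Ry the claim holds because right
multiplication by y has the same index on commensurable lattices (`smulCard_quotient_pow_eq`);
extracting a root gives it for V. For the converse direction, a finite module on which only e_i acts
nontrivially determines v_i. -/

set_option linter.unusedSectionVars false

/-! ### Two-sided ideals of maximal orders: primes, inverses, factorization -/

section MaximalOrders

variable {A : Type*} [Ring A] [Algebra ℚ A]

/-- The subgroup `n Λ`. -/
def scaled (n : ℕ) (Λ : Submodule ℤ A) : Submodule ℤ A := Λ.map ((n : ℤ) • LinearMap.id)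

theorem mem_scaled {n : ℕ} {Λ : Submodule ℤ A} {x : A} :
    x ∈ scaled n Λ ↔ ∃ y ∈ Λ, n • y = x := by
  simp [scaled]

theorem scaled_le (n : ℕ) (Λ : Submodule ℤ A) : scaled n Λ ≤ Λ := by
  intro x hx
  obtain ⟨y, hy, rfl⟩ := mem_scaled.mp hx
  exact nsmul_mem hy n

/-- `Λ ⊆ f A f` is a subring with identity `f`, finite modulo each positive integer, and maximal
among the subrings of `f A f` that are commensurable with it. -/
structure IsMaxOrder (f : A) (Λ : Submodule ℤ A) : Prop where
  one_mem : f ∈ Λ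
  mul_mem : ∀ x ∈ Λ, ∀ y ∈ Λ, x * y ∈ Λ
  one_mul : ∀ x ∈ Λ, f * x = x
  mul_one : ∀ x ∈ Λ, x * f = x
  fin : ∀ n : ℕ, n ≠ 0 → ∃ s : Set A, s.Finite ∧ ∀ x ∈ Λ, ∃ t ∈ s, x - t ∈ scaled n Λ
  max : ∀ L : Submodule ℤ A, Λ ≤ L → (∀ x ∈ L, ∀ y ∈ L, x * y ∈ L) → (∀ x ∈ L, f * x = x) →
    (∀ x ∈ L, x * f = x) → ∀ n : ℕ, n ≠ 0 → (∀ x ∈ L, n • x ∈ Λ) → L ≤ Λ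

/-- A two-sided ideal of `Λ` of full rank. -/
structure IsFullIdeal (Λ I : Submodule ℤ A) : Prop where
  le : I ≤ Λ
  left : ∀ r ∈ Λ, ∀ x ∈ I, r * x ∈ I
  right : ∀ r ∈ Λ, ∀ x ∈ I, x * r ∈ I
  full : ∃ n : ℕ, n ≠ 0 ∧ scaled n Λ ≤ I

/-- A maximal two-sided ideal of `Λ` of full rank. -/
structure IsMaxIdeal (Λ M : Submodule ℤ A) : Prop extends IsFullIdeal Λ M where
  ne : M ≠ Λ
  eq_or : ∀ I, IsFullIdeal Λ I → M ≤ I → I = M ∨ I = Λ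

theorem nsmul_inv_smul {n : ℕ} (hn : n ≠ 0) (x : A) : n • ((n : ℚ)⁻¹ • x) = x := by
  rw [← Nat.cast_smul_eq_nsmul ℚ, smul_smul, mul_inv_cancel₀ (by exact_mod_cast hn), one_smul]

theorem inv_smul_nsmul {n : ℕ} (hn : n ≠ 0) (x : A) : (n : ℚ)⁻¹ • (n • x) = x := by
  rw [← Nat.cast_smul_eq_nsmul ℚ, smul_smul, inv_mul_cancel₀ (by exact_mod_cast hn), one_smul]

variable {f : A} {Λ : Submodule ℤ A}

namespace IsMaxOrder

theorem idem (h : IsMaxOrder f Λ) : f * f = f := h.one_mul f h.one_mem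

/-- The x with x I ⊆ I form a ring containing Λ, commensurable with Λ because n f ∈ I gives n x ∈ I.
Maximality leaves only Λ. -/
theorem leftOrder (h : IsMaxOrder f Λ) {I : Submodule ℤ A} (hI : IsFullIdeal Λ I) {x : A}
    (h1 : f * x = x) (h2 : x * f = x) (hx : ∀ t ∈ I, x * t ∈ I) : x ∈ Λ := by
  obtain ⟨n, hn, hnI⟩ := hI.full
  let L : Submodule ℤ A :=
    { carrier := {x | f * x = x ∧ x * f = x ∧ ∀ t ∈ I, x * t ∈ I}
      zero_mem' := ⟨by simp, by simp, fun t _ => by simp⟩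
      add_mem' := fun {a b} ha hb => ⟨by rw [mul_add, ha.1, hb.1], by rw [add_mul, ha.2.1, hb.2.1],
        fun t ht => by rw [add_mul]; exact add_mem (ha.2.2 t ht) (hb.2.2 t ht)⟩
      smul_mem' := fun c a ha => ⟨by rw [mul_smul_comm, ha.1], by rw [smul_mul_assoc, ha.2.1],
        fun t ht => by rw [smul_mul_assoc]; exact I.smul_mem c (ha.2.2 t ht)⟩ }
  refine h.max L (fun r hr => ⟨h.one_mul r hr, h.mul_one r hr, hI.left r hr⟩)
    (fun a ha b hb => ⟨by rw [← mul_assoc, ha.1], by rw [mul_assoc, hb.2.1],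
      fun t ht => by rw [mul_assoc]; exact ha.2.2 _ (hb.2.2 t ht)⟩)
    (fun a ha => ha.1) (fun a ha => ha.2.1) n hn (fun a ha => ?_) ⟨h1, h2, hx⟩
  have : n • a = a * (n • f) := by rw [mul_smul_comm, ha.2.1]
  rw [this]
  exact hI.le (ha.2.2 _ (hnI (mem_scaled.mpr ⟨f, h.one_mem, rfl⟩)))

theorem rightOrder (h : IsMaxOrder f Λ) {I : Submodule ℤ A} (hI : IsFullIdeal Λ I) {x : A}
    (h1 : f * x = x) (h2 : x * f = x) (hx : ∀ t ∈ I, t * x ∈ I) : x ∈ Λ := by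
  obtain ⟨n, hn, hnI⟩ := hI.full
  let L : Submodule ℤ A :=
    { carrier := {x | f * x = x ∧ x * f = x ∧ ∀ t ∈ I, t * x ∈ I}
      zero_mem' := ⟨by simp, by simp, fun t _ => by simp⟩
      add_mem' := fun {a b} ha hb => ⟨by rw [mul_add, ha.1, hb.1], by rw [add_mul, ha.2.1, hb.2.1],
        fun t ht => by rw [mul_add]; exact add_mem (ha.2.2 t ht) (hb.2.2 t ht)⟩
      smul_mem' := fun c a ha => ⟨by rw [mul_smul_comm, ha.1], by rw [smul_mul_assoc, ha.2.1],
        fun t ht => by rw [mul_smul_comm]; exact I.smul_mem c (ha.2.2 t ht)⟩ }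
  refine h.max L (fun r hr => ⟨h.one_mul r hr, h.mul_one r hr, hI.right r hr⟩)
    (fun a ha b hb => ⟨by rw [← mul_assoc, ha.1], by rw [mul_assoc, hb.2.1],
      fun t ht => by rw [← mul_assoc]; exact hb.2.2 _ (ha.2.2 t ht)⟩)
    (fun a ha => ha.1) (fun a ha => ha.2.1) n hn (fun a ha => ?_) ⟨h1, h2, hx⟩
  have : n • a = (n • f) * a := by rw [smul_mul_assoc, ha.1]
  rw [this]
  exact hI.le (ha.2.2 _ (hnI (mem_scaled.mpr ⟨f, h.one_mem, rfl⟩)))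

theorem isFullIdeal_self (h : IsMaxOrder f Λ) : IsFullIdeal Λ Λ :=
  ⟨le_rfl, h.mul_mem, fun r hr x hx => h.mul_mem x hx r hr, 1, one_ne_zero, scaled_le _ _⟩

theorem isFullIdeal_scaled (h : IsMaxOrder f Λ) {n : ℕ} (hn : n ≠ 0) :
    IsFullIdeal Λ (scaled n Λ) := by
  refine ⟨scaled_le _ _, ?_, ?_, n, hn, le_rfl⟩
  · intro r hr x hx
    obtain ⟨y, hy, rfl⟩ := mem_scaled.mp hx
    exact mem_scaled.mpr ⟨r * y, h.mul_mem r hr y hy, by rw [mul_smul_comm]⟩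
  · intro r hr x hx
    obtain ⟨y, hy, rfl⟩ := mem_scaled.mp hx
    exact mem_scaled.mpr ⟨y * r, h.mul_mem y hy r hr, by rw [smul_mul_assoc]⟩

end IsMaxOrder

namespace IsFullIdeal

variable {I J : Submodule ℤ A}

theorem mul_le_left (hI : IsFullIdeal Λ I) (hJ : J ≤ Λ) : I * J ≤ I :=
  Submodule.mul_le.mpr fun x hx y hy => hI.right y (hJ hy) x hx

theorem mul_le_right (hI : I ≤ Λ) (hJ : IsFullIdeal Λ J) : I * J ≤ J :=
  Submodule.mul_le.mpr fun x hx y hy => hJ.left x (hI hx) y hy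

theorem mul (h : IsMaxOrder f Λ) (hI : IsFullIdeal Λ I) (hJ : IsFullIdeal Λ J) :
    IsFullIdeal Λ (I * J) := by
  obtain ⟨n, hn, hnI⟩ := hI.full
  obtain ⟨m, hm, hmJ⟩ := hJ.full
  refine ⟨(hI.mul_le_left hJ.le).trans hI.le, ?_, ?_, n * m, mul_ne_zero hn hm, ?_⟩
  · intro r hr x hx
    refine Submodule.mul_induction_on hx (fun a ha b hb => ?_) (fun a b ha hb => ?_)
    · rw [← mul_assoc]; exact Submodule.mul_mem_mul (hI.left r hr a ha) hb
    · rw [mul_add]; exact add_mem ha hb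
  · intro r hr x hx
    refine Submodule.mul_induction_on hx (fun a ha b hb => ?_) (fun a b ha hb => ?_)
    · rw [mul_assoc]; exact Submodule.mul_mem_mul ha (hJ.right r hr b hb)
    · rw [add_mul]; exact add_mem ha hb
  · intro x hx
    obtain ⟨y, hy, rfl⟩ := mem_scaled.mp hx
    have : (n * m) • y = (n • f) * (m • y) := by
      rw [smul_mul_assoc, mul_smul_comm, h.one_mul y hy, mul_smul]
    rw [this]
    exact Submodule.mul_mem_mul (hnI (mem_scaled.mpr ⟨f, h.one_mem, rfl⟩))
      (hmJ (mem_scaled.mpr ⟨y, hy, rfl⟩))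

theorem sup (hI : IsFullIdeal Λ I) (hJ : IsFullIdeal Λ J) : IsFullIdeal Λ (I ⊔ J) := by
  refine ⟨sup_le hI.le hJ.le, ?_, ?_, ?_⟩
  · intro r hr x hx
    obtain ⟨a, ha, b, hb, rfl⟩ := Submodule.mem_sup.mp hx
    rw [mul_add]
    exact Submodule.add_mem_sup (hI.left r hr a ha) (hJ.left r hr b hb)
  · intro r hr x hx
    obtain ⟨a, ha, b, hb, rfl⟩ := Submodule.mem_sup.mp hx
    rw [add_mul]
    exact Submodule.add_mem_sup (hI.right r hr a ha) (hJ.right r hr b hb)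
  · obtain ⟨n, hn, h⟩ := hI.full
    exact ⟨n, hn, h.trans le_sup_left⟩

theorem eq_of_one_mem (h : IsMaxOrder f Λ) (hI : IsFullIdeal Λ I) (hf : f ∈ I) : I = Λ :=
  le_antisymm hI.le fun x hx => by rw [← h.mul_one x hx]; exact hI.left x hx f hf

theorem mul_self_order (h : IsMaxOrder f Λ) (hI : IsFullIdeal Λ I) : I * Λ = I :=
  le_antisymm (hI.mul_le_left le_rfl) fun x hx => by
    rw [← h.mul_one x (hI.le hx)]; exact Submodule.mul_mem_mul hx h.one_mem

theorem order_mul_self (h : IsMaxOrder f Λ) (hI : IsFullIdeal Λ I) : Λ * I = I :=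
  le_antisymm (mul_le_right le_rfl hI) fun x hx => by
    rw [← h.one_mul x (hI.le hx)]; exact Submodule.mul_mem_mul h.one_mem hx

end IsFullIdeal

theorem IsMaxIdeal.sup_eq {M I : Submodule ℤ A} (hM : IsMaxIdeal Λ M) (hI : IsFullIdeal Λ I)
    (h : ¬ I ≤ M) : I ⊔ M = Λ := by
  refine (hM.eq_or _ (hI.sup hM.1) le_sup_right).resolve_left fun h' => h ?_
  rw [← h']
  exact le_sup_left

/-- If I is not inside M then f = b + m with b ∈ I, m ∈ M, and c = b c + m c lies in M for every c ∈
J. -/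
theorem IsMaxIdeal.prime (h : IsMaxOrder f Λ) {M I J : Submodule ℤ A} (hM : IsMaxIdeal Λ M)
    (hI : IsFullIdeal Λ I) (hJ : J ≤ Λ) (hIJ : I * J ≤ M) : I ≤ M ∨ J ≤ M := by
  by_contra! hc
  have h1 := hM.sup_eq hI hc.1
  obtain ⟨b, hb, m, hm, hbm⟩ := Submodule.mem_sup.mp (h1.symm ▸ h.one_mem : f ∈ I ⊔ M)
  refine hc.2 fun c hc => ?_
  rw [← h.one_mul c (hJ hc), ← hbm, add_mul]
  exact add_mem (hIJ (Submodule.mul_mem_mul hb hc)) (hM.right c (hJ hc) m hm)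

theorem IsMaxIdeal.eq_of_le {M N : Submodule ℤ A} (hM : IsMaxIdeal Λ M) (hN : IsMaxIdeal Λ N)
    (h : M ≤ N) : N = M :=
  (hM.eq_or N hN.1 h).resolve_right hN.ne

/-- An ideal acting nontrivially on a simple left module contains an element acting as `1`. -/
theorem exists_mem_sub_mul_mem (h : IsMaxOrder f Λ) {X' X I : Submodule ℤ A} {n : ℕ} (hn : n ≠ 0)
    (hX : X ≤ Λ) (hnX : scaled n Λ ≤ X') (hsX : ∀ r ∈ Λ, ∀ x ∈ X, r * x ∈ X)
    (hsX' : ∀ r ∈ Λ, ∀ x ∈ X', r * x ∈ X') (hlt : X' ≤ X)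
    (hcov : ∀ Y : Submodule ℤ A, X' ≤ Y → Y ≤ X → (∀ r ∈ Λ, ∀ x ∈ Y, r * x ∈ Y) → Y = X' ∨ Y = X)
    (hI : IsFullIdeal Λ I) (hIX : ¬ I * X ≤ X') : ∃ k ∈ I, ∀ v ∈ X, v - k * v ∈ X' := by
  have h1 : ∀ v ∈ X, v ∉ X' → ∃ k ∈ I, v - k * v ∈ X' := by
    intro v hv hv'
    let K : Submodule ℤ A :=
      { carrier := {w | w ∈ X ∧ ∀ k ∈ I, k * w ∈ X'}
        zero_mem' := ⟨zero_mem _, fun k _ => by simp⟩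
        add_mem' := fun {a b} ha hb => ⟨add_mem ha.1 hb.1, fun k hk => by
          rw [mul_add]; exact add_mem (ha.2 k hk) (hb.2 k hk)⟩
        smul_mem' := fun c a ha => ⟨X.smul_mem c ha.1, fun k hk => by
          rw [mul_smul_comm]; exact X'.smul_mem c (ha.2 k hk)⟩ }
    -- The elements of X sent into X' by I form a stable submodule between X' and X; it cannot be X
    -- because I X is not inside X'.
    have hK : K = X' := by
      refine (hcov K (fun w hw => ⟨hlt hw, fun k hk => hsX' k (hI.le hk) w hw⟩) (fun w hw => hw.1)
        (fun r hr w hw => ⟨hsX r hr w hw.1, fun k hk => ?_⟩)).resolve_right fun hc => hIX ?_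
      · rw [← mul_assoc]; exact hw.2 _ (hI.right r hr k hk)
      · refine Submodule.mul_le.mpr fun k hk w hw => ?_
        rw [← hc] at hw
        exact hw.2 k hk
    have hvK : v ∉ K := hK ▸ hv'
    let Y : Submodule ℤ A := I.map (LinearMap.mulRight ℤ v) ⊔ X'
    have hY : Y = X := by
      refine (hcov Y le_sup_right (sup_le ?_ hlt) ?_).resolve_left fun hc => hvK ⟨hv, fun k hk => ?_⟩
      · rintro _ ⟨k, hk, rfl⟩
        exact hsX k (hI.le hk) v hv
      · intro r hr x hx
        obtain ⟨_, ⟨k, hk, rfl⟩, b, hb, rfl⟩ := Submodule.mem_sup.mp hx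
        rw [mul_add]
        refine Submodule.add_mem_sup ⟨r * k, hI.left r hr k hk, ?_⟩ (hsX' r hr b hb)
        simp [mul_assoc]
      · rw [← hc]
        exact Submodule.mem_sup_left ⟨k, hk, by simp⟩
    obtain ⟨_, ⟨k, hk, rfl⟩, b, hb, hkb⟩ := Submodule.mem_sup.mp (hY.symm ▸ hv : v ∈ Y)
    refine ⟨k, hk, ?_⟩
    have : v - k * v = b := by
      rw [sub_eq_iff_eq_add']; simpa using hkb.symm
    rwa [this]
  obtain ⟨s, hs, hsΛ⟩ := h.fin n hn
  -- Elements acting as 1 on more and more vectors are combined by 1 - k'' = (1 - k')(1 - k), that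
  -- is, k'' = k' + k - k' k.
  have h2 : ∀ s : Set A, s.Finite → s ⊆ X → ∃ k ∈ I, ∀ v ∈ s, v - k * v ∈ X' := by
    intro s hs
    induction s, hs using Set.Finite.induction_on with
    | empty => exact fun _ => ⟨0, zero_mem _, by simp⟩
    | @insert a s _ _ ih =>
      intro hsX2
      obtain ⟨k, hk, hks⟩ := ih ((Set.subset_insert _ _).trans hsX2)
      have haX := hsX2 (Set.mem_insert _ _)
      have hwX : a - k * a ∈ X := sub_mem haX (hsX k (hI.le hk) a haX)
      by_cases hw : a - k * a ∈ X'
      · refine ⟨k, hk, fun v hv => ?_⟩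
        rcases hv with rfl | hv
        · exact hw
        · exact hks v hv
      · obtain ⟨k', hk', hk'w⟩ := h1 _ hwX hw
        refine ⟨k' + k - k' * k, sub_mem (add_mem hk' hk) (hI.left _ (hI.le hk') _ hk), ?_⟩
        have key : ∀ v, v - (k' + k - k' * k) * v = (v - k * v) - k' * (v - k * v) := by
          intro v; noncomm_ring
        intro v hv
        rw [key]
        rcases hv with rfl | hv
        · exact hk'w
        · exact sub_mem (hks v hv) (hsX' _ (hI.le hk') _ (hks v hv))
  -- The finitely many representatives of Λ modulo n need not lie in X; each class that meets X gets
  -- a representative inside X.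
  have hchoice : ∀ t : A, ∃ u ∈ X, (∃ v ∈ X, v - t ∈ scaled n Λ) → u - t ∈ scaled n Λ := by
    intro t
    by_cases ht : ∃ v ∈ X, v - t ∈ scaled n Λ
    · obtain ⟨v, hv, hvt⟩ := ht
      exact ⟨v, hv, fun _ => hvt⟩
    · exact ⟨0, zero_mem _, fun h => absurd h ht⟩
  choose u hu hut using hchoice
  obtain ⟨k, hk, hks⟩ := h2 (u '' s) (hs.image u) (by rintro _ ⟨t, _, rfl⟩; exact hu t)
  refine ⟨k, hk, fun v hv => ?_⟩
  obtain ⟨t, ht, hvt⟩ := hsΛ v (hX hv)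
  have h3 : v - u t ∈ X' := by
    have := sub_mem hvt (hut t ⟨v, hv, hvt⟩)
    rw [sub_sub_sub_cancel_right] at this
    exact hnX this
  have : v - k * v = (u t - k * u t) + ((v - u t) - k * (v - u t)) := by noncomm_ring
  rw [this]
  exact add_mem (hks _ ⟨t, ht, rfl⟩) (sub_mem h3 (hsX' k (hI.le hk) _ h3))

/-- The annihilator of a simple left module is a maximal two-sided ideal. -/
theorem isMaxIdeal_of_annihilator (h : IsMaxOrder f Λ) {X' X M : Submodule ℤ A} {n : ℕ} (hn : n ≠ 0)
    (hX : X ≤ Λ) (hnX : scaled n Λ ≤ X') (hsX : ∀ r ∈ Λ, ∀ x ∈ X, r * x ∈ X)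
    (hsX' : ∀ r ∈ Λ, ∀ x ∈ X', r * x ∈ X') (hlt : X' < X)
    (hcov : ∀ Y : Submodule ℤ A, X' ≤ Y → Y ≤ X → (∀ r ∈ Λ, ∀ x ∈ Y, r * x ∈ Y) → Y = X' ∨ Y = X)
    (hM : ∀ r, r ∈ M ↔ r ∈ Λ ∧ ∀ x ∈ X, r * x ∈ X') : IsMaxIdeal Λ M := by
  refine ⟨⟨fun r hr => ((hM r).mp hr).1, ?_, ?_, n, hn, ?_⟩, ?_, ?_⟩
  · intro r hr x hx
    rw [hM] at hx ⊢
    exact ⟨h.mul_mem r hr x hx.1, fun y hy => by rw [mul_assoc]; exact hsX' r hr _ (hx.2 y hy)⟩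
  · intro r hr x hx
    rw [hM] at hx ⊢
    exact ⟨h.mul_mem x hx.1 r hr, fun y hy => by rw [mul_assoc]; exact hx.2 _ (hsX r hr y hy)⟩
  · intro x hx
    rw [hM]
    exact ⟨scaled_le _ _ hx, fun y hy => hnX ((h.isFullIdeal_scaled hn).right y (hX hy) x hx)⟩
  · intro hc
    refine hlt.not_ge fun x hx => ?_
    rw [← h.one_mul x (hX hx)]
    exact ((hM f).mp (hc ▸ h.one_mem)).2 x hx
  · intro I hI hMI
    by_cases hIX : I * X ≤ X'
    · left
      exact le_antisymm (fun r hr => (hM r).mpr ⟨hI.le hr, fun x hx =>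
        hIX (Submodule.mul_mem_mul hr hx)⟩) hMI
    · right
      obtain ⟨k, hk, hkX⟩ := exists_mem_sub_mul_mem h hn hX hnX hsX hsX' hlt.le hcov hI hIX
      refine hI.eq_of_one_mem h ?_
      -- An element k of I acts as 1 on the simple module, so f - k annihilates it and f = (f - k) +
      -- k ∈ I.
      have : f - k ∈ M := (hM _).mpr ⟨sub_mem h.one_mem (hI.le hk), fun x hx => by
        rw [sub_mul, h.one_mul x (hX hx)]; exact hkX x hx⟩
      have := add_mem (hMI this) hk
      rwa [sub_add_cancel] at this

/-- Such a subgroup is determined by the classes modulo n that it meets. This gives both chain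
conditions used below. -/
theorem IsMaxOrder.finite_between (h : IsMaxOrder f Λ) {n : ℕ} (hn : n ≠ 0) :
    Finite {X : Submodule ℤ A // scaled n Λ ≤ X ∧ X ≤ Λ} := by
  obtain ⟨s, hs, hsΛ⟩ := h.fin n hn
  have := hs.finite_subsets.to_subtype
  let g : {X : Submodule ℤ A // scaled n Λ ≤ X ∧ X ≤ Λ} → {t : Set A | t ⊆ s} :=
    fun X => ⟨{t | t ∈ s ∧ ∃ x ∈ X.1, x - t ∈ scaled n Λ}, fun t ht => ht.1⟩
  refine Finite.of_injective g ?_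
  have key : ∀ X Y, g X = g Y → X.1 ≤ Y.1 := by
    intro X Y hXY x hx
    obtain ⟨t, ht, hxt⟩ := hsΛ x (X.2.2 hx)
    have h1 : t ∈ (g X).1 := ⟨ht, x, hx, hxt⟩
    rw [hXY] at h1
    obtain ⟨-, y, hy, hyt⟩ := h1
    have h2 := Y.2.1 (sub_mem hxt hyt)
    rw [sub_sub_sub_cancel_right] at h2
    have := add_mem h2 hy
    rwa [sub_add_cancel] at this
  intro X Y hXY
  exact Subtype.ext (le_antisymm (key X Y hXY) (key Y X hXY.symm))

/-- A composition series of X modulo n: each simple factor is killed by its annihilator, a maximal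
two-sided ideal, and the product of these annihilators kills everything. -/
theorem exists_list_mul_le (h : IsMaxOrder f Λ) {n : ℕ} (hn : n ≠ 0) (X : Submodule ℤ A)
    (hnX : scaled n Λ ≤ X) (hX : X ≤ Λ) (hsX : ∀ r ∈ Λ, ∀ x ∈ X, r * x ∈ X) :
    ∃ l : List (Submodule ℤ A), (∀ M ∈ l, IsMaxIdeal Λ M) ∧ l.prod * X ≤ scaled n Λ := by
  have := h.finite_between hn
  suffices H : ∀ X : {X : Submodule ℤ A // scaled n Λ ≤ X ∧ X ≤ Λ},
      (∀ r ∈ Λ, ∀ x ∈ X.1, r * x ∈ X.1) →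
      ∃ l : List (Submodule ℤ A), (∀ M ∈ l, IsMaxIdeal Λ M) ∧ l.prod * X.1 ≤ scaled n Λ from
    H ⟨X, hnX, hX⟩ hsX
  intro X
  induction X using WellFoundedLT.induction with
  | ind X ih =>
    intro hsX
    by_cases hXn : X.1 = scaled n Λ
    · exact ⟨[], by simp, by simp [hXn]⟩
    obtain ⟨X', ⟨hX'X, hsX'⟩, hmax⟩ := wellFounded_gt.has_min
      {X' : {X : Submodule ℤ A // scaled n Λ ≤ X ∧ X ≤ Λ} |
        X' < X ∧ ∀ r ∈ Λ, ∀ x ∈ X'.1, r * x ∈ X'.1}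
      ⟨⟨scaled n Λ, le_rfl, scaled_le _ _⟩, lt_of_le_of_ne X.2.1
        (fun hc => hXn (congrArg Subtype.val hc).symm), (h.isFullIdeal_scaled hn).left⟩
    obtain ⟨l, hl, hlX⟩ := ih X' hX'X hsX'
    let M : Submodule ℤ A :=
      { carrier := {r | r ∈ Λ ∧ ∀ x ∈ X.1, r * x ∈ X'.1}
        zero_mem' := ⟨zero_mem _, fun x _ => by simp⟩
        add_mem' := fun {a b} ha hb => ⟨add_mem ha.1 hb.1, fun x hx => by
          rw [add_mul]; exact add_mem (ha.2 x hx) (hb.2 x hx)⟩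
        smul_mem' := fun c a ha => ⟨Λ.smul_mem c ha.1, fun x hx => by
          rw [smul_mul_assoc]; exact X'.1.smul_mem c (ha.2 x hx)⟩ }
    have hM : IsMaxIdeal Λ M := by
      refine isMaxIdeal_of_annihilator h hn X.2.2 X'.2.1 hsX hsX' hX'X ?_ (fun r => Iff.rfl)
      intro Y hX'Y hYX hsY
      by_contra! hc
      exact hmax ⟨Y, X'.2.1.trans hX'Y, hYX.trans X.2.2⟩ ⟨lt_of_le_of_ne hYX
        (fun hc' => hc.2 (congrArg Subtype.val hc')), hsY⟩ (lt_of_le_of_ne hX'Y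
        (fun hc' => hc.1 (congrArg Subtype.val hc').symm))
    refine ⟨l ++ [M], ?_, ?_⟩
    · intro N hN
      rcases List.mem_append.mp hN with hN | hN
      · exact hl N hN
      · rw [List.mem_singleton.mp hN]; exact hM
    · rw [List.prod_append, List.prod_singleton, mul_assoc]
      refine le_trans (mul_le_mul_right ?_ _) hlX
      exact Submodule.mul_le.mpr fun r hr x hx => hr.2 x hx

/-- The trailing factor Λ is needed since the empty product of submodules is ℤ · 1 and not Λ. -/
theorem IsFullIdeal.listProd (h : IsMaxOrder f Λ) (l : List (Submodule ℤ A))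
    (hl : ∀ M ∈ l, IsMaxIdeal Λ M) : IsFullIdeal Λ (l.prod * Λ) := by
  induction l with
  | nil => simpa using h.isFullIdeal_self
  | cons M l ih =>
    rw [List.prod_cons, mul_assoc]
    exact (hl M (by simp)).1.mul h (ih fun N hN => hl N (by simp [hN]))

theorem IsMaxIdeal.mem_of_listProd_le (h : IsMaxOrder f Λ) {M : Submodule ℤ A}
    (hM : IsMaxIdeal Λ M) (l : List (Submodule ℤ A)) (hl : ∀ M ∈ l, IsMaxIdeal Λ M)
    (hlM : l.prod * Λ ≤ M) : M ∈ l := by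
  induction l with
  | nil => exact absurd (le_antisymm hM.le (by simpa using hlM)) hM.ne
  | cons N l ih =>
    have hl' : ∀ M ∈ l, IsMaxIdeal Λ M := fun N hN => hl N (by simp [hN])
    rw [List.prod_cons, mul_assoc] at hlM
    rcases hM.prime h (hl N (by simp)).1 (IsFullIdeal.listProd h l hl').le hlM with h1 | h1
    · rw [(hl N (by simp)).eq_of_le hM h1]; simp
    · exact List.mem_cons_of_mem _ (ih hl' h1)

/-- A maximal two-sided ideal of a maximal order has a nontrivial inverse. -/
theorem IsMaxIdeal.exists_notMem (h : IsMaxOrder f Λ) {M : Submodule ℤ A} (hM : IsMaxIdeal Λ M) :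
    ∃ x, x ∉ Λ ∧ f * x = x ∧ x * f = x ∧ ∀ m ∈ M, x * m ∈ Λ ∧ m * x ∈ Λ := by
  classical
  obtain ⟨n, hn, hnM⟩ := hM.full
  -- A shortest product of maximal ideals inside nΛ. Since nΛ ⊆ M, primeness makes M one of the
  -- factors, so the product reads B M C, while C B is shorter and so not inside nΛ.
  have hex : ∃ k, ∃ l : List (Submodule ℤ A), l.length = k ∧ (∀ M ∈ l, IsMaxIdeal Λ M) ∧
      l.prod * Λ ≤ scaled n Λ := by
    obtain ⟨l, hl, hl'⟩ := exists_list_mul_le h hn Λ (scaled_le _ _) le_rfl h.mul_mem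
    exact ⟨_, l, rfl, hl, hl'⟩
  obtain ⟨l, hlen, hl, hln⟩ := Nat.find_spec hex
  have hmin : ∀ l' : List (Submodule ℤ A), l'.length < l.length → (∀ M ∈ l', IsMaxIdeal Λ M) →
      ¬ l'.prod * Λ ≤ scaled n Λ := fun l' h1 h2 h3 =>
    Nat.find_min hex (hlen ▸ h1) ⟨l', rfl, h2, h3⟩
  have hMl := hM.mem_of_listProd_le h l hl (hln.trans hnM)
  obtain ⟨l₁, l₂, rfl⟩ := List.append_of_mem hMl
  have hl₁ : ∀ M ∈ l₁, IsMaxIdeal Λ M := fun N hN => hl N (by simp [hN])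
  have hl₂ : ∀ M ∈ l₂, IsMaxIdeal Λ M := fun N hN => hl N (by simp [hN])
  have hB := IsFullIdeal.listProd h l₁ hl₁
  have hC := IsFullIdeal.listProd h l₂ hl₂
  set B := l₁.prod * Λ with hBdef
  set C := l₂.prod * Λ with hCdef
  have hBMC : B * M * C ≤ scaled n Λ := by
    refine le_trans (le_of_eq ?_) hln
    rw [hBdef, mul_assoc l₁.prod, hM.1.order_mul_self h, hCdef, List.prod_append, List.prod_cons]
    simp only [mul_assoc]
  have hCB : ¬ C * B ≤ scaled n Λ := by
    have := hmin (l₂ ++ l₁) (by simp; omega) (fun N hN => (List.mem_append.mp hN).elim (hl₂ N) (hl₁ N))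
    rwa [List.prod_append, mul_assoc, ← hBdef, ← hB.order_mul_self h, ← mul_assoc, ← hCdef] at this
  obtain ⟨w, hw, hwn⟩ := SetLike.not_le_iff_exists.mp hCB
  have hwΛ : w ∈ Λ := (hC.mul h hB).le hw
  have hf1 : ∀ {y : A}, f * y = y → f * ((n : ℚ)⁻¹ • y) = (n : ℚ)⁻¹ • y := fun h => by
    rw [mul_smul_comm, h]
  have hf2 : ∀ {y : A}, y * f = y → ((n : ℚ)⁻¹ • y) * f = (n : ℚ)⁻¹ • y := fun h => by
    rw [smul_mul_assoc, h]
  -- For w ∈ C B outside nΛ, the element w/n works: (w m) C ⊆ C (B M C) ⊆ n C puts (w/n) m in the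
  -- left order of C, and B (m w) ⊆ (B M C) B ⊆ n B puts m (w/n) in the right order of B.
  refine ⟨(n : ℚ)⁻¹ • w, fun hc => hwn (mem_scaled.mpr ⟨_, hc, nsmul_inv_smul hn w⟩),
    hf1 (h.one_mul w hwΛ), hf2 (h.mul_one w hwΛ), fun m hm => ⟨?_, ?_⟩⟩
  · rw [smul_mul_assoc]
    have hwm := h.mul_mem w hwΛ m (hM.le hm)
    refine h.leftOrder hC (hf1 (h.one_mul _ hwm)) (hf2 (h.mul_one _ hwm)) fun c hc => ?_
    have h1 : w * m * c ∈ C * scaled n Λ := by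
      have : w * m * c ∈ C * B * M * C :=
        Submodule.mul_mem_mul (Submodule.mul_mem_mul hw hm) hc
      rw [mul_assoc C B M, mul_assoc C] at this
      exact mul_le_mul' le_rfl hBMC this
    have h2 : C * scaled n Λ ≤ scaled n C := by
      refine Submodule.mul_le.mpr fun a ha b hb => ?_
      obtain ⟨b', hb', rfl⟩ := mem_scaled.mp hb
      exact mem_scaled.mpr ⟨a * b', hC.right b' hb' a ha, by rw [mul_smul_comm]⟩
    obtain ⟨d, hd, hdn⟩ := mem_scaled.mp (h2 h1)
    rw [smul_mul_assoc, ← hdn, inv_smul_nsmul hn]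
    exact hd
  · rw [mul_smul_comm]
    have hwm := h.mul_mem m (hM.le hm) w hwΛ
    refine h.rightOrder hB (hf1 (h.one_mul _ hwm)) (hf2 (h.mul_one _ hwm)) fun b hb => ?_
    have h1 : b * (m * w) ∈ scaled n Λ * B := by
      have : b * (m * w) ∈ B * (M * (C * B)) :=
        Submodule.mul_mem_mul hb (Submodule.mul_mem_mul hm hw)
      rw [← mul_assoc M, ← mul_assoc B, ← mul_assoc B] at this
      exact mul_le_mul' hBMC le_rfl this
    have h2 : scaled n Λ * B ≤ scaled n B := by
      refine Submodule.mul_le.mpr fun a ha b hb => ?_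
      obtain ⟨a', ha', rfl⟩ := mem_scaled.mp ha
      exact mem_scaled.mpr ⟨a' * b, hB.left a' ha' b hb, by rw [smul_mul_assoc]⟩
    obtain ⟨d, hd, hdn⟩ := mem_scaled.mp (h2 h1)
    rw [mul_smul_comm, ← hdn, inv_smul_nsmul hn]
    exact hd

theorem IsFullIdeal.exists_le_isMaxIdeal (h : IsMaxOrder f Λ) {I : Submodule ℤ A}
    (hI : IsFullIdeal Λ I) (hf : f ∉ I) : ∃ M, I ≤ M ∧ IsMaxIdeal Λ M := by
  obtain ⟨n, hn, hnI⟩ := hI.full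
  have := h.finite_between hn
  obtain ⟨M, ⟨hM, hIM, hfM⟩, hmax⟩ := wellFounded_gt.has_min
    {M : {X : Submodule ℤ A // scaled n Λ ≤ X ∧ X ≤ Λ} | IsFullIdeal Λ M.1 ∧ I ≤ M.1 ∧ f ∉ M.1}
    ⟨⟨I, hnI, hI.le⟩, hI, le_rfl, hf⟩
  refine ⟨M.1, hIM, hM, fun hc => hfM (hc.symm.le h.one_mem), fun J hJ hMJ => ?_⟩
  by_contra! hc
  exact hmax ⟨J, M.2.1.trans hMJ, hJ.le⟩ ⟨hJ, hIM.trans hMJ, fun hfJ => hc.2 (hJ.eq_of_one_mem h hfJ)⟩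
    (lt_of_le_of_ne hMJ fun hc' => hc.1 (congrArg Subtype.val hc').symm)

/-- A full ideal of a maximal order with trivial left inverse is the unit ideal. -/
theorem IsFullIdeal.one_mem_of_forall (h : IsMaxOrder f Λ) {T : Submodule ℤ A}
    (hT : IsFullIdeal Λ T)
    (hinv : ∀ x, f * x = x → x * f = x → (∀ t ∈ T, x * t ∈ Λ) → x ∈ Λ) : f ∈ T := by
  by_contra hf
  obtain ⟨M, hTM, hM⟩ := hT.exists_le_isMaxIdeal h hf
  obtain ⟨x, hx, h1, h2, h3⟩ := hM.exists_notMem h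
  exact hx (hinv x h1 h2 fun t ht => (h3 t (hTM ht)).1)

/-- The inverse of a two-sided ideal. -/
def idealInv (f : A) (Λ M : Submodule ℤ A) : Submodule ℤ A where
  carrier := {x | f * x = x ∧ x * f = x ∧ ∀ m ∈ M, x * m ∈ Λ ∧ m * x ∈ Λ}
  zero_mem' := ⟨by simp, by simp, fun t _ => by simp⟩
  add_mem' := fun {a b} ha hb => ⟨by rw [mul_add, ha.1, hb.1], by rw [add_mul, ha.2.1, hb.2.1],
    fun t ht => ⟨by rw [add_mul]; exact add_mem (ha.2.2 t ht).1 (hb.2.2 t ht).1,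
      by rw [mul_add]; exact add_mem (ha.2.2 t ht).2 (hb.2.2 t ht).2⟩⟩
  smul_mem' := fun c a ha => ⟨by rw [mul_smul_comm, ha.1], by rw [smul_mul_assoc, ha.2.1],
    fun t ht => ⟨by rw [smul_mul_assoc]; exact Λ.smul_mem c (ha.2.2 t ht).1,
      by rw [mul_smul_comm]; exact Λ.smul_mem c (ha.2.2 t ht).2⟩⟩

namespace IsMaxIdeal

variable {M N : Submodule ℤ A}

theorem order_le_idealInv (h : IsMaxOrder f Λ) (hM : IsMaxIdeal Λ M) : Λ ≤ idealInv f Λ M :=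
  fun r hr => ⟨h.one_mul r hr, h.mul_one r hr, fun m hm =>
    ⟨hM.le (hM.left r hr m hm), hM.le (hM.right r hr m hm)⟩⟩

theorem idealInv_left (h : IsMaxOrder f Λ) (hM : IsMaxIdeal Λ M) {r x : A} (hr : r ∈ Λ)
    (hx : x ∈ idealInv f Λ M) : r * x ∈ idealInv f Λ M :=
  ⟨by rw [← mul_assoc, h.one_mul r hr], by rw [mul_assoc, hx.2.1], fun m hm =>
    ⟨by rw [mul_assoc]; exact h.mul_mem r hr _ (hx.2.2 m hm).1,
      by rw [← mul_assoc]; exact (hx.2.2 _ (hM.right r hr m hm)).2⟩⟩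

theorem idealInv_right (h : IsMaxOrder f Λ) (hM : IsMaxIdeal Λ M) {r x : A} (hr : r ∈ Λ)
    (hx : x ∈ idealInv f Λ M) : x * r ∈ idealInv f Λ M :=
  ⟨by rw [← mul_assoc, hx.1], by rw [mul_assoc, h.mul_one r hr], fun m hm =>
    ⟨by rw [mul_assoc]; exact (hx.2.2 _ (hM.left r hr m hm)).1,
      by rw [← mul_assoc]; exact h.mul_mem _ (hx.2.2 m hm).2 r hr⟩⟩

/-- The product is an ideal between M and Λ. Were it M, the inverse would lie in the right order of
M, which is Λ, against `exists_notMem`. -/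
theorem mul_idealInv (h : IsMaxOrder f Λ) (hM : IsMaxIdeal Λ M) : M * idealInv f Λ M = Λ := by
  have hle : M * idealInv f Λ M ≤ Λ := Submodule.mul_le.mpr fun m hm x hx => (hx.2.2 m hm).2
  have hMle : M ≤ M * idealInv f Λ M := fun m hm => by
    rw [← h.mul_one m (hM.le hm)]
    exact Submodule.mul_mem_mul hm (hM.order_le_idealInv h h.one_mem)
  obtain ⟨n, hn, hnM⟩ := hM.full
  refine (hM.eq_or _ ⟨hle, ?_, ?_, n, hn, hnM.trans hMle⟩ hMle).resolve_left fun hc => ?_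
  · intro r hr x hx
    refine Submodule.mul_induction_on hx (fun a ha b hb => ?_) (fun a b ha hb => ?_)
    · rw [← mul_assoc]; exact Submodule.mul_mem_mul (hM.left r hr a ha) hb
    · rw [mul_add]; exact add_mem ha hb
  · intro r hr x hx
    refine Submodule.mul_induction_on hx (fun a ha b hb => ?_) (fun a b ha hb => ?_)
    · rw [mul_assoc]; exact Submodule.mul_mem_mul ha (hM.idealInv_right h hr hb)
    · rw [add_mul]; exact add_mem ha hb
  · obtain ⟨x, hx, h1, h2, h3⟩ := hM.exists_notMem h
    exact hx (h.rightOrder hM.1 h1 h2 fun t ht => hc.le (Submodule.mul_mem_mul ht ⟨h1, h2, h3⟩))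

theorem idealInv_mul (h : IsMaxOrder f Λ) (hM : IsMaxIdeal Λ M) : idealInv f Λ M * M = Λ := by
  have hle : idealInv f Λ M * M ≤ Λ := Submodule.mul_le.mpr fun x hx m hm => (hx.2.2 m hm).1
  have hMle : M ≤ idealInv f Λ M * M := fun m hm => by
    rw [← h.one_mul m (hM.le hm)]
    exact Submodule.mul_mem_mul (hM.order_le_idealInv h h.one_mem) hm
  obtain ⟨n, hn, hnM⟩ := hM.full
  refine (hM.eq_or _ ⟨hle, ?_, ?_, n, hn, hnM.trans hMle⟩ hMle).resolve_left fun hc => ?_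
  · intro r hr x hx
    refine Submodule.mul_induction_on hx (fun a ha b hb => ?_) (fun a b ha hb => ?_)
    · rw [← mul_assoc]; exact Submodule.mul_mem_mul (hM.idealInv_left h hr ha) hb
    · rw [mul_add]; exact add_mem ha hb
  · intro r hr x hx
    refine Submodule.mul_induction_on hx (fun a ha b hb => ?_) (fun a b ha hb => ?_)
    · rw [mul_assoc]; exact Submodule.mul_mem_mul ha (hM.right r hr b hb)
    · rw [add_mul]; exact add_mem ha hb
  · obtain ⟨x, hx, h1, h2, h3⟩ := hM.exists_notMem h
    exact hx (h.leftOrder hM.1 h1 h2 fun t ht => hc.le (Submodule.mul_mem_mul ⟨h1, h2, h3⟩ ht))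

/-- Put D = M N M⁻¹, an ideal with D M = M N ⊆ N. As N is prime and M is not inside N, D ⊆ N;
multiplying by M gives M N ⊆ N M. -/
theorem mul_le_mul_comm (h : IsMaxOrder f Λ) (hM : IsMaxIdeal Λ M) (hN : IsMaxIdeal Λ N)
    (hne : M ≠ N) : M * N ≤ N * M := by
  set K := idealInv f Λ M
  have hD : IsFullIdeal Λ (M * N * K) := by
    obtain ⟨n, hn, hnMN⟩ := (hM.1.mul h hN.1).full
    refine ⟨?_, ?_, ?_, n, hn, ?_⟩
    · calc M * N * K ≤ M * K := mul_le_mul' (hM.1.mul_le_left hN.le) le_rfl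
        _ = Λ := hM.mul_idealInv h
    · intro r hr x hx
      refine Submodule.mul_induction_on hx (fun a ha b hb => ?_) (fun a b ha hb => ?_)
      · rw [← mul_assoc]; exact Submodule.mul_mem_mul ((hM.1.mul h hN.1).left r hr a ha) hb
      · rw [mul_add]; exact add_mem ha hb
    · intro r hr x hx
      refine Submodule.mul_induction_on hx (fun a ha b hb => ?_) (fun a b ha hb => ?_)
      · rw [mul_assoc a]; exact Submodule.mul_mem_mul ha (hM.idealInv_right h hr hb)
      · rw [add_mul]; exact add_mem ha hb
    · intro x hx
      rw [← h.mul_one x (scaled_le _ _ hx)]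
      exact Submodule.mul_mem_mul (hnMN hx) (hM.order_le_idealInv h h.one_mem)
  have hDM : M * N * K * M = M * N := by
    rw [mul_assoc, hM.idealInv_mul h, (hM.1.mul h hN.1).mul_self_order h]
  have hDN : M * N * K ≤ N := by
    refine (hN.prime h hD hM.le ?_).resolve_right fun hc => hne (hM.eq_of_le hN hc).symm
    rw [hDM]
    exact IsFullIdeal.mul_le_right hM.le hN.1
  rw [← hDM]
  exact mul_le_mul' hDN le_rfl

theorem mul_comm (h : IsMaxOrder f Λ) (hM : IsMaxIdeal Λ M) (hN : IsMaxIdeal Λ N)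
    (hne : M ≠ N) : M * N = N * M :=
  le_antisymm (hM.mul_le_mul_comm h hN hne) (hN.mul_le_mul_comm h hM hne.symm)

/-- Distinct maximal ideals commute, so all factors M can be collected on the left; what remains is
coprime to M because M is prime. -/
theorem exists_pow_mul (h : IsMaxOrder f Λ) (hM : IsMaxIdeal Λ M) (l : List (Submodule ℤ A))
    (hl : ∀ N ∈ l, IsMaxIdeal Λ N) : ∃ (a : ℕ) (C : Submodule ℤ A), IsFullIdeal Λ C ∧
      M ^ a * C = l.prod * Λ ∧ M * C = C * M ∧ C ⊔ M = Λ := by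
  classical
  induction l with
  | nil =>
    exact ⟨0, Λ, h.isFullIdeal_self, by simp, by rw [hM.1.mul_self_order h, hM.1.order_mul_self h],
      sup_eq_left.mpr hM.le⟩
  | cons N l ih =>
    obtain ⟨a, C, hC, hprod, hcomm, hsup⟩ := ih fun N hN => hl N (by simp [hN])
    have hN := hl N (by simp)
    rw [List.prod_cons, mul_assoc, ← hprod]
    by_cases hMN : M = N
    · subst hMN
      exact ⟨a + 1, C, hC, by rw [pow_succ', mul_assoc], hcomm, hsup⟩
    · have hMN' : Commute M N := hM.mul_comm h hN hMN
      refine ⟨a, N * C, hN.1.mul h hC, ?_, ?_, hM.sup_eq (hN.1.mul h hC) fun hc => ?_⟩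
      · rw [← mul_assoc, ← mul_assoc, (hMN'.pow_left a).eq]
      · exact hMN'.mul_right hcomm
      · rcases hM.prime h hN.1 hC.le hc with hc | hc
        · exact hMN (hN.eq_of_le hM hc)
        · rw [sup_eq_right.mpr hc] at hsup
          exact hM.ne hsup

theorem sup_pow (h : IsMaxOrder f Λ) {C : Submodule ℤ A} (hM : IsFullIdeal Λ M)
    (hC : IsFullIdeal Λ C) (hsup : C ⊔ M = Λ) (a : ℕ) : ∃ c ∈ C, ∃ m ∈ M ^ a * Λ, c + m = f := by
  induction a with
  | zero => exact ⟨0, zero_mem _, f, by simpa using h.one_mem, by simp⟩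
  | succ a ih =>
    obtain ⟨c, hc, m, hm, hcm⟩ := ih
    obtain ⟨c', hc', m', hm', hcm'⟩ := Submodule.mem_sup.mp (hsup.symm ▸ h.one_mem : f ∈ C ⊔ M)
    refine ⟨c' + m' * c, add_mem hc' (hC.left m' (hM.le hm') c hc), m' * m, ?_, ?_⟩
    · rw [pow_succ', mul_assoc]; exact Submodule.mul_mem_mul hm' hm
    · rw [add_assoc, ← mul_add, hcm, h.mul_one m' (hM.le hm'), hcm']

/-- In a maximal order, semilocal over `n`, some power of each maximal two-sided ideal is contained
in a principal left ideal contained in the maximal ideal. -/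
theorem exists_generator (h : IsMaxOrder f Λ) (hM : IsMaxIdeal Λ M) {n : ℕ} (hn : n ≠ 0)
    (hnM : scaled n Λ ≤ M)
    (hNak : ∀ B L : Submodule ℤ A, IsFullIdeal Λ B → (∀ r ∈ Λ, ∀ x ∈ L, r * x ∈ L) → L ≤ Λ →
      B ≤ L ⊔ scaled n B → B ≤ L) :
    ∃ y ∈ M, (∀ r ∈ Λ, ∃ s ∈ Λ, s * y = n • r) ∧ ∃ a : ℕ, ∀ t ∈ M ^ a * Λ, ∃ s ∈ Λ, s * y = t := by
  -- Modulo n, the ideals M^a and C are coprime with product zero, so Λ/n splits as a product of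
  -- rings. The M-component of 1 is cut out by an idempotent, and Nakayama's lemma lifts the
  -- resulting generator of B = M^a Λ + nΛ.
  obtain ⟨l, hl, hln⟩ := exists_list_mul_le h hn Λ (scaled_le _ _) le_rfl h.mul_mem
  obtain ⟨a, C, hC, hprod, hcomm, hsup⟩ := hM.exists_pow_mul h l hl
  rw [← hprod] at hln
  have hMa : IsFullIdeal Λ (M ^ a * Λ) := by
    have := IsFullIdeal.listProd h (List.replicate a M)
      (fun N hN => by rw [(List.mem_replicate.mp hN).2]; exact hM)
    rwa [List.prod_replicate] at this
  have ha : a ≠ 0 := by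
    rintro rfl
    rw [pow_zero, one_mul] at hln
    rw [sup_eq_right.mpr (hln.trans hnM)] at hsup
    exact hM.ne hsup
  have hMaM : M ^ a * Λ ≤ M := by
    obtain ⟨b, rfl⟩ := Nat.exists_eq_succ_of_ne_zero ha
    rw [Nat.succ_eq_add_one, pow_succ, mul_assoc, hM.1.mul_self_order h]
    clear hprod hln hMa ha
    induction b with
    | zero => simp
    | succ b ih =>
      rw [pow_succ', mul_assoc]
      exact (mul_le_mul' le_rfl ih).trans (hM.1.mul_le_left hM.le)
  have hsc := h.isFullIdeal_scaled hn
  set B := M ^ a * Λ ⊔ scaled n Λ with hB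
  have hBI : IsFullIdeal Λ B := hMa.sup hsc
  have hBC : B * C ≤ scaled n Λ := by
    rw [hB, Submodule.sup_mul, mul_assoc, hC.order_mul_self h]
    exact sup_le hln (hsc.mul_le_left hC.le)
  have hCB : C * B ≤ scaled n Λ := by
    have hc : Commute (M ^ a) C := Commute.pow_left hcomm a
    rw [hB, Submodule.mul_sup, ← mul_assoc, ← hc.eq]
    exact sup_le ((mul_le_mul' hln le_rfl).trans (hsc.mul_le_left le_rfl))
      (IsFullIdeal.mul_le_right hC.le hsc)
  obtain ⟨c, hc, b, hb, hcb⟩ := sup_pow h hM.1 hC hsup a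
  have hbB : b ∈ B := Submodule.mem_sup_left hb
  have hbΛ := hBI.le hbB
  have hcΛ := hC.le hc
  have hnB : scaled n Λ ≤ B := le_sup_right
  obtain ⟨c1, hc1, hcb1⟩ := mem_scaled.mp (hBC (Submodule.mul_mem_mul hbB hc))
  -- `x ∈ B²` and `f - x ∈ C²` modulo `n B`
  set x := b * b * (f + c + c) with hx
  have hcf : c * f = c := h.mul_one c hcΛ
  have hbf : b * f = b := h.mul_one b hbΛ
  have hfb : f * b = b := h.one_mul b hbΛ
  have hfc : f * c = c := h.one_mul c hcΛ
  have hfc' : ∀ t, f * (c * t) = c * t := fun t => by rw [← mul_assoc, hfc]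
  have hb' : b = f - c := by rw [← hcb]; abel
  have hcb_comm : c * b = b * c := by rw [hb', mul_sub, sub_mul, hcf, hfc]
  have hxB : x ∈ B := hBI.right _ (add_mem (add_mem h.one_mem hcΛ) hcΛ) _ (hBI.left b hbΛ b hbB)
  -- With c = f - b, x is the usual lift 3b² - 2b³ of an idempotent, so exchanging b and c turns x
  -- into f - x.
  have hfx : f - x = c * c * (f + b + b) := by
    rw [hx, hb']
    have := h.idem
    simp only [mul_add, mul_sub, sub_mul, hcf, hfc, this, mul_assoc]
    abel
  have hnBmem : ∀ u ∈ B, n • u ∈ scaled n B := fun u hu => mem_scaled.mpr ⟨u, hu, rfl⟩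
  have hxC : f - x ∈ C := by
    rw [hfx]
    exact hC.right _ (add_mem (add_mem h.one_mem hbΛ) hbΛ) _ (hC.left c hcΛ c hc)
  -- The summand n f makes Λ y contain n f up to n B, whereas x alone generates only an idempotent
  -- part.
  set y := x + n • f with hy
  have hyB : y ∈ B := add_mem hxB (hnB (mem_scaled.mpr ⟨f, h.one_mem, rfl⟩))
  have hxΛ := hBI.le hxB
  let L : Submodule ℤ A := Λ.map (LinearMap.mulRight ℤ y)
  have hxL : x ∈ L ⊔ scaled n B := by
    -- The error x (f - x) is a multiple of b² c² = n b c₁ c, where b c = n c₁, and so lies in n B.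
    have h1 : x = x * y + (x * (f - x) - n • x) := by
      rw [hy, mul_add, mul_sub, mul_smul_comm, h.mul_one x hxΛ]; abel
    rw [h1]
    refine Submodule.add_mem_sup ⟨x, hxΛ, by simp⟩ (sub_mem ?_ (hnBmem x hxB))
    have h2 : x * (f - x) = (b * b * (c * c)) * ((f + c + c) * (f + b + b)) := by
      rw [hfx, hx, hb']
      simp only [mul_add, add_mul, mul_sub, sub_mul, hcf, hfc, h.idem, mul_assoc, hfc']
    have h3 : b * b * (c * c) = n • (b * c1 * c) := by
      rw [← mul_assoc, mul_assoc b b c, ← hcb1, mul_smul_comm, smul_mul_assoc]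
    rw [h2, h3, smul_mul_assoc]
    refine hnBmem _ (hBI.right _ (h.mul_mem _ ?_ _ ?_) _ (hBI.right c hcΛ _ (hBI.right c1 hc1 b hbB)))
    · exact add_mem (add_mem h.one_mem hcΛ) hcΛ
    · exact add_mem (add_mem h.one_mem hbΛ) hbΛ
  have hnL : n • f ∈ L ⊔ scaled n B := by
    have : n • f = f * y - x := by
      rw [hy, mul_add, mul_smul_comm, h.idem, h.one_mul x hxΛ]; abel
    rw [this]
    exact sub_mem (Submodule.mem_sup_left ⟨f, h.one_mem, by simp⟩) hxL
  have hLs : ∀ r ∈ Λ, ∀ u ∈ L ⊔ scaled n B, r * u ∈ L ⊔ scaled n B := by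
    intro r hr u hu
    obtain ⟨_, ⟨s, hs, rfl⟩, d, hd, rfl⟩ := Submodule.mem_sup.mp hu
    obtain ⟨e, he, rfl⟩ := mem_scaled.mp hd
    rw [mul_add]
    refine Submodule.add_mem_sup ⟨r * s, h.mul_mem r hr s hs, by simp [mul_assoc]⟩ ?_
    rw [mul_smul_comm]
    exact hnBmem _ (hBI.left r hr e he)
  -- Nakayama: u = u x + u (f - x), where x ∈ L + n B and u (f - x) ∈ B C ⊆ nΛ = Λ · n f.
  have hBL : B ≤ L := by
    refine hNak B L hBI ?_ ?_ ?_
    · rintro r hr _ ⟨s, hs, rfl⟩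
      exact ⟨r * s, h.mul_mem r hr s hs, by simp [mul_assoc]⟩
    · rintro _ ⟨s, hs, rfl⟩
      exact h.mul_mem s hs y (hBI.le hyB)
    · intro u hu
      have hu' : u = u * x + u * (f - x) := by
        rw [mul_sub, h.mul_one u (hBI.le hu)]; abel
      rw [hu']
      refine add_mem (hLs u (hBI.le hu) x hxL) ?_
      obtain ⟨d, hd, hdu⟩ := mem_scaled.mp (hBC (Submodule.mul_mem_mul hu hxC))
      rw [← hdu, ← h.mul_one d hd, ← mul_smul_comm]
      exact hLs d hd _ hnL
  refine ⟨y, sup_le hMaM hnM hyB, fun r hr => ?_, a, fun t ht => ?_⟩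
  · obtain ⟨s, hs, hsy⟩ := hBL (hnB (mem_scaled.mpr ⟨r, hr, rfl⟩))
    exact ⟨s, hs, by simpa using hsy⟩
  · obtain ⟨s, hs, hsy⟩ := hBL (Submodule.mem_sup_left ht : t ∈ B)
    exact ⟨s, hs, by simpa using hsy⟩

end IsMaxIdeal

end MaximalOrders

/-! ### Arithmetic of ℤ_S for a finite set of primes -/

section IntegersAtPrimes

variable {S : Set ℕ}

theorem ZS.inv_mem {d : ℤ} (hd : ∀ p ∈ S, p.Prime → ¬ (p : ℤ) ∣ d) : ((d : ℚ)⁻¹) ∈ ZS S := by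
  intro p hp hpp h
  have h1 : ((d : ℚ)⁻¹).den = if d = 0 then 1 else d.natAbs := by
    rw [Rat.inv_intCast_den]
  rw [h1] at h
  split_ifs at h with h0
  · exact hd p hp hpp (by simp [h0])
  · exact hd p hp hpp (Int.natCast_dvd.mpr h)

theorem ZS.den_not_dvd {q : ℚ} (hq : q ∈ ZS S) : ∀ p ∈ S, p.Prime → ¬ (p : ℤ) ∣ q.den :=
  fun p hp hpp h => hq p hp hpp (Int.natCast_dvd_natCast.mp h)

/-- Denominators are units, so an ideal is determined by the integers it contains, and chains of
ideals inject into chains in ℤ. -/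
instance : IsNoetherianRing (ZS S) := by
  have key : ∀ I J : Ideal (ZS S), I.comap (Int.castRingHom (ZS S)) ≤
      J.comap (Int.castRingHom (ZS S)) → I ≤ J := by
    intro I J h x hx
    have hden : ((x.1.den : ℤ) : ℚ)⁻¹ ∈ ZS S := ZS.inv_mem (ZS.den_not_dvd x.2)
    have hden0 : ((x.1.den : ℤ) : ℚ) ≠ 0 := by exact_mod_cast x.1.den_nz
    have h1 : (x.1.num : ZS S) = (x.1.den : ZS S) * x := by
      apply Subtype.ext
      push_cast
      exact (Rat.den_mul_eq_num x.1).symm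
    have h2 : x = ⟨_, hden⟩ * (x.1.num : ZS S) := by
      rw [h1, ← mul_assoc]
      have : (⟨_, hden⟩ : ZS S) * (x.1.den : ZS S) = 1 := by
        apply Subtype.ext
        push_cast
        exact inv_mul_cancel₀ (by exact_mod_cast x.1.den_nz)
      rw [this, one_mul]
    have h3 : x.1.num ∈ J.comap (Int.castRingHom (ZS S)) := h (by
      show ((x.1.num : ℤ) : ZS S) ∈ I
      rw [h1]; exact I.mul_mem_left _ hx)
    rw [h2]
    exact J.mul_mem_left _ h3
  have hmono : StrictMono (fun I : Ideal (ZS S) => I.comap (Int.castRingHom (ZS S))) := by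
    intro I J h
    refine lt_of_le_not_ge (Ideal.comap_mono h.le) fun hc => h.not_ge (key J I hc)
  rw [isNoetherianRing_iff, isNoetherian_iff']
  exact hmono.wellFoundedGT

/-- The product of the elements of a finite set of primes. -/
noncomputable def primeProd (S : Set ℕ) : ℕ := ∏ᶠ p ∈ S, p

theorem primeProd_ne_zero (hS : ∀ p ∈ S, p.Prime) : primeProd S ≠ 0 :=
  finprod_mem_induction (· ≠ 0) one_ne_zero (fun _ _ => mul_ne_zero) fun p hp => (hS p hp).ne_zero

theorem dvd_primeProd (hfin : S.Finite) {p : ℕ} (hp : p ∈ S) : p ∣ primeProd S := by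
  unfold primeProd
  rw [finprod_mem_eq_finite_toFinset_prod _ hfin]
  exact Finset.dvd_prod_of_mem _ (by simpa using hp)

theorem coprime_primeProd (hS : ∀ p ∈ S, p.Prime) {d : ℕ} (hd : ∀ p ∈ S, ¬ p ∣ d) :
    Nat.Coprime d (primeProd S) :=
  finprod_mem_induction (fun n => Nat.Coprime d n) (Nat.coprime_one_right d)
    (fun _ _ => Nat.Coprime.mul_right)
    fun p hp => ((hS p hp).coprime_iff_not_dvd.mpr (hd p hp)).symm

/-- Primes outside S are units of ℤ_S, and those in S divide the product, so n divides a power of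
the product in ℤ_S. -/
theorem exists_primeProd_pow (hfin : S.Finite) {n : ℕ} (hn : n ≠ 0) :
    ∃ (k : ℕ), ∃ r ∈ ZS S, (primeProd S : ℚ) ^ k = n * r := by
  induction n using induction_on_primes with
  | zero => exact absurd rfl hn
  | one => exact ⟨0, 1, one_mem _, by simp⟩
  | prime_mul q m hq ih =>
    obtain ⟨k, r, hr, h⟩ := ih (right_ne_zero_of_mul hn)
    by_cases hqS : q ∈ S
    · obtain ⟨c, hc⟩ := dvd_primeProd hfin hqS
      refine ⟨k + 1, c * r, mul_mem (natCast_mem _ c) hr, ?_⟩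
      rw [pow_succ, h]
      nth_rw 1 [hc]
      push_cast
      ring
    · refine ⟨k, ((q : ℤ) : ℚ)⁻¹ * r, mul_mem (ZS.inv_mem fun p hp hpp h => ?_) hr, ?_⟩
      · rw [Int.natCast_dvd_natCast, Nat.prime_dvd_prime_iff_eq hpp hq] at h
        exact hqS (h ▸ hp)
      · rw [h]
        have : (q : ℚ) ≠ 0 := by exact_mod_cast hq.ne_zero
        push_cast
        field_simp

/-- `ℤ_S / n` is finite. -/
theorem ZS.exists_nat_add (hfin : S.Finite) (hS : ∀ p ∈ S, p.Prime) {n : ℕ} (hn : n ≠ 0) :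
    ∃ m : ℕ, ∀ q : ZS S, ∃ c < m, ∃ r : ZS S, q = (c : ZS S) + n * r := by
  obtain ⟨k, r₀, hr₀, hk⟩ := exists_primeProd_pow hfin hn
  have hm : primeProd S ^ k ≠ 0 := pow_ne_zero _ (primeProd_ne_zero hS)
  refine ⟨primeProd S ^ k, fun q => ?_⟩
  -- With m = `primeProd S ^ k` and u · den + v · m = 1, the fraction num/den is congruent to the
  -- integer num · u modulo m, and m is a multiple of n.
  have hcop : IsCoprime (q.1.den : ℤ) ((primeProd S ^ k : ℕ) : ℤ) :=
    Nat.isCoprime_iff_coprime.mpr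
      ((coprime_primeProd hS fun p hp h => q.2 p hp (hS p hp) h).pow_right k)
  obtain ⟨u, v, huv⟩ := hcop
  have hm' : ((primeProd S ^ k : ℕ) : ℤ) ≠ 0 := by exact_mod_cast hm
  have hc0 := Int.emod_nonneg (q.1.num * u) hm'
  have hc1 := Int.emod_lt_of_pos (q.1.num * u) (show 0 < ((primeProd S ^ k : ℕ) : ℤ) by positivity)
  refine ⟨((q.1.num * u) % ((primeProd S ^ k : ℕ) : ℤ)).toNat, by omega,
    ⟨r₀ * ((q.1.num * v : ℤ) * ((q.1.den : ℤ) : ℚ)⁻¹ + (q.1.num * u / ((primeProd S ^ k : ℕ) : ℤ) : ℤ)),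
      mul_mem hr₀ (add_mem (mul_mem (intCast_mem _ _) (ZS.inv_mem (ZS.den_not_dvd q.2)))
        (intCast_mem _ _))⟩, ?_⟩
  apply Subtype.ext
  have hden : ((q.1.den : ℤ) : ℚ) ≠ 0 := by exact_mod_cast q.1.den_nz
  have e1 : ((((q.1.num * u) % ((primeProd S ^ k : ℕ) : ℤ)).toNat : ℤ) : ℚ) =
      (q.1.num * u : ℤ) - ((primeProd S ^ k : ℕ) : ℤ) * (q.1.num * u / ((primeProd S ^ k : ℕ) : ℤ) : ℤ) := by
    rw [Int.toNat_of_nonneg hc0, Int.emod_def]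
    push_cast
    ring
  have e2 : (q.1 : ℚ) = q.1.num / ((q.1.den : ℤ) : ℚ) := by
    exact_mod_cast (Rat.num_div_den q.1).symm
  have e3 : (u : ℚ) * ((q.1.den : ℤ) : ℚ) + v * ((primeProd S ^ k : ℕ) : ℤ) = 1 := by
    exact_mod_cast congrArg (Int.cast : ℤ → ℚ) huv
  have e4 : (((primeProd S ^ k : ℕ) : ℤ) : ℚ) = n * r₀ := by rw [← hk]; push_cast; rfl
  show q.1 = ((((q.1.num * u) % ((primeProd S ^ k : ℕ) : ℤ)).toNat : ZS S) : ℚ) + ((n : ZS S) : ℚ) * _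
  have e5 : ∀ m : ℕ, ((m : ZS S) : ℚ) = ((m : ℤ) : ℚ) := fun m => by push_cast; rfl
  rw [e5, e5, e1]
  generalize hQ : (q.1.num * u / ((primeProd S ^ k : ℕ) : ℤ)) = Q at *
  have e6 : (q.1 : ℚ) = q.1.num * u + (q.1.num * v * ((q.1.den : ℤ) : ℚ)⁻¹) *
      ((primeProd S ^ k : ℕ) : ℤ) := by
    nth_rw 1 [e2]
    field_simp
    rw [mul_comm ((q.1.den : ℤ) : ℚ) (u : ℚ), e3, mul_one]
  refine e6.trans ?_
  rw [e4]
  push_cast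
  ring

/-- For q ∈ ℤ_S the numerator of 1 + (∏ p) q is prime to S, so this element is a unit. A prime in S
is needed to exclude numerator zero: for empty S the product is 1. -/
theorem primeProd_mem_jacobson (hfin : S.Finite) (hne : S.Nonempty) (hS : ∀ p ∈ S, p.Prime) :
    (primeProd S : ZS S) ∈ Ideal.jacobson (⊥ : Ideal (ZS S)) := by
  rw [Ideal.mem_jacobson_bot]
  intro q
  have hnd : ∀ p ∈ S, p.Prime → ¬ (p : ℤ) ∣ primeProd S * q.1.num + q.1.den := by
    intro p hp hpp h
    refine ZS.den_not_dvd q.2 p hp hpp ?_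
    rwa [Int.dvd_add_right] at h
    exact Dvd.dvd.mul_right (Int.natCast_dvd_natCast.mpr (dvd_primeProd hfin hp)) _
  have h0 : ((primeProd S * q.1.num + q.1.den : ℤ) : ℚ) ≠ 0 := by
    rw [Int.cast_ne_zero]
    intro h
    obtain ⟨p, hp⟩ := hne
    exact hnd p hp (hS p hp) (h ▸ dvd_zero _)
  refine IsUnit.of_mul_eq_one ⟨(q.1.den : ℤ) * _, mul_mem (intCast_mem _ _) (ZS.inv_mem hnd)⟩ ?_
  apply Subtype.ext
  show ((primeProd S : ZS S) * q.1 + 1) * (((q.1.den : ℤ) : ℚ) * _) = 1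
  have e2 : (q.1 : ℚ) = q.1.num / ((q.1.den : ℤ) : ℚ) := by
    exact_mod_cast (Rat.num_div_den q.1).symm
  have hden : ((q.1.den : ℤ) : ℚ) ≠ 0 := by exact_mod_cast q.1.den_nz
  have e5 : ((primeProd S : ZS S) : ℚ) = ((primeProd S : ℤ) : ℚ) := by push_cast; rfl
  rw [e5]
  nth_rw 1 [e2]
  push_cast at h0 ⊢
  field_simp

/-- A finitely generated `ℤ_S`-module is finite modulo each positive integer. -/
theorem Submodule.FG.exists_finite_mod (hfin : S.Finite) (hS : ∀ p ∈ S, p.Prime) {V : Type*}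
    [AddCommGroup V] [Module (ZS S) V] {L : Submodule (ZS S) V} (hL : L.FG) {n : ℕ} (hn : n ≠ 0) :
    ∃ s : Set V, s.Finite ∧ ∀ x ∈ L, ∃ t ∈ s, ∃ y ∈ L, x - t = n • y := by
  obtain ⟨m, hm⟩ := ZS.exists_nat_add hfin hS hn
  obtain ⟨k, g, rfl⟩ := Submodule.fg_iff_exists_fin_generating_family.mp hL
  choose c hc r hr using hm
  refine ⟨Set.range fun a : Fin k → Fin m => ∑ i, ((a i : ℕ) : ZS S) • g i, Set.finite_range _, ?_⟩
  intro x hx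
  obtain ⟨w, rfl⟩ := (Submodule.mem_span_range_iff_exists_fun _).mp hx
  refine ⟨_, ⟨fun i => ⟨c (w i), hc (w i)⟩, rfl⟩, ∑ i, r (w i) • g i,
    sum_mem fun i _ => Submodule.smul_mem _ _ (Submodule.subset_span ⟨i, rfl⟩), ?_⟩
  rw [← Finset.sum_sub_distrib, Finset.smul_sum]
  refine Finset.sum_congr rfl fun i _ => ?_
  nth_rw 1 [hr (w i)]
  rw [add_smul, add_sub_cancel_left, mul_smul, Nat.cast_smul_eq_nsmul]

end IntegersAtPrimes

/-! ### Two-sided ideals of semisimple rings -/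

section SemisimpleIdeals

/-- A two-sided ideal of a semisimple ring is generated by a central idempotent. -/
theorem exists_centralIdem_of_isTwoSided {B : Type*} [Ring B] [IsSemisimpleRing B] (I : Ideal B)
    [I.IsTwoSided] : ∃ ε ∈ I, IsCentralIdem ε ∧ ∀ x ∈ I, x * ε = x := by
  obtain ⟨K, hK⟩ := exists_isCompl I
  obtain ⟨ε, hε, κ, hκ, h1⟩ := Submodule.mem_sup.mp (hK.sup_eq_top ▸ Submodule.mem_top : (1 : B) ∈ I ⊔ K)
  have hdisj : ∀ x ∈ I, x ∈ K → x = 0 := fun x hx hx' =>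
    (Submodule.mem_bot B).mp (hK.inf_eq_bot ▸ ⟨hx, hx'⟩)
  -- I is two-sided and K is a left ideal, so a product from I K lies in both. Hence the I-component
  -- ε of 1 is a right identity of I.
  have hIK : ∀ x ∈ I, ∀ y ∈ K, x * y = 0 := fun x hx y hy =>
    hdisj _ (I.mul_mem_right y hx) (K.mul_mem_left x hy)
  have hr : ∀ x ∈ I, x * ε = x := fun x hx => by
    have : x * (ε + κ) = x := by rw [h1, mul_one]
    rwa [mul_add, hIK x hx κ hκ, add_zero] at this
  -- Bx has a complement, so it is generated by an idempotent cx; I x = 0 gives x c x = 0 and thus x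
  -- = 0. Applied to ε x - x, this makes ε a left identity of I as well.
  have hsq : ∀ x ∈ I, (∀ y ∈ I, y * x = 0) → x = 0 := by
    intro x hx h
    rw [← hr x hx]
    obtain ⟨K', hK'⟩ := exists_isCompl (Ideal.span {x})
    obtain ⟨d, hd, d', hd', hdd⟩ :=
      Submodule.mem_sup.mp (hK'.sup_eq_top ▸ Submodule.mem_top : (1 : B) ∈ Ideal.span {x} ⊔ K')
    obtain ⟨c, rfl⟩ := Ideal.mem_span_singleton'.mp hd
    have hcx : c * x ∈ I := I.mul_mem_left c hx
    have h2 : x * (c * x) = 0 := by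
      rw [← mul_assoc]; exact h _ (I.mul_mem_right c hx)
    have h3 : x = x * d' := by
      have : x * (c * x + d') = x := by rw [hdd, mul_one]
      rwa [mul_add, h2, zero_add, eq_comm] at this
    have h4 : x = 0 := (Submodule.mem_bot B).mp (hK'.inf_eq_bot ▸
      ⟨Ideal.mem_span_singleton_self x, by rw [h3]; exact K'.mul_mem_left x hd'⟩)
    rw [h4, zero_mul]
  have hl : ∀ x ∈ I, ε * x = x := by
    intro x hx
    rw [← sub_eq_zero]
    refine hsq _ (sub_mem (I.mul_mem_left ε hx) hx) fun y hy => ?_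
    rw [mul_sub, ← mul_assoc, hr y hy, sub_self]
  refine ⟨ε, hε, ⟨hr ε hε, fun x => ?_⟩, hr⟩
  rw [← hr _ (I.mul_mem_right x hε), mul_assoc, hl _ (I.mul_mem_left x hε)]

end SemisimpleIdeals

/-! ### The idempotents e_{Γ/Γ'} and e₁' and the norm element -/

section AugmentationIdempotent

variable {Γ : Type*} [Group Γ] [Finite Γ] (Γ' : Subgroup Γ)

instance : IsSemisimpleRing (MonoidAlgebra ℚ Γ) := by
  have : NeZero (Nat.card Γ : ℚ) := ⟨by exact_mod_cast Nat.card_pos.ne'⟩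
  infer_instance

theorem avgIdem_mul_single {γ : Γ} (hγ : γ ∈ Γ') :
    avgIdem Γ' * MonoidAlgebra.single γ 1 = avgIdem Γ' := by
  classical
  have := Fintype.ofFinite Γ'
  unfold avgIdem
  rw [finsum_eq_sum_of_fintype, Finset.sum_mul]
  simp only [MonoidAlgebra.single_mul_single, mul_one]
  exact Fintype.sum_equiv (Equiv.mulRight (⟨γ, hγ⟩ : Γ')) _ _ (fun τ => rfl)

/-- The norm element `∑_{τ ∈ Γ'} τ`. -/
noncomputable def normElt : MonoidAlgebra ℚ Γ := ∑ᶠ τ : Γ', MonoidAlgebra.single (τ : Γ) 1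

theorem normElt_eq_smul : normElt Γ' = Nat.card Γ' • avgIdem Γ' := by
  classical
  have := Fintype.ofFinite Γ'
  unfold avgIdem normElt
  rw [finsum_eq_sum_of_fintype, finsum_eq_sum_of_fintype, Finset.smul_sum]
  refine Finset.sum_congr rfl fun τ _ => ?_
  rw [← Nat.cast_smul_eq_nsmul ℚ, MonoidAlgebra.smul_single, smul_eq_mul,
    mul_inv_cancel₀ (by exact_mod_cast Nat.card_pos.ne')]

theorem normElt_mul_avgIdem : normElt Γ' * avgIdem Γ' = normElt Γ' := by
  rw [normElt_eq_smul, smul_mul_assoc, (avgIdem_idem Γ').eq]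

theorem avgIdem_mul_normElt : avgIdem Γ' * normElt Γ' = normElt Γ' := by
  rw [normElt_eq_smul, mul_smul_comm, (avgIdem_idem Γ').eq]

theorem single_mem_groupRing (S : Set ℕ) (γ : Γ) : MonoidAlgebra.single γ 1 ∈ groupRing Γ S :=
  ⟨MonoidAlgebra.single γ 1, by simp⟩

theorem smul_mem_groupRing {S : Set ℕ} {q : ℚ} (hq : q ∈ ZS S) {x : MonoidAlgebra ℚ Γ}
    (hx : x ∈ groupRing Γ S) : q • x ∈ groupRing Γ S := by
  rw [mem_groupRing_iff] at hx ⊢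
  intro γ
  simpa using mul_mem hq (hx γ)

theorem normElt_mem_groupRing (S : Set ℕ) : normElt Γ' ∈ groupRing Γ S := by
  have := Fintype.ofFinite Γ'
  unfold normElt
  rw [finsum_eq_sum_of_fintype]
  exact sum_mem fun τ _ => single_mem_groupRing S _

theorem bijective_out_mul : Function.Bijective fun x : (Γ ⧸ Γ') × Γ' => x.1.out * (x.2 : Γ) := by
  constructor
  · rintro ⟨q, τ⟩ ⟨q', τ'⟩ h
    have hq : q = q' := by
      have := congrArg (QuotientGroup.mk : Γ → Γ ⧸ Γ') h
      simpa [QuotientGroup.mk_mul_of_mem] using this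
    subst hq
    simpa using h
  · intro γ
    obtain ⟨τ, hτ⟩ := QuotientGroup.mk_out_eq_mul Γ' γ
    exact ⟨(QuotientGroup.mk γ, τ⁻¹), by simp [hτ]⟩

/-- The right `Γ'`-invariants of `ℤ_S[Γ]` are the multiples of the norm element. -/
theorem exists_mul_normElt {S : Set ℕ} {w : MonoidAlgebra ℚ Γ} (hw : w ∈ groupRing Γ S)
    (hw' : w * avgIdem Γ' = w) : ∃ y ∈ groupRing Γ S, w = y * normElt Γ' := by
  classical
  have := Fintype.ofFinite Γ'
  have := Fintype.ofFinite Γ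
  have := Fintype.ofFinite (Γ ⧸ Γ')
  have hinv : ∀ γ : Γ, ∀ τ : Γ', w.coeff (γ * τ) = w.coeff γ := by
    intro γ τ
    have : w * MonoidAlgebra.single (τ : Γ) 1 = w := by
      rw [← hw', mul_assoc, avgIdem_mul_single Γ' τ.2]
    nth_rw 1 [← this]
    rw [MonoidAlgebra.coeff_mul_single_mul, mul_one]
  refine ⟨∑ q : Γ ⧸ Γ', w.coeff q.out • MonoidAlgebra.single q.out 1,
    sum_mem fun q _ => smul_mem_groupRing (mem_groupRing_iff.mp hw _) (single_mem_groupRing S _), ?_⟩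
  unfold normElt
  rw [finsum_eq_sum_of_fintype, Finset.sum_mul_sum]
  have h1 : w = ∑ γ : Γ, MonoidAlgebra.single γ (w.coeff γ) := by
    ext δ
    simp [MonoidAlgebra.coeff_sum]
  nth_rw 1 [h1]
  rw [← Fintype.sum_prod_type']
  rw [← (bijective_out_mul Γ').sum_comp]
  refine Finset.sum_congr rfl fun x _ => ?_
  rw [smul_mul_assoc, MonoidAlgebra.single_mul_single, mul_one, MonoidAlgebra.smul_single,
    smul_eq_mul, mul_one, hinv]

/-- The left `Γ'`-invariants of `ℤ_S[Γ]` are the multiples of the norm element. -/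
theorem exists_normElt_mul {S : Set ℕ} {w : MonoidAlgebra ℚ Γ} (hw : w ∈ groupRing Γ S)
    (hw' : avgIdem Γ' * w = w) : ∃ y ∈ groupRing Γ S, w = normElt Γ' * y := by
  classical
  have := Fintype.ofFinite Γ'
  have := Fintype.ofFinite Γ
  have := Fintype.ofFinite (Γ ⧸ Γ')
  have hinv : ∀ γ : Γ, ∀ τ : Γ', w.coeff (τ * γ) = w.coeff γ := by
    intro γ τ
    have : MonoidAlgebra.single (τ : Γ) 1 * w = w := by
      rw [← hw', ← mul_assoc, single_mul_avgIdem Γ' τ.2]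
    nth_rw 1 [← this]
    rw [MonoidAlgebra.coeff_single_mul_mul, one_mul]
  refine ⟨∑ q : Γ ⧸ Γ', w.coeff q.out⁻¹ • MonoidAlgebra.single q.out⁻¹ 1,
    sum_mem fun q _ => smul_mem_groupRing (mem_groupRing_iff.mp hw _) (single_mem_groupRing S _), ?_⟩
  unfold normElt
  rw [finsum_eq_sum_of_fintype, Finset.sum_mul_sum, Finset.sum_comm]
  have h1 : w = ∑ γ : Γ, MonoidAlgebra.single γ (w.coeff γ) := by
    ext δ
    simp [MonoidAlgebra.coeff_sum]
  nth_rw 1 [h1]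
  rw [← Fintype.sum_prod_type']
  have hbij : Function.Bijective fun x : (Γ ⧸ Γ') × Γ' => (x.2 : Γ) * x.1.out⁻¹ := by
    have : (fun x : (Γ ⧸ Γ') × Γ' => (x.2 : Γ) * x.1.out⁻¹) =
        Inv.inv ∘ (fun x : (Γ ⧸ Γ') × Γ' => x.1.out * (x.2 : Γ)) ∘ Prod.map id Inv.inv := by
      funext x
      simp
    rw [this]
    exact (Equiv.inv Γ).bijective.comp ((bijective_out_mul Γ').comp
      (Function.bijective_id.prodMap (Equiv.inv Γ').bijective))
  rw [← hbij.sum_comp]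
  refine Finset.sum_congr rfl fun x _ => ?_
  rw [mul_smul_comm, MonoidAlgebra.single_mul_single, mul_one, MonoidAlgebra.smul_single,
    smul_eq_mul, mul_one, hinv]

/-- Every element of `ℚ[Γ/Γ']` is `a · Γ'` for some `a ∈ ℚ[Γ]`. -/
theorem exists_asAlgebraHom_single (x : MonoidAlgebra ℚ (Γ ⧸ Γ')) : ∃ a : MonoidAlgebra ℚ Γ,
    (Representation.ofMulAction ℚ Γ (Γ ⧸ Γ')).asAlgebraHom a
      (MonoidAlgebra.single (QuotientGroup.mk 1) 1) = x := by
  induction x using MonoidAlgebra.induction_linear with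
  | zero => exact ⟨0, by simp⟩
  | add f g hf hg =>
    obtain ⟨a, rfl⟩ := hf
    obtain ⟨b, rfl⟩ := hg
    exact ⟨a + b, by simp⟩
  | single q r =>
    induction q using QuotientGroup.induction_on with
    | H γ =>
      refine ⟨MonoidAlgebra.single γ r, ?_⟩
      rw [Representation.asAlgebraHom_single, LinearMap.smul_apply, Representation.ofMulAction_single,
        MonoidAlgebra.smul_single, smul_eq_mul, mul_one, MulAction.Quotient.smul_mk, smul_eq_mul,
        mul_one]

theorem asAlgebraHom_avgIdem_single :
    (Representation.ofMulAction ℚ Γ (Γ ⧸ Γ')).asAlgebraHom (avgIdem Γ')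
      (MonoidAlgebra.single (QuotientGroup.mk 1) 1) =
      MonoidAlgebra.single (QuotientGroup.mk 1) 1 := by
  have := Fintype.ofFinite Γ'
  unfold avgIdem
  rw [finsum_eq_sum_of_fintype, map_sum, LinearMap.sum_apply]
  have : ∀ τ : Γ', (Representation.ofMulAction ℚ Γ (Γ ⧸ Γ')).asAlgebraHom
      (MonoidAlgebra.single (τ : Γ) ((Nat.card Γ' : ℚ)⁻¹))
      (MonoidAlgebra.single (QuotientGroup.mk 1) 1) =
      MonoidAlgebra.single (QuotientGroup.mk 1) ((Nat.card Γ' : ℚ)⁻¹) := by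
    intro τ
    rw [Representation.asAlgebraHom_single, LinearMap.smul_apply, Representation.ofMulAction_single,
      MonoidAlgebra.smul_single, smul_eq_mul, mul_one, MulAction.Quotient.smul_mk, smul_eq_mul]
    congr 1
    rw [mul_one, eq_comm, QuotientGroup.eq]
    simp
  rw [Finset.sum_congr rfl fun τ _ => this τ, Finset.sum_const, Finset.card_univ,
    ← Nat.card_eq_fintype_card, ← Nat.cast_smul_eq_nsmul ℚ, MonoidAlgebra.smul_single, smul_eq_mul,
    mul_inv_cancel₀ (by exact_mod_cast Nat.card_pos.ne')]

/-- The permutation module is generated by the trivial coset, which e₁' fixes; a central c with c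
e₁' = 0 kills the generator and so everything. -/
theorem asAlgebraHom_eq_zero {c : MonoidAlgebra ℚ Γ} (hc : ∀ x, c * x = x * c)
    (h : c * avgIdem Γ' = 0) (x : MonoidAlgebra ℚ (Γ ⧸ Γ')) :
    (Representation.ofMulAction ℚ Γ (Γ ⧸ Γ')).asAlgebraHom c x = 0 := by
  obtain ⟨a, rfl⟩ := exists_asAlgebraHom_single Γ' x
  rw [← asAlgebraHom_avgIdem_single, ← Module.End.mul_apply, ← Module.End.mul_apply, ← map_mul,
    ← map_mul, hc, mul_assoc, hc, ← hc, h, mul_zero, map_zero, LinearMap.zero_apply]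

theorem augIdem_mul_of_acts {ε : MonoidAlgebra ℚ Γ} (hε : IsCentralIdem ε)
    (h : ActsAsOneOnAug Γ' ε) : augIdem Γ' * ε = augIdem Γ' :=
  (exists_augIdem Γ').choose_spec.2 ε hε h

theorem IsCentralIdem.one_sub {B : Type*} [Ring B] {ε : B} (h : IsCentralIdem ε) :
    IsCentralIdem (1 - ε) :=
  ⟨h.1.one_sub, fun x => by rw [sub_mul, mul_sub, one_mul, mul_one, h.2]⟩

/-- `e_{Γ/Γ'}` lies in the two-sided ideal generated by `e₁'`. -/
theorem augIdem_mem_span : augIdem Γ' ∈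
    AddSubgroup.closure {x | ∃ a b : MonoidAlgebra ℚ Γ, a * avgIdem Γ' * b = x} := by
  set C := AddSubgroup.closure {x | ∃ a b : MonoidAlgebra ℚ Γ, a * avgIdem Γ' * b = x}
  have hl : ∀ c, ∀ x ∈ C, c * x ∈ C := by
    intro c x hx
    induction hx using AddSubgroup.closure_induction with
    | mem x hx =>
      obtain ⟨a, b, rfl⟩ := hx
      exact AddSubgroup.subset_closure ⟨c * a, b, by simp only [mul_assoc]⟩
    | zero => rw [mul_zero]; exact zero_mem _
    | add x y _ _ hx hy => rw [mul_add]; exact add_mem hx hy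
    | neg x _ hx => rw [mul_neg]; exact neg_mem hx
  have hr : ∀ c, ∀ x ∈ C, x * c ∈ C := by
    intro c x hx
    induction hx using AddSubgroup.closure_induction with
    | mem x hx =>
      obtain ⟨a, b, rfl⟩ := hx
      exact AddSubgroup.subset_closure ⟨a, b * c, by simp only [mul_assoc]⟩
    | zero => rw [zero_mul]; exact zero_mem _
    | add x y _ _ hx hy => rw [add_mul]; exact add_mem hx hy
    | neg x _ hx => rw [neg_mul]; exact neg_mem hx
  let I : Ideal (MonoidAlgebra ℚ Γ) := { C.toAddSubmonoid with smul_mem' := fun c x hx => hl c x hx }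
  have : I.IsTwoSided := ⟨fun {a} b ha => hr b a ha⟩
  obtain ⟨ε, hε, hεc, h⟩ := exists_centralIdem_of_isTwoSided I
  have h1 : avgIdem Γ' ∈ I := AddSubgroup.subset_closure ⟨1, 1, by simp⟩
  -- If ε generates the two-sided ideal of e₁', then 1 - ε kills e₁' and hence ℚ[Γ/Γ']; minimality
  -- of e_{Γ/Γ'} then gives e_{Γ/Γ'} ε = e_{Γ/Γ'}.
  have hact : ActsAsOneOnAug Γ' ε := by
    intro x _
    have := asAlgebraHom_eq_zero Γ' (c := 1 - ε) hεc.one_sub.2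
      (by rw [sub_mul, one_mul, hεc.2, h _ h1, sub_self]) x
    rw [map_sub, map_one, LinearMap.sub_apply, sub_eq_zero] at this
    exact this.symm
  rw [← augIdem_mul_of_acts Γ' hεc hact]
  exact hl _ _ hε

theorem avgIdem_top_isCentralIdem : IsCentralIdem (avgIdem (⊤ : Subgroup Γ)) := by
  refine ⟨avgIdem_idem _, fun x => ?_⟩
  induction x using MonoidAlgebra.induction_linear with
  | zero => simp
  | add f g hf hg => rw [mul_add, add_mul, hf, hg]
  | single γ a =>
    have : (MonoidAlgebra.single γ a : MonoidAlgebra ℚ Γ) = a • MonoidAlgebra.single γ 1 := by simp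
    rw [this, mul_smul_comm, smul_mul_assoc, avgIdem_mul_single _ (Subgroup.mem_top γ),
      single_mul_avgIdem _ (Subgroup.mem_top γ)]

/-- The average over Γ acts on ℚ[Γ/Γ'] through the coefficient sum, so it is zero on the
augmentation part, and minimality applies to its complement. Consequently the trivial character is
not among the φ_i. -/
theorem augIdem_mul_avgIdem_top : augIdem Γ' * avgIdem (⊤ : Subgroup Γ) = 0 := by
  classical
  have := Fintype.ofFinite Γ
  have := Fintype.ofFinite (⊤ : Subgroup Γ)
  have h : ActsAsOneOnAug Γ' (1 - avgIdem (⊤ : Subgroup Γ)) := by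
    intro x hx
    rw [map_sub, map_one, LinearMap.sub_apply, Module.End.one_apply, sub_eq_self]
    have h1 : ∀ γ : Γ, ∀ y : MonoidAlgebra ℚ (Γ ⧸ Γ'),
        (Representation.ofMulAction ℚ Γ (Γ ⧸ Γ')).asAlgebraHom (avgIdem (⊤ : Subgroup Γ))
        (Representation.ofMulAction ℚ Γ (Γ ⧸ Γ') γ y) =
        (Representation.ofMulAction ℚ Γ (Γ ⧸ Γ')).asAlgebraHom (avgIdem (⊤ : Subgroup Γ)) y := by
      intro γ y
      rw [← Representation.asAlgebraHom_single_one, ← Module.End.mul_apply, ← map_mul,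
        avgIdem_mul_single _ (Subgroup.mem_top γ)]
    have h2 : ∀ x : MonoidAlgebra ℚ (Γ ⧸ Γ'),
        (Representation.ofMulAction ℚ Γ (Γ ⧸ Γ')).asAlgebraHom (avgIdem (⊤ : Subgroup Γ)) x =
        (x.coeff.sum fun _ a => a) • (Representation.ofMulAction ℚ Γ (Γ ⧸ Γ')).asAlgebraHom
          (avgIdem (⊤ : Subgroup Γ)) (MonoidAlgebra.single (QuotientGroup.mk 1) 1) := by
      intro x
      induction x using MonoidAlgebra.induction_linear with
      | zero => simp
      | add f g hf hg =>
        rw [map_add, hf, hg, ← add_smul, MonoidAlgebra.coeff_add,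
          Finsupp.sum_add_index' (fun _ => rfl) (fun _ _ _ => rfl)]
      | single q a =>
        induction q using QuotientGroup.induction_on with
        | H γ =>
          have : (MonoidAlgebra.single (QuotientGroup.mk γ : Γ ⧸ Γ') a : MonoidAlgebra ℚ (Γ ⧸ Γ')) =
              a • Representation.ofMulAction ℚ Γ (Γ ⧸ Γ') γ
                (MonoidAlgebra.single (QuotientGroup.mk 1) 1) := by
            rw [Representation.ofMulAction_single, MonoidAlgebra.smul_single, smul_eq_mul, mul_one,
              MulAction.Quotient.smul_mk, smul_eq_mul, mul_one]
          rw [this, map_smul, h1, ← this, MonoidAlgebra.coeff_single, Finsupp.sum_single_index rfl]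
    rw [h2, hx, zero_smul]
  have := augIdem_mul_of_acts Γ' avgIdem_top_isCentralIdem.one_sub h
  rwa [mul_sub, mul_one, sub_eq_self] at this

/-- Otherwise e_i kills ℚ[Γ/Γ'], and minimality of e_{Γ/Γ'} applied to 1 - e_i would remove e_i from
e_{Γ/Γ'}. This makes ⟨φ_i, a_{Γ/Γ'}⟩ nonzero. -/
theorem AugIndex.mul_avgIdem_ne_zero {Γ' : Subgroup Γ} (i : AugIndex Γ') :
    i.1 * avgIdem Γ' ≠ 0 := by
  intro h
  have hc := i.2.1.1
  have hact : ActsAsOneOnAug Γ' (1 - i.1) := by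
    intro x _
    rw [map_sub, map_one, LinearMap.sub_apply, asAlgebraHom_eq_zero Γ' hc.2 h, sub_zero]
    rfl
  have := augIdem_mul_of_acts Γ' hc.one_sub hact
  rw [mul_sub, mul_one, sub_eq_self, (augIdem_isCentralIdem Γ').2, i.2.2] at this
  exact i.2.1.2.1 this

end AugmentationIdempotent

/-! ### The orders R and 𝔬 as lattices in ℚ[Γ]; both are maximal and R N R = R -/

section Lattices

variable {Γ : Type*} [Group Γ] [Finite Γ]

theorem exists_nsmul_mem_groupRing (S : Set ℕ) (x : MonoidAlgebra ℚ Γ) :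
    ∃ n : ℕ, n ≠ 0 ∧ n • x ∈ groupRing Γ S := by
  induction x using MonoidAlgebra.induction_linear with
  | zero => exact ⟨1, one_ne_zero, by simp [zero_mem]⟩
  | add f g hf hg =>
    obtain ⟨n, hn, hf⟩ := hf
    obtain ⟨m, hm, hg⟩ := hg
    refine ⟨n * m, mul_ne_zero hn hm, ?_⟩
    rw [smul_add, mul_comm, mul_smul, mul_comm, mul_smul]
    exact add_mem (nsmul_mem hf m) (nsmul_mem hg n)
  | single γ a =>
    refine ⟨a.den, a.den_nz, ?_⟩
    have : a.den • MonoidAlgebra.single γ a = a.num • (MonoidAlgebra.single γ 1 : MonoidAlgebra ℚ Γ) := by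
      rw [← Nat.cast_smul_eq_nsmul ℚ, ← Int.cast_smul_eq_zsmul ℚ, MonoidAlgebra.smul_single,
        MonoidAlgebra.smul_single, smul_eq_mul, smul_eq_mul, mul_one, Rat.den_mul_eq_num]
    rw [this]
    exact zsmul_mem (single_mem_groupRing S γ) _

/-- The group ring `ℤ_S[Γ]` as a `ℤ_S`-submodule of `ℚ[Γ]`. -/
noncomputable def groupLattice (Γ : Type*) [Group Γ] [Finite Γ] (S : Set ℕ) :
    Submodule (ZS S) (MonoidAlgebra ℚ Γ) where
  carrier := groupRing Γ S
  zero_mem' := zero_mem _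
  add_mem' := add_mem
  smul_mem' := fun q _ hx => smul_mem_groupRing q.2 hx

theorem groupLattice_fg (S : Set ℕ) : (groupLattice Γ S).FG := by
  classical
  have := Fintype.ofFinite Γ
  refine ⟨Finset.univ.image fun γ : Γ => MonoidAlgebra.single γ 1, le_antisymm ?_ ?_⟩
  · rw [Submodule.span_le]
    intro x hx
    obtain ⟨γ, -, rfl⟩ := Finset.mem_image.mp (Finset.mem_coe.mp hx)
    exact single_mem_groupRing S γ
  · rintro _ ⟨y, rfl⟩
    induction y using MonoidAlgebra.induction_linear with
    | zero => rw [map_zero]; exact zero_mem _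
    | add f g hf hg => rw [map_add]; exact add_mem hf hg
    | single γ a =>
      have : MonoidAlgebra.mapRingHom Γ (ZS S).subtype (MonoidAlgebra.single γ a) =
          a • (MonoidAlgebra.single γ 1 : MonoidAlgebra ℚ Γ) := by
        show _ = (a : ℚ) • (MonoidAlgebra.single γ 1 : MonoidAlgebra ℚ Γ)
        simp
      rw [this]
      exact Submodule.smul_mem _ _ (Submodule.subset_span (by simp))

theorem fg_of_nsmul_mem {S : Set ℕ} {N : Submodule (ZS S) (MonoidAlgebra ℚ Γ)} {n : ℕ} (hn : n ≠ 0)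
    (h : ∀ x ∈ N, n • x ∈ groupRing Γ S) : N.FG := by
  let g : MonoidAlgebra ℚ Γ →ₗ[ZS S] MonoidAlgebra ℚ Γ :=
    { toFun := fun x => (n : ℚ)⁻¹ • x
      map_add' := fun x y => smul_add _ x y
      map_smul' := fun q x => smul_comm ((n : ℚ)⁻¹) (q : ℚ) x }
  have h1 : ((groupLattice Γ S).map g).FG := (groupLattice_fg S).map g
  have h2 := isNoetherian_of_fg_of_noetherian _ h1
  exact isNoetherian_submodule.mp h2 N fun x hx => ⟨n • x, h x hx, inv_smul_nsmul hn x⟩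

theorem exists_finite_mod {S : Set ℕ} (hfin : S.Finite) (hS : ∀ p ∈ S, p.Prime)
    {L : Submodule ℤ (MonoidAlgebra ℚ Γ)} (hL : ∀ q ∈ ZS S, ∀ x ∈ L, q • x ∈ L) {n : ℕ} (hn : n ≠ 0)
    (h : ∀ x ∈ L, n • x ∈ groupRing Γ S) {m : ℕ} (hm : m ≠ 0) :
    ∃ s : Set (MonoidAlgebra ℚ Γ), s.Finite ∧ ∀ x ∈ L, ∃ t ∈ s, x - t ∈ scaled m L := by
  let N : Submodule (ZS S) (MonoidAlgebra ℚ Γ) :=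
    { L.toAddSubmonoid with smul_mem' := fun q x hx => hL q q.2 x hx }
  obtain ⟨s, hs, hsN⟩ := (fg_of_nsmul_mem (N := N) hn h).exists_finite_mod hfin hS hm
  refine ⟨s, hs, fun x hx => ?_⟩
  obtain ⟨t, ht, y, hy, hxy⟩ := hsN x hx
  exact ⟨t, ht, mem_scaled.mpr ⟨y, hy, hxy.symm⟩⟩

variable (Γ' : Subgroup Γ) (S : Set ℕ)

/-- The elements of `ℤ_S[Γ]` fixed by `e_{Γ/Γ'}`. -/
noncomputable def augLat : Submodule ℤ (MonoidAlgebra ℚ Γ) where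
  carrier := {x | x ∈ groupRing Γ S ∧ augIdem Γ' * x = x}
  zero_mem' := ⟨zero_mem _, mul_zero _⟩
  add_mem' := fun ha hb => ⟨add_mem ha.1 hb.1, by rw [mul_add, ha.2, hb.2]⟩
  smul_mem' := fun c x hx => ⟨zsmul_mem hx.1 c, by rw [mul_smul_comm, hx.2]⟩

/-- The elements of `e_{Γ/Γ'} e₁' ℚ[Γ] e₁'` that become integral after multiplication by the norm
element. -/
noncomputable def heckeLat : Submodule ℤ (MonoidAlgebra ℚ Γ) where
  carrier := {x | x * normElt Γ' ∈ augLat Γ' S ∧ avgIdem Γ' * x = x ∧ x * avgIdem Γ' = x}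
  zero_mem' := ⟨by rw [zero_mul]; exact zero_mem _, mul_zero _, zero_mul _⟩
  add_mem' := fun ha hb => ⟨by rw [add_mul]; exact add_mem ha.1 hb.1, by rw [mul_add, ha.2.1, hb.2.1],
    by rw [add_mul, ha.2.2, hb.2.2]⟩
  smul_mem' := fun c x hx => ⟨by rw [smul_mul_assoc]; exact (augLat Γ' S).smul_mem c hx.1,
    by rw [mul_smul_comm, hx.2.1], by rw [smul_mul_assoc, hx.2.2]⟩

variable {Γ' S}

theorem augIdem_mul_mem {y : MonoidAlgebra ℚ Γ} (he : augIdem Γ' ∈ groupRing Γ S)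
    (hy : y ∈ groupRing Γ S) : augIdem Γ' * y ∈ augLat Γ' S :=
  ⟨mul_mem he hy, by rw [← mul_assoc, (augIdem_idem Γ').eq]⟩

theorem mem_augRing_iff (he : augIdem Γ' ∈ groupRing Γ S) {x : AugAlg Γ'} :
    x ∈ augRing Γ' S ↔ x.1 ∈ augLat Γ' S := by
  constructor
  · rintro ⟨y, hy, hx⟩
    rw [hx]
    exact augIdem_mul_mem he hy
  · rintro ⟨h1, h2⟩
    exact ⟨x.1, h1, h2.symm⟩

theorem augLat_mul {x y : MonoidAlgebra ℚ Γ} (hx : x ∈ augLat Γ' S) (hy : y ∈ augLat Γ' S) :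
    x * y ∈ augLat Γ' S :=
  ⟨mul_mem hx.1 hy.1, by rw [← mul_assoc, hx.2]⟩

theorem augLat_mul_groupRing {x y : MonoidAlgebra ℚ Γ} (hx : x ∈ augLat Γ' S)
    (hy : y ∈ groupRing Γ S) : x * y ∈ augLat Γ' S :=
  ⟨mul_mem hx.1 hy, by rw [← mul_assoc, hx.2]⟩

theorem augLat_mul_idem {x : MonoidAlgebra ℚ Γ} (hx : x ∈ augLat Γ' S) : x * augIdem Γ' = x := by
  rw [← (augIdem_isCentralIdem Γ').2, hx.2]

theorem smul_mem_augLat {q : ℚ} (hq : q ∈ ZS S) {x : MonoidAlgebra ℚ Γ} (hx : x ∈ augLat Γ' S) :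
    q • x ∈ augLat Γ' S :=
  ⟨smul_mem_groupRing hq hx.1, by rw [mul_smul_comm, hx.2]⟩

theorem exists_augLat_mul_normElt {w : MonoidAlgebra ℚ Γ} (he : augIdem Γ' ∈ groupRing Γ S)
    (hw : w ∈ augLat Γ' S) (hw' : w * avgIdem Γ' = w) : ∃ y ∈ augLat Γ' S, w = y * normElt Γ' := by
  obtain ⟨y, hy, h⟩ := exists_mul_normElt Γ' hw.1 hw'
  refine ⟨augIdem Γ' * y, augIdem_mul_mem he hy, ?_⟩
  rw [mul_assoc, ← h, hw.2]

theorem exists_augLat_normElt_mul {w : MonoidAlgebra ℚ Γ} (he : augIdem Γ' ∈ groupRing Γ S)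
    (hw : w ∈ augLat Γ' S) (hw' : avgIdem Γ' * w = w) : ∃ y ∈ augLat Γ' S, w = normElt Γ' * y := by
  obtain ⟨y, hy, h⟩ := exists_normElt_mul Γ' hw.1 hw'
  refine ⟨augIdem Γ' * y, augIdem_mul_mem he hy, ?_⟩
  rw [← mul_assoc, ← (augIdem_isCentralIdem Γ').2, mul_assoc, ← h, hw.2]

theorem AllGood.prime (hS : AllGood Γ' S) : ∀ p ∈ S, p.Prime := fun p hp => (hS p hp).1

theorem mem_groupRing_of_localized {x : MonoidAlgebra ℚ Γ}
    (h : ∀ p ∈ S, x ∈ groupRing Γ {p}) : x ∈ groupRing Γ S := by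
  rw [mem_groupRing_iff]
  intro γ p hpS hp
  exact mem_groupRing_iff.mp (h p hpS) γ p rfl hp

theorem groupRing_mono {p : ℕ} (hp : p ∈ S) {x : MonoidAlgebra ℚ Γ} (hx : x ∈ groupRing Γ S) :
    x ∈ groupRing Γ {p} := by
  rw [mem_groupRing_iff] at hx ⊢
  intro γ q hq
  rw [Set.mem_singleton_iff.mp hq]
  exact hx γ p hp

/-- Maximality at a good prime gives maximality among commensurable rings. -/
theorem mem_groupRing_of_isGoodPrime {p : ℕ} (hp : IsGoodPrime Γ' p) (hpS : p ∈ S)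
    {L : Submodule ℤ (MonoidAlgebra ℚ Γ)} (hL : augLat Γ' S ≤ L)
    (hmul : ∀ x ∈ L, ∀ y ∈ L, x * y ∈ L) (hone : ∀ x ∈ L, augIdem Γ' * x = x)
    (he : augIdem Γ' ∈ groupRing Γ S)
    {n : ℕ} (hn : n ≠ 0) (hnL : ∀ x ∈ L, n • x ∈ augLat Γ' S) {x : MonoidAlgebra ℚ Γ} (hx : x ∈ L) :
    x ∈ groupRing Γ {p} := by
  obtain ⟨hpp, hep, hord, hmax⟩ := hp
  have hpnd : ∀ {d : ℕ}, ¬ p ∣ d → ∀ q ∈ ({p} : Set ℕ), q.Prime → ¬ (q : ℤ) ∣ (d : ℤ) := by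
    rintro d hd q rfl _ h
    exact hd (Int.natCast_dvd_natCast.mp h)
  have hne : ∀ {d : ℕ}, ¬ p ∣ d → d ≠ 0 := fun hd h => hd (h ▸ dvd_zero p)
  -- The localization of L at p, an overorder of e_{Γ/Γ'} ℤ_(p)[Γ], to which the assumed maximality
  -- at p applies.
  let N : Submodule (ZS {p}) (MonoidAlgebra ℚ Γ) :=
    { carrier := {x | ∃ d : ℕ, ¬ p ∣ d ∧ d • x ∈ L}
      zero_mem' := ⟨1, hpp.one_lt.ne' ∘ Nat.dvd_one.mp, by simp⟩
      add_mem' := by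
        rintro a b ⟨d, hd, ha⟩ ⟨d', hd', hb⟩
        refine ⟨d * d', fun h => (hpp.dvd_mul.mp h).elim hd hd', ?_⟩
        rw [smul_add, mul_comm, mul_smul, mul_comm, mul_smul]
        exact add_mem (nsmul_mem ha _) (nsmul_mem hb _)
      smul_mem' := by
        rintro q x ⟨d, hd, hx⟩
        refine ⟨q.1.den * d, fun h => (hpp.dvd_mul.mp h).elim (q.2 p rfl hpp) hd, ?_⟩
        have : (q.1.den * d) • (q • x) = q.1.num • (d • x) := by
          show _ • ((q : ℚ) • x) = _
          rw [mul_smul, smul_comm d, ← Nat.cast_smul_eq_nsmul ℚ, smul_smul, Rat.den_mul_eq_num,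
            Int.cast_smul_eq_zsmul]
        rw [this]
        exact L.smul_mem _ hx }
  have hNone : ∀ x ∈ N, augIdem Γ' * x = x := by
    rintro x ⟨d, hd, hx⟩
    have := hone _ hx
    rw [mul_smul_comm] at this
    rw [← inv_smul_nsmul (hne hd) x, mul_smul_comm, mul_smul_comm, this]
  have hcorner : ∀ x ∈ N, x ∈ Subsemigroup.corner (augIdem Γ') := fun x hx =>
    (Subsemigroup.mem_corner_iff (augIdem_idem Γ')).mpr
      ⟨hNone x hx, by rw [← (augIdem_isCentralIdem Γ').2, hNone x hx]⟩
  let Λ : Subring (AugAlg Γ') :=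
    { carrier := {x | x.1 ∈ N}
      zero_mem' := zero_mem N
      one_mem' := ⟨1, hpp.one_lt.ne' ∘ Nat.dvd_one.mp, by
        rw [one_smul]; exact hL ⟨he, (augIdem_idem Γ').eq⟩⟩
      add_mem' := fun {a b} ha hb => add_mem (S := Submodule _ _) (s := N) ha hb
      neg_mem' := fun {a} ha => neg_mem (S := Submodule _ _) (s := N) ha
      mul_mem' := by
        rintro a b ⟨d, hd, ha⟩ ⟨d', hd', hb⟩
        refine ⟨d * d', fun h => (hpp.dvd_mul.mp h).elim hd hd', ?_⟩
        have : (d * d') • (a * b).1 = (d • a.1) * (d' • b.1) := by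
          rw [smul_mul_assoc, mul_smul_comm, mul_smul]; rfl
        rw [this]
        exact hmul _ ha _ hb }
  have himage : (fun x : AugAlg Γ' => x.1) '' (Λ : Set (AugAlg Γ')) = (N : Set (MonoidAlgebra ℚ Γ)) := by
    ext x
    constructor
    · rintro ⟨y, hy, rfl⟩
      exact hy
    · intro hx
      exact ⟨⟨x, hcorner x hx⟩, hx, rfl⟩
  have hle : augRing Γ' {p} ≤ Λ := by
    intro x hx
    rw [mem_augRing_iff hep] at hx
    classical
    have := Fintype.ofFinite Γ
    -- The product of all denominators of coefficients is prime to p and clears them at once.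
    refine ⟨∏ γ : Γ, (x.1.coeff γ).den, fun h => ?_, hL ⟨?_, by rw [mul_smul_comm, hx.2]⟩⟩
    · obtain ⟨γ, -, hγ⟩ := (Prime.dvd_finsetProd_iff hpp.prime _).mp h
      exact mem_groupRing_iff.mp hx.1 γ p rfl hpp hγ
    · rw [mem_groupRing_iff]
      intro γ
      rw [← Finset.prod_erase_mul _ _ (Finset.mem_univ γ)]
      have : (((∏ δ ∈ Finset.univ.erase γ, (x.1.coeff δ).den) * (x.1.coeff γ).den) • x.1).coeff γ =
          ((∏ δ ∈ Finset.univ.erase γ, (x.1.coeff δ).den : ℕ) : ℚ) * (x.1.coeff γ).num := by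
        rw [← Rat.den_mul_eq_num, ← mul_assoc, ← Nat.cast_mul, ← Nat.cast_smul_eq_nsmul ℚ]
        simp
      rw [this]
      exact mul_mem (natCast_mem _ _) (intCast_mem _ _)
  have hNfg : N.FG := by
    refine fg_of_nsmul_mem hn ?_
    rintro x ⟨d, hd, hx⟩
    rw [← inv_smul_nsmul (hne hd) (n • x), smul_comm d]
    exact smul_mem_groupRing (by exact_mod_cast ZS.inv_mem (hpnd hd)) (groupRing_mono hpS (hnL _ hx).1)
  have hΛ : IsZSOrder {p} Λ := by
    refine ⟨?_, fun y => Submodule.span_mono (Set.image_mono hle) (hord.2 y)⟩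
    obtain ⟨T, hT⟩ := hNfg
    exact ⟨T, by rw [himage, hT]⟩
  have hxN : x ∈ N := ⟨1, hpp.one_lt.ne' ∘ Nat.dvd_one.mp, by rwa [one_smul]⟩
  have hxΛ : (⟨x, hcorner x hxN⟩ : AugAlg Γ') ∈ Λ := hxN
  rw [hmax Λ hΛ hle] at hxΛ
  exact ((mem_augRing_iff hep).mp hxΛ).1

/-- Lying in ℤ_S[Γ] can be tested at each p ∈ S, so maximality at each good prime gives it globally.
-/
theorem augLat_isMaxOrder (hfin : S.Finite) (hS : AllGood Γ' S) :
    IsMaxOrder (augIdem Γ') (augLat Γ' S) where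
  one_mem := ⟨hS.augIdem_mem, (augIdem_idem Γ').eq⟩
  mul_mem := fun x hx y hy => augLat_mul hx hy
  one_mul := fun x hx => hx.2
  mul_one := fun x hx => augLat_mul_idem hx
  fin := fun n hn => exists_finite_mod hfin hS.prime (fun q hq x hx => smul_mem_augLat hq hx)
    one_ne_zero (fun x hx => by rw [one_smul]; exact hx.1) hn
  max := fun L hL hmul hone _ n hn hnL x hx =>
    ⟨mem_groupRing_of_localized fun p hp => mem_groupRing_of_isGoodPrime (hS p hp) hp hL hmul hone
      hS.augIdem_mem hn hnL hx, hone x hx⟩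

/-- The two-sided ideal of `e_{Γ/Γ'} ℤ_S[Γ]` generated by the norm element is the unit ideal. -/
theorem augIdem_mem_mul_normElt_mul (hfin : S.Finite) (hS : AllGood Γ' S) :
    augIdem Γ' ∈ augLat Γ' S * Submodule.span ℤ {normElt Γ'} * augLat Γ' S := by
  have h := augLat_isMaxOrder hfin hS
  have he := hS.augIdem_mem
  set R := augLat Γ' S
  set Nl := Submodule.span ℤ {normElt Γ'}
  have hN : normElt Γ' ∈ Nl := Submodule.mem_span_singleton_self _
  have hT : IsFullIdeal R (R * Nl * R) := by
    have hRN : R * Nl ≤ R := Submodule.mul_le.mpr fun x hx y hy => by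
      obtain ⟨c, rfl⟩ := Submodule.mem_span_singleton.mp hy
      rw [mul_smul_comm]
      exact R.smul_mem c (augLat_mul_groupRing hx (normElt_mem_groupRing Γ' S))
    refine ⟨(mul_le_mul' hRN le_rfl).trans (Submodule.mul_le.mpr h.mul_mem), ?_, ?_, ?_⟩
    · intro r hr x hx
      have : r * x ∈ R * (R * Nl * R) := Submodule.mul_mem_mul hr hx
      rw [← mul_assoc, ← mul_assoc] at this
      exact mul_le_mul' (mul_le_mul' (Submodule.mul_le.mpr h.mul_mem) le_rfl) le_rfl this
    · intro r hr x hx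
      have : x * r ∈ R * Nl * R * R := Submodule.mul_mem_mul hx hr
      rw [mul_assoc (R * Nl)] at this
      exact mul_le_mul' le_rfl (Submodule.mul_le.mpr h.mul_mem) this
    -- The ideal is full because e_{Γ/Γ'} lies rationally in the ideal of e₁' = |Γ'|⁻¹ N;
    -- denominators are then cleared.
    · have key : ∀ x ∈ AddSubgroup.closure {x | ∃ a b : MonoidAlgebra ℚ Γ, a * avgIdem Γ' * b = x},
          ∃ n : ℕ, n ≠ 0 ∧ n • (augIdem Γ' * x) ∈ R * Nl * R := by
        intro x hx
        induction hx using AddSubgroup.closure_induction with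
        | mem x hx =>
          obtain ⟨a, b, rfl⟩ := hx
          obtain ⟨n, hn, ha⟩ := exists_nsmul_mem_groupRing S a
          obtain ⟨m, hm, hb⟩ := exists_nsmul_mem_groupRing S b
          refine ⟨n * m * Nat.card Γ', mul_ne_zero (mul_ne_zero hn hm) Nat.card_pos.ne', ?_⟩
          have : (n * m * Nat.card Γ') • (augIdem Γ' * (a * avgIdem Γ' * b)) =
              (augIdem Γ' * (n • a)) * normElt Γ' * (augIdem Γ' * (m • b)) := by
            rw [← mul_assoc _ (augIdem Γ') (m • b), ← (augIdem_isCentralIdem Γ').2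
              (augIdem Γ' * n • a * normElt Γ'), normElt_eq_smul]
            simp only [mul_smul_comm, smul_mul_assoc, ← mul_assoc, (augIdem_idem Γ').eq, smul_smul]
            congr 1
            ring
          rw [this]
          exact Submodule.mul_mem_mul (Submodule.mul_mem_mul (augIdem_mul_mem he ha) hN)
            (augIdem_mul_mem he hb)
        | zero => exact ⟨1, one_ne_zero, by simp⟩
        | add x y _ _ hx hy =>
          obtain ⟨n, hn, hx⟩ := hx
          obtain ⟨m, hm, hy⟩ := hy
          refine ⟨n * m, mul_ne_zero hn hm, ?_⟩
          rw [mul_add, smul_add, mul_comm, mul_smul, mul_comm, mul_smul]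
          exact add_mem (nsmul_mem hx m) (nsmul_mem hy n)
        | neg x _ hx =>
          obtain ⟨n, hn, hx⟩ := hx
          exact ⟨n, hn, by rw [mul_neg, smul_neg]; exact neg_mem hx⟩
      obtain ⟨n, hn, hne⟩ := key _ (augIdem_mem_span Γ')
      rw [(augIdem_idem Γ').eq] at hne
      refine ⟨n, hn, fun x hx => ?_⟩
      obtain ⟨y, hy, rfl⟩ := mem_scaled.mp hx
      have h1 : n • y = (n • augIdem Γ') * y := by rw [smul_mul_assoc, hy.2]
      have h2 : (n • augIdem Γ') * y ∈ R * Nl * R * R := Submodule.mul_mem_mul hne hy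
      rw [mul_assoc (R * Nl)] at h2
      rw [h1]
      exact mul_le_mul' le_rfl (Submodule.mul_le.mpr h.mul_mem) h2
  -- If x carries T = R N R into R, then each x r N is a right Γ'-invariant of R, hence in R N; so x
  -- T ⊆ T and x lies in the left order R.
  refine hT.one_mem_of_forall h fun x h1 h2 hx => h.leftOrder hT h1 h2 fun t ht => ?_
  have hxN : ∀ r ∈ R, x * (r * normElt Γ') ∈ R * Nl := by
    intro r hr
    have h3 : x * (r * normElt Γ' * augIdem Γ') ∈ R :=
      hx _ (Submodule.mul_mem_mul (Submodule.mul_mem_mul hr hN) h.one_mem)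
    rw [augLat_mul_idem (augLat_mul_groupRing hr (normElt_mem_groupRing Γ' S))] at h3
    obtain ⟨y, hy, hyN⟩ := exists_augLat_mul_normElt he h3
      (by rw [mul_assoc, mul_assoc, normElt_mul_avgIdem])
    rw [hyN]
    exact Submodule.mul_mem_mul hy hN
  refine Submodule.mul_induction_on ht (fun a ha b hb => ?_) fun a b ha hb => ?_
  · rw [← mul_assoc]
    refine Submodule.mul_mem_mul ?_ hb
    refine Submodule.mul_induction_on ha (fun r hr c hc => ?_) fun a b ha hb => ?_
    · obtain ⟨c, rfl⟩ := Submodule.mem_span_singleton.mp hc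
      rw [mul_smul_comm, mul_smul_comm]
      exact Submodule.smul_mem _ c (hxN r hr)
    · rw [mul_add]; exact add_mem ha hb
  · rw [mul_add]; exact add_mem ha hb

theorem eq_of_mul_normElt {x y : MonoidAlgebra ℚ Γ} (h : x * normElt Γ' = y * normElt Γ') :
    x * avgIdem Γ' = y * avgIdem Γ' := by
  rw [normElt_eq_smul, mul_smul_comm, mul_smul_comm] at h
  have := congrArg (fun z => ((Nat.card Γ' : ℕ) : ℚ)⁻¹ • z) h
  simpa only [inv_smul_nsmul (Nat.card_pos (α := Γ')).ne'] using this

theorem heckeLat_one_mul {x : MonoidAlgebra ℚ Γ} (hx : x ∈ heckeLat Γ' S) :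
    augIdem Γ' * x = x := by
  have h := eq_of_mul_normElt (Γ' := Γ') (x := augIdem Γ' * x) (y := x) (by rw [mul_assoc, hx.1.2])
  rwa [mul_assoc, hx.2.2] at h

/-- The element x N is integral and right Γ'-invariant, so x N = y N with y ∈ R; dividing by |Γ'|
gives x = y e₁'. This is why integrality of x N characterizes 𝔬. -/
theorem exists_eq_mul_avgIdem (he : augIdem Γ' ∈ groupRing Γ S) {x : MonoidAlgebra ℚ Γ}
    (hx : x ∈ heckeLat Γ' S) : ∃ y ∈ augLat Γ' S, x = y * avgIdem Γ' := by
  obtain ⟨y, hy, hxy⟩ := exists_augLat_mul_normElt he hx.1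
    (by rw [mul_assoc, normElt_mul_avgIdem])
  exact ⟨y, hy, by rw [← eq_of_mul_normElt hxy, hx.2.2]⟩

theorem mem_heckeOrder_iff (he : augIdem Γ' ∈ groupRing Γ S) {x : HeckeAlg Γ'} :
    x ∈ heckeOrder Γ' S ↔ x.1 ∈ heckeLat Γ' S := by
  constructor
  · rintro ⟨⟨y, hy, hx⟩, hx'⟩
    refine ⟨?_, avgIdem_mul_of_fixed Γ' hx', by rw [hx, mul_assoc, (avgIdem_idem Γ').eq]⟩
    rw [hx, mul_assoc, avgIdem_mul_normElt]
    exact augLat_mul_groupRing (augIdem_mul_mem he hy) (normElt_mem_groupRing Γ' S)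
  · intro hx
    obtain ⟨y, hy, hxy⟩ := exists_eq_mul_avgIdem he hx
    refine ⟨⟨y, hy.1, by rw [hy.2, hxy]⟩, fun γ hγ => ?_⟩
    nth_rw 1 [← hx.2.1]
    rw [← mul_assoc, single_mul_avgIdem Γ' hγ, hx.2.1]

theorem normElt_mul_augLat_mul (r : MonoidAlgebra ℚ Γ) (hr : r ∈ augLat Γ' S) :
    normElt Γ' * r * avgIdem Γ' ∈ heckeLat Γ' S := by
  refine ⟨⟨?_, ?_⟩, by rw [← mul_assoc, ← mul_assoc, avgIdem_mul_normElt],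
    by rw [mul_assoc, (avgIdem_idem Γ').eq]⟩
  · rw [mul_assoc, avgIdem_mul_normElt]
    exact mul_mem (mul_mem (normElt_mem_groupRing Γ' S) hr.1) (normElt_mem_groupRing Γ' S)
  · rw [← mul_assoc, ← mul_assoc, ← mul_assoc, (augIdem_isCentralIdem Γ').2 (normElt Γ'),
      mul_assoc (normElt Γ') (augIdem Γ'), hr.2]

theorem heckeLat_mul {x y : MonoidAlgebra ℚ Γ} (he : augIdem Γ' ∈ groupRing Γ S)
    (hx : x ∈ heckeLat Γ' S) (hy : y ∈ heckeLat Γ' S) : x * y ∈ heckeLat Γ' S := by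
  refine ⟨?_, by rw [← mul_assoc, hx.2.1], by rw [mul_assoc, hy.2.2]⟩
  obtain ⟨w, hw, rfl⟩ := exists_eq_mul_avgIdem he hx
  rw [mul_assoc, mul_assoc, ← mul_assoc (avgIdem Γ'), hy.2.1]
  exact augLat_mul hw hy.1

theorem augIdem_mul_avgIdem_mem (he : augIdem Γ' ∈ groupRing Γ S) :
    augIdem Γ' * avgIdem Γ' ∈ heckeLat Γ' S := by
  refine ⟨?_, ?_, by rw [mul_assoc, (avgIdem_idem Γ').eq]⟩
  · rw [mul_assoc, avgIdem_mul_normElt]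
    exact augIdem_mul_mem he (normElt_mem_groupRing Γ' S)
  · rw [← mul_assoc, ← (augIdem_isCentralIdem Γ').2, mul_assoc, (avgIdem_idem Γ').eq]

/-- An overring L of 𝔬 is transported to W = R L N R. Since N R e₁' ⊆ 𝔬 ⊆ L, one has N R L ⊆ L, so W
is a ring, and it contains R N R = R. Maximality of R gives W = R, so L N ⊆ R, which is L ⊆ 𝔬. -/
theorem heckeLat_isMaxOrder (hfin : S.Finite) (hS : AllGood Γ' S) :
    IsMaxOrder (augIdem Γ' * avgIdem Γ') (heckeLat Γ' S) where
  one_mem := augIdem_mul_avgIdem_mem hS.augIdem_mem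
  mul_mem := fun x hx y hy => heckeLat_mul hS.augIdem_mem hx hy
  one_mul := fun x hx => by rw [mul_assoc, hx.2.1, heckeLat_one_mul hx]
  mul_one := fun x hx => by
    rw [← mul_assoc, ← (augIdem_isCentralIdem Γ').2, heckeLat_one_mul hx, hx.2.2]
  fin := fun n hn => by
    refine exists_finite_mod (L := heckeLat Γ' S) (n := Nat.card Γ') hfin hS.prime ?_
      Nat.card_pos.ne' ?_ hn
    · intro q hq x hx
      refine ⟨?_, ?_, ?_⟩
      · rw [smul_mul_assoc]; exact smul_mem_augLat hq hx.1
      · rw [mul_smul_comm, hx.2.1]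
      · rw [smul_mul_assoc, hx.2.2]
    · intro x hx
      have := hx.1.1
      rwa [normElt_eq_smul, mul_smul_comm, hx.2.2] at this
  max := fun L hL hmul hone hone' n hn hnL => by
    have h := augLat_isMaxOrder hfin hS
    have he := hS.augIdem_mem
    have hT := augIdem_mem_mul_normElt_mul hfin hS
    set R := augLat Γ' S
    set Nl := Submodule.span ℤ {normElt Γ'}
    have hN : normElt Γ' ∈ Nl := Submodule.mem_span_singleton_self _
    have hRR : R * R ≤ R := Submodule.mul_le.mpr h.mul_mem
    have hLe : ∀ x ∈ L, avgIdem Γ' * x = x := fun x hx => by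
      rw [← hone x hx, ← mul_assoc, ← mul_assoc, ← (augIdem_isCentralIdem Γ').2,
        mul_assoc (augIdem Γ') _ (avgIdem Γ'), (avgIdem_idem Γ').eq]
    have hLe' : ∀ x ∈ L, x * avgIdem Γ' = x := fun x hx => by
      rw [← hone' x hx, mul_assoc, mul_assoc, (avgIdem_idem Γ').eq]
    have hNRL : Nl * (R * L) ≤ L := by
      rw [← mul_assoc]
      refine Submodule.mul_le.mpr fun a ha x hx => ?_
      refine Submodule.mul_induction_on ha (fun c hc r hr => ?_) fun a b ha hb => ?_
      · obtain ⟨c, rfl⟩ := Submodule.mem_span_singleton.mp hc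
        rw [smul_mul_assoc, smul_mul_assoc, ← hLe x hx, ← mul_assoc]
        exact L.smul_mem c (hmul _ (hL (normElt_mul_augLat_mul r hr)) _ hx)
      · rw [add_mul]; exact add_mem ha hb
    set W := R * L * Nl * R with hW
    have hWW : W * W ≤ W := by
      calc W * W = R * L * Nl * (R * R) * L * Nl * R := by simp only [hW, mul_assoc]
        _ ≤ R * L * Nl * R * L * Nl * R := by
          gcongr
        _ = R * (L * (Nl * (R * L))) * Nl * R := by simp only [mul_assoc]
        _ ≤ R * L * Nl * R := by
          gcongr
          exact (mul_le_mul' le_rfl hNRL).trans (Submodule.mul_le.mpr hmul)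
    have hRW : R ≤ W := by
      have h1 : R * Nl ≤ R * L * Nl := by
        refine Submodule.mul_le.mpr fun r hr c hc => ?_
        obtain ⟨c, rfl⟩ := Submodule.mem_span_singleton.mp hc
        have : r * normElt Γ' = r * (augIdem Γ' * avgIdem Γ') * normElt Γ' := by
          rw [← mul_assoc, augLat_mul_idem hr, mul_assoc, avgIdem_mul_normElt]
        rw [mul_smul_comm, this]
        exact Submodule.smul_mem _ c (Submodule.mul_mem_mul
          (Submodule.mul_mem_mul hr (hL (augIdem_mul_avgIdem_mem he))) hN)
      intro r hr
      have h2 : r * augIdem Γ' ∈ R * (R * Nl * R) := Submodule.mul_mem_mul hr hT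
      rw [augLat_mul_idem hr, ← mul_assoc, ← mul_assoc] at h2
      exact mul_le_mul' ((mul_le_mul' hRR le_rfl).trans h1) le_rfl h2
    -- Commensurability is inherited: n L ⊆ 𝔬 and 𝔬 N ⊆ R give n W ⊆ R.
    have hK : W ≤ R.comap ((n : ℤ) • LinearMap.id) := by
      rw [hW, mul_assoc R L Nl]
      refine Submodule.mul_le.mpr fun a ha r hr => ?_
      refine Submodule.mul_induction_on ha (fun s hs b hb => ?_) fun a b ha hb => ?_
      · refine Submodule.mul_induction_on hb (fun x hx c hc => ?_) fun a b ha hb => ?_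
        · obtain ⟨c, rfl⟩ := Submodule.mem_span_singleton.mp hc
          have : n • (s * (x * c • normElt Γ') * r) = c • (s * ((n • x) * normElt Γ') * r) := by
            simp only [smul_mul_assoc, mul_smul_comm]
            rw [smul_comm]
          simp only [Submodule.mem_comap, LinearMap.smul_apply, LinearMap.id_apply, natCast_zsmul]
          rw [this]
          exact R.smul_mem c (augLat_mul (augLat_mul hs (hnL x hx).1) hr)
        · rw [mul_add, add_mul]; exact add_mem ha hb
      · rw [add_mul]; exact add_mem ha hb
    have hWone : ∀ w ∈ W, augIdem Γ' * w = w := by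
      intro w hw
      rw [hW, mul_assoc, mul_assoc] at hw
      refine Submodule.mul_induction_on hw (fun a ha b hb => ?_) fun a b ha hb => ?_
      · rw [← mul_assoc, ha.2]
      · rw [mul_add, ha, hb]
    have hWR : W ≤ R := h.max W hRW (fun x hx y hy => hWW (Submodule.mul_mem_mul hx hy)) hWone
      (fun w hw => by rw [← (augIdem_isCentralIdem Γ').2, hWone w hw]) n hn
      (fun w hw => by simpa using hK hw)
    intro x hx
    refine ⟨?_, hLe x hx, hLe' x hx⟩
    have h1 : augIdem Γ' * x * normElt Γ' * augIdem Γ' ∈ R :=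
      hWR (Submodule.mul_mem_mul (Submodule.mul_mem_mul (Submodule.mul_mem_mul h.one_mem hx) hN)
        h.one_mem)
    have h2 : augIdem Γ' * x = x := by
      rw [← hone x hx, ← mul_assoc, ← mul_assoc, (augIdem_idem Γ').eq]
    rwa [h2, ← (augIdem_isCentralIdem Γ').2, ← mul_assoc, h2] at h1

/-- The ideal J = N R e₁' of 𝔬 is full, and the claim is that it contains 1. If x J ⊆ 𝔬 then x N R N
⊆ R; since R N R = R this gives x N ∈ R, that is, x ∈ 𝔬. So J has trivial inverse in the maximal
order 𝔬. -/
theorem exists_normElt_mul_mul (hfin : S.Finite) (hS : AllGood Γ' S) :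
    ∃ z ∈ augLat Γ' S, normElt Γ' * z * avgIdem Γ' = augIdem Γ' * avgIdem Γ' := by
  have h := heckeLat_isMaxOrder hfin hS
  have hR := augLat_isMaxOrder hfin hS
  have he := hS.augIdem_mem
  have hTR := augIdem_mem_mul_normElt_mul hfin hS
  let J : Submodule ℤ (MonoidAlgebra ℚ Γ) :=
    (augLat Γ' S).map (LinearMap.mulLeftRight ℤ (normElt Γ', avgIdem Γ'))
  have hJ : ∀ x, x ∈ J ↔ ∃ r ∈ augLat Γ' S, normElt Γ' * r * avgIdem Γ' = x := by
    intro x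
    simp [J, mul_assoc]
  have hJI : IsFullIdeal (heckeLat Γ' S) J := by
    refine ⟨?_, ?_, ?_, Nat.card Γ', Nat.card_pos.ne', ?_⟩
    · intro x hx
      obtain ⟨r, hr, rfl⟩ := (hJ x).mp hx
      exact normElt_mul_augLat_mul r hr
    · intro s hs x hx
      obtain ⟨r, hr, rfl⟩ := (hJ x).mp hx
      have h1 : s * normElt Γ' * r ∈ augLat Γ' S := augLat_mul hs.1 hr
      obtain ⟨y, hy, hxy⟩ := exists_augLat_normElt_mul he h1
        (by rw [← mul_assoc, ← mul_assoc, hs.2.1])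
      exact (hJ _).mpr ⟨y, hy, by rw [← hxy]; simp only [mul_assoc]⟩
    · intro s hs x hx
      obtain ⟨r, hr, rfl⟩ := (hJ x).mp hx
      obtain ⟨y, hy, rfl⟩ := exists_eq_mul_avgIdem he hs
      refine (hJ _).mpr ⟨r * y, augLat_mul hr hy, ?_⟩
      rw [mul_assoc (normElt Γ' * r), hs.2.1]
      simp only [mul_assoc]
    · intro x hx
      obtain ⟨s, hs, rfl⟩ := mem_scaled.mp hx
      obtain ⟨y, hy, rfl⟩ := exists_eq_mul_avgIdem he hs
      refine (hJ _).mpr ⟨y, hy, ?_⟩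
      rw [normElt_eq_smul, smul_mul_assoc, smul_mul_assoc, mul_assoc, hs.2.1]
  refine (hJ _).mp (hJI.one_mem_of_forall h fun x h1 h2 hx => ?_)
  have h3 : avgIdem Γ' * x = x := by
    rw [← h1, ← mul_assoc, ← mul_assoc, ← (augIdem_isCentralIdem Γ').2,
      mul_assoc (augIdem Γ') _ (avgIdem Γ'), (avgIdem_idem Γ').eq]
  have h4 : x * avgIdem Γ' = x := by rw [← h2, mul_assoc, mul_assoc, (avgIdem_idem Γ').eq]
  have h5 : x * augIdem Γ' = x := by
    rw [← (augIdem_isCentralIdem Γ').2, ← h1, ← mul_assoc, ← mul_assoc, (augIdem_idem Γ').eq]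
  refine ⟨?_, h3, h4⟩
  have key : ∀ t ∈ augLat Γ' S * Submodule.span ℤ {normElt Γ'} * augLat Γ' S,
      x * normElt Γ' * t ∈ augLat Γ' S := by
    intro t ht
    refine Submodule.mul_induction_on ht (fun a ha b hb => ?_) fun a b ha hb => ?_
    · refine Submodule.mul_induction_on ha (fun r hr c hc => ?_) fun a b ha hb => ?_
      · obtain ⟨c, rfl⟩ := Submodule.mem_span_singleton.mp hc
        have h6 := (hx _ ((hJ _).mpr ⟨r, hr, rfl⟩)).1
        have h7 : x * normElt Γ' * (r * c • normElt Γ' * b) =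
            c • (x * (normElt Γ' * r * avgIdem Γ') * normElt Γ' * b) := by
          simp only [mul_smul_comm, smul_mul_assoc, mul_assoc]
          rw [← mul_assoc (avgIdem Γ') (normElt Γ'), avgIdem_mul_normElt]
        rw [h7]
        exact Submodule.smul_mem _ c (augLat_mul h6 hb)
      · rw [add_mul, mul_add]; exact add_mem ha hb
    · rw [mul_add]; exact add_mem ha hb
  have := key _ hTR
  rwa [mul_assoc, ← (augIdem_isCentralIdem Γ').2, ← mul_assoc, h5] at this

end Lattices

/-! ### The inverse functor: the image of an idempotent matrix -/

section InducedModule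

variable {R O ι : Type*} [Ring R] [Ring O] [Fintype ι] (c : R →+ O) {N : R} (x y : ι → R)
  (H : Type*) [AddCommGroup H] [Module O H]

/-- The image of the idempotent matrix `(c (y j * x l))` on `H^ι`. -/
def matrixModule : AddSubgroup (ι → H) where
  carrier := {h | ∀ j, ∑ l, c (y j * x l) • h l = h j}
  zero_mem' := fun j => by simp
  add_mem' := fun ha hb j => by simp [Finset.sum_add_distrib, ha j, hb j]
  neg_mem' := fun ha j => by simp [ha j]

variable {c x y} (hc : ∀ r s, c r * c s = c (r * N * s)) (h1 : ∑ i, x i * N * y i = 1)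

-- The products c (r N s) insert the factor N that turns ∑ x_l y_l into ∑ x_l N y_l = 1. For r =
-- y_j, s = x_i this says that the matrix (c (y_j x_l)) is idempotent.
include hc h1 in
theorem sum_matrix_mul (r s : R) :
    ∑ l, c (r * x l) * c (y l * s) = c (r * s) := by
  simp only [hc, ← map_sum]
  congr 1
  have : ∀ l, r * x l * N * (y l * s) = r * (x l * N * y l) * s := fun l => by noncomm_ring
  simp only [this, ← Finset.sum_mul, ← Finset.mul_sum, h1, mul_one]

variable {H} in
include hc h1 in
theorem sum_matrix_smul (r s : R) (h : ι → H) :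
    ∑ l, c (r * x l) • ∑ i, c (y l * s * x i) • h i = ∑ i, c (r * s * x i) • h i := by
  simp only [Finset.smul_sum, smul_smul]
  rw [Finset.sum_comm]
  simp only [← Finset.sum_smul]
  refine Finset.sum_congr rfl fun i _ => ?_
  congr 1
  rw [mul_assoc r, ← sum_matrix_mul hc h1]
  simp only [mul_assoc]

/-- The action of `R` on the image of the idempotent matrix. -/
@[reducible]
def matrixModuleModule : Module R (matrixModule c x y H) where
  smul r h := ⟨fun j => ∑ l, c (y j * r * x l) • h.1 l, fun j => by
    rw [sum_matrix_smul hc h1]⟩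
  one_smul h := Subtype.ext (funext fun j => by
    show ∑ l, c (y j * 1 * x l) • h.1 l = h.1 j
    rw [mul_one]; exact h.2 j)
  mul_smul r s h := Subtype.ext (funext fun j => by
    show ∑ l, c (y j * (r * s) * x l) • h.1 l =
      ∑ l, c (y j * r * x l) • ∑ i, c (y l * s * x i) • h.1 i
    rw [sum_matrix_smul hc h1, mul_assoc (y j)])
  smul_zero r := Subtype.ext (funext fun j => by
    show ∑ l, c (y j * r * x l) • (0 : H) = 0
    simp)
  smul_add r g h := Subtype.ext (funext fun j => by
    show ∑ l, c (y j * r * x l) • (g.1 l + h.1 l) = ∑ l, _ • g.1 l + ∑ l, _ • h.1 l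
    simp [Finset.sum_add_distrib])
  add_smul r s h := Subtype.ext (funext fun j => by
    show ∑ l, c (y j * (r + s) * x l) • h.1 l =
      ∑ l, c (y j * r * x l) • h.1 l + ∑ l, c (y j * s * x l) • h.1 l
    simp [mul_add, add_mul, add_smul, Finset.sum_add_distrib])
  zero_smul h := Subtype.ext (funext fun j => by
    show ∑ l, c (y j * 0 * x l) • h.1 l = 0
    simp)

end InducedModule

/-! ### The Morita equivalence between R-modules and 𝔬-modules -/

section Equivalence

variable {Γ : Type*} [Group Γ] [Finite Γ] {Γ' : Subgroup Γ} {S : Set ℕ}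

/-- An element of the lattice `e_{Γ/Γ'} ℤ_S[Γ]` as an element of the ring. -/
def augMk (he : augIdem Γ' ∈ groupRing Γ S) {x : MonoidAlgebra ℚ Γ} (hx : x ∈ augLat Γ' S) :
    augRing Γ' S :=
  ⟨⟨x, (Subsemigroup.mem_corner_iff (augIdem_idem Γ')).mpr ⟨hx.2, augLat_mul_idem hx⟩⟩,
    (mem_augRing_iff he).mpr hx⟩

theorem augRing_ext {a b : augRing Γ' S} (h : a.1.1 = b.1.1) : a = b :=
  Subtype.ext (Subtype.ext h)

theorem heckeOrder_ext {a b : heckeOrder Γ' S} (h : a.1.1 = b.1.1) : a = b :=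
  Subtype.ext (Subtype.ext h)

theorem augRing_val_mem (he : augIdem Γ' ∈ groupRing Γ S) (r : augRing Γ' S) :
    r.1.1 ∈ augLat Γ' S := (mem_augRing_iff he).mp r.2

variable (Γ' S) in
/-- The image of the norm element in `e_{Γ/Γ'} ℤ_S[Γ]`. -/
noncomputable def normRing : augRing Γ' S :=
  ⟨⟨augIdem Γ' * normElt Γ', (Subsemigroup.mem_corner_iff (augIdem_idem Γ')).mpr
    ⟨by rw [← mul_assoc, (augIdem_idem Γ').eq],
      by rw [← (augIdem_isCentralIdem Γ').2, ← mul_assoc, (augIdem_idem Γ').eq]⟩⟩,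
    _, normElt_mem_groupRing Γ' S, rfl⟩

theorem augRing_mul_normRing (r : augRing Γ' S) : (r * normRing Γ' S).1.1 = r.1.1 * normElt Γ' := by
  show r.1.1 * (augIdem Γ' * normElt Γ') = _
  rw [← mul_assoc, ((Subsemigroup.mem_corner_iff (augIdem_idem Γ')).mp r.1.2).2]

theorem normRing_mul (r : augRing Γ' S) : (normRing Γ' S * r).1.1 = normElt Γ' * r.1.1 := by
  show (augIdem Γ' * normElt Γ') * r.1.1 = _
  rw [(augIdem_isCentralIdem Γ').2, mul_assoc,
    ((Subsemigroup.mem_corner_iff (augIdem_idem Γ')).mp r.1.2).1]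

theorem toAugRing_single_val (γ : Γ) :
    (toAugRing Γ' S (MonoidAlgebra.single γ 1)).1.1 = augIdem Γ' * MonoidAlgebra.single γ 1 := by
  show augIdem Γ' * MonoidAlgebra.mapRingHom Γ (ZS S).subtype (MonoidAlgebra.single γ 1) = _
  rw [MonoidAlgebra.mapRingHom_single, map_one]

theorem augRing_mul_single (r : augRing Γ' S) (γ : Γ) :
    (r * toAugRing Γ' S (MonoidAlgebra.single γ 1)).1.1 = r.1.1 * MonoidAlgebra.single γ 1 := by
  show r.1.1 * (toAugRing Γ' S (MonoidAlgebra.single γ 1)).1.1 = _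
  rw [toAugRing_single_val, ← mul_assoc,
    ((Subsemigroup.mem_corner_iff (augIdem_idem Γ')).mp r.1.2).2]

theorem single_mul_normRing {γ : Γ} (hγ : γ ∈ Γ') :
    toAugRing Γ' S (MonoidAlgebra.single γ 1) * normRing Γ' S = normRing Γ' S := by
  apply augRing_ext
  rw [augRing_mul_normRing, toAugRing_single_val, mul_assoc]
  show _ = augIdem Γ' * normElt Γ'
  congr 1
  rw [normElt_eq_smul, mul_smul_comm, single_mul_avgIdem Γ' hγ]

theorem exists_normRing_mul_mul (hfin : S.Finite) (hS : AllGood Γ' S) :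
    ∃ z : augRing Γ' S, (normElt Γ' * z.1.1) * avgIdem Γ' = augIdem Γ' * avgIdem Γ' := by
  obtain ⟨z, hz, h⟩ := exists_normElt_mul_mul hfin hS
  exact ⟨augMk hS.augIdem_mem hz, h⟩

theorem exists_sum_mul_normRing_mul (hfin : S.Finite) (hS : AllGood Γ' S) :
    ∃ (ι : Type) (_ : Fintype ι) (x y : ι → augRing Γ' S), ∑ i, x i * normRing Γ' S * y i = 1 := by
  have he := hS.augIdem_mem
  have key : ∀ t ∈ augLat Γ' S * Submodule.span ℤ {normElt Γ'} * augLat Γ' S,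
      ∃ (ι : Type) (_ : Fintype ι) (x y : ι → augRing Γ' S),
        (∑ i, x i * normRing Γ' S * y i).1.1 = t := by
    intro t ht
    refine Submodule.mul_induction_on ht (fun a ha b hb => ?_) ?_
    · refine Submodule.mul_induction_on ha (fun r hr c hc => ?_) ?_
      · obtain ⟨c, rfl⟩ := Submodule.mem_span_singleton.mp hc
        refine ⟨Unit, inferInstance, fun _ => c • augMk he hr, fun _ => augMk he hb, ?_⟩
        rw [Finset.sum_const, Finset.card_univ, Fintype.card_unit, one_smul]
        show ((c • augMk he hr * normRing Γ' S).1.1) * b = _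
        rw [augRing_mul_normRing, mul_smul_comm]
        congr 1
        show (c • r) * _ = _
        rw [smul_mul_assoc]
      · rintro a a' ⟨ι, _, x, y, h⟩ ⟨ι', _, x', y', h'⟩
        refine ⟨ι ⊕ ι', inferInstance, Sum.elim x x', Sum.elim y y', ?_⟩
        rw [Fintype.sum_sum_type, add_mul, ← h, ← h']
        rfl
    · rintro a a' ⟨ι, _, x, y, h⟩ ⟨ι', _, x', y', h'⟩
      refine ⟨ι ⊕ ι', inferInstance, Sum.elim x x', Sum.elim y y', ?_⟩
      rw [Fintype.sum_sum_type, ← h, ← h']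
      rfl
  obtain ⟨ι, hι, x, y, h⟩ := key _ (augIdem_mem_mul_normElt_mul hfin hS)
  exact ⟨ι, hι, x, y, augRing_ext h⟩

/-- The additive map `s ↦ N s e₁'` from `e_{Γ/Γ'} ℤ_S[Γ]` to `𝔬`. -/
noncomputable def heckeMap (hS : AllGood Γ' S) : augRing Γ' S →+ heckeOrder Γ' S where
  toFun s := ⟨⟨normElt Γ' * s.1.1 * avgIdem Γ', by
      have h := normElt_mul_augLat_mul s.1.1 (augRing_val_mem hS.augIdem_mem s)
      refine (Subsemigroup.mem_corner_iff (augIdem_mul_avgIdem_idem Γ')).mpr ⟨?_, ?_⟩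
      · rw [mul_assoc (augIdem Γ'), h.2.1, heckeLat_one_mul h]
      · rw [← mul_assoc, ← (augIdem_isCentralIdem Γ').2, heckeLat_one_mul h, h.2.2]⟩,
    (mem_heckeOrder_iff hS.augIdem_mem).mpr
      (normElt_mul_augLat_mul s.1.1 (augRing_val_mem hS.augIdem_mem s))⟩
  map_zero' := heckeOrder_ext (by
    show normElt Γ' * 0 * avgIdem Γ' = 0
    rw [mul_zero, zero_mul])
  map_add' a b := heckeOrder_ext (by
    show normElt Γ' * (a.1.1 + b.1.1) * avgIdem Γ' =
      normElt Γ' * a.1.1 * avgIdem Γ' + normElt Γ' * b.1.1 * avgIdem Γ'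
    rw [mul_add, add_mul])

variable (hS : AllGood Γ' S)

theorem heckeMap_val (s : augRing Γ' S) :
    (heckeMap hS s).1.1 = normElt Γ' * s.1.1 * avgIdem Γ' := rfl

/-- The middle e₁' is absorbed by the following N. This is the relation required by `matrixModule`.
-/
theorem heckeMap_mul (r s : augRing Γ' S) :
    heckeMap hS r * heckeMap hS s = heckeMap hS (r * normRing Γ' S * s) := by
  apply heckeOrder_ext
  show normElt Γ' * r.1.1 * avgIdem Γ' * (normElt Γ' * s.1.1 * avgIdem Γ') =
    normElt Γ' * ((r * normRing Γ' S).1.1 * s.1.1) * avgIdem Γ'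
  rw [augRing_mul_normRing, mul_assoc (normElt Γ' * r.1.1), ← mul_assoc (avgIdem Γ'),
    ← mul_assoc (avgIdem Γ'), avgIdem_mul_normElt]
  simp only [mul_assoc]

theorem heckeMap_eq_one {z : augRing Γ' S}
    (hz : normElt Γ' * z.1.1 * avgIdem Γ' = augIdem Γ' * avgIdem Γ') : heckeMap hS z = 1 :=
  heckeOrder_ext hz

theorem heckeMap_mul_single (s : augRing Γ' S) {γ : Γ} (hγ : γ ∈ Γ') :
    heckeMap hS (s * toAugRing Γ' S (MonoidAlgebra.single γ 1)) = heckeMap hS s := by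
  apply heckeOrder_ext
  rw [heckeMap_val, heckeMap_val, augRing_mul_single, mul_assoc, mul_assoc,
    single_mul_avgIdem Γ' hγ, mul_assoc]

/-- If N z e₁' is the identity of 𝔬 and x = y e₁', then N (z y) e₁' = (N z e₁') x = x. -/
theorem heckeMap_surjective (hfin : S.Finite) : Function.Surjective (heckeMap hS) := by
  intro x
  obtain ⟨z, hz⟩ := exists_normRing_mul_mul hfin hS
  obtain ⟨y, hy, hxy⟩ := exists_eq_mul_avgIdem hS.augIdem_mem
    ((mem_heckeOrder_iff hS.augIdem_mem).mp x.2)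
  refine ⟨z * augMk hS.augIdem_mem hy, heckeOrder_ext ?_⟩
  show normElt Γ' * (z.1.1 * y) * avgIdem Γ' = x.1.1
  rw [mul_assoc, mul_assoc, ← hxy, ← avgIdem_mul_heckeOrder x, ← mul_assoc, ← mul_assoc, hz,
    mul_assoc, avgIdem_mul_heckeOrder]
  exact heckeLat_one_mul ((mem_heckeOrder_iff hS.augIdem_mem).mp x.2)

section Modules

variable {G : Type*} [AddCommGroup G] [Module (augRing Γ' S) G] {G' : Type*} [AddCommGroup G']
  [Module (augRing Γ' S) G']

theorem normRing_smul_mem (g : G) : normRing Γ' S • g ∈ invSubgroup Γ' S G := fun γ hγ => by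
  rw [← mul_smul, single_mul_normRing hγ]

theorem heckeMap_smul_val (s : augRing Γ' S) (g : GammaInv hS G) :
    (heckeMap hS s • g).1 = (normRing Γ' S * s) • g.1 := by
  refine GammaInv.smul_val hS G _ _ ?_ g
  rw [normRing_mul, heckeMap_val]

/-- The map `g ↦ N s g` from `G` to its invariants. -/
noncomputable def normSMul (s : augRing Γ' S) : G →+ GammaInv hS G where
  toFun g := ⟨normRing Γ' S • s • g, normRing_smul_mem _⟩
  map_zero' := Subtype.ext (by
    show normRing Γ' S • s • (0 : G) = 0
    simp)
  map_add' a b := Subtype.ext (by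
    show normRing Γ' S • s • (a + b) = normRing Γ' S • s • a + normRing Γ' S • s • b
    simp)

variable (G) in
/-- The inclusion of the invariants. -/
def GammaInv.incl : GammaInv hS G →+ G := (invSubgroup Γ' S G).subtype

theorem incl_heckeMap_smul (s : augRing Γ' S) (g : GammaInv hS G) :
    GammaInv.incl hS G (heckeMap hS s • g) = normRing Γ' S • s • GammaInv.incl hS G g := by
  rw [← mul_smul]
  exact heckeMap_smul_val hS s g

theorem incl_normSMul (s : augRing Γ' S) (g : G) :
    GammaInv.incl hS G (normSMul hS s g) = normRing Γ' S • s • g := rfl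

theorem incl_injective : Function.Injective (GammaInv.incl hS G) := Subtype.val_injective

variable {ι : Type*} [Fintype ι] {x y : ι → augRing Γ' S}

/-- R N R = R applied to g: every element is an R-combination of the invariants N y_i g. Hence
homomorphisms are determined by, and extend from, the invariants. -/
theorem sum_smul_incl_normSMul (h1 : ∑ i, x i * normRing Γ' S * y i = 1) (g : G) :
    ∑ i, x i • GammaInv.incl hS G (normSMul hS (y i) g) = g := by
  simp only [mul_assoc] at h1
  simp only [incl_normSMul, ← mul_smul, ← Finset.sum_smul]
  rw [h1, one_smul]

theorem ext_of_incl (h1 : ∑ i, x i * normRing Γ' S * y i = 1) {f g : G →ₗ[augRing Γ' S] G'}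
    (h : ∀ a, f (GammaInv.incl hS G a) = g (GammaInv.incl hS G a)) : f = g := by
  ext a
  rw [← sum_smul_incl_normSMul hS h1 a, map_sum, map_sum]
  refine Finset.sum_congr rfl fun i _ => ?_
  rw [map_smul, map_smul, h]

/-- A homomorphism between the invariants extends to the modules. -/
theorem exists_extension (h1 : ∑ i, x i * normRing Γ' S * y i = 1)
    (f : GammaInv hS G →ₗ[heckeOrder Γ' S] GammaInv hS G') :
    ∃ F : G →ₗ[augRing Γ' S] G',
      ∀ a, F (GammaInv.incl hS G a) = GammaInv.incl hS G' (f a) := by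
  refine ⟨
    { toFun := fun g => ∑ i, x i • GammaInv.incl hS G' (f (normSMul hS (y i) g))
      map_add' := fun a b => by simp [Finset.sum_add_distrib]
      map_smul' := fun r g => ?_ }, fun a => ?_⟩
  -- Expanding g by the invariants N y_l g turns N y_j r into elements N y_j r x_l, which act on
  -- invariants as elements of 𝔬 and so pass through f.
  · have key : ∀ j, f (normSMul hS (y j) (r • g)) =
        ∑ l, heckeMap hS (y j * r * x l) • f (normSMul hS (y l) g) := by
      intro j
      simp only [← map_smul, ← map_sum]
      congr 1
      apply incl_injective
      simp only [map_sum, incl_heckeMap_smul, incl_normSMul]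
      nth_rw 1 [← sum_smul_incl_normSMul hS h1 g]
      simp only [Finset.smul_sum, incl_normSMul, mul_smul]
    simp only [key, map_sum, incl_heckeMap_smul, Finset.smul_sum, RingHom.id_apply]
    rw [Finset.sum_comm]
    refine Finset.sum_congr rfl fun l _ => ?_
    simp only [← mul_smul, ← Finset.sum_smul]
    congr 1
    have : ∀ i, x i * normRing Γ' S * (y i * r * x l) = (x i * normRing Γ' S * y i) * (r * x l) :=
      fun i => by noncomm_ring
    simp only [← mul_assoc] at this ⊢
    simp only [mul_assoc _ r]
    simp only [← Finset.sum_mul, h1, one_mul]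
  · have key : ∀ j, f (normSMul hS (y j) (GammaInv.incl hS G a)) = heckeMap hS (y j) • f a := by
      intro j
      rw [← map_smul]
      congr 1
      apply incl_injective
      rw [incl_heckeMap_smul, incl_normSMul]
    show ∑ i, x i • GammaInv.incl hS G' (f (normSMul hS (y i) (GammaInv.incl hS G a))) = _
    simp only [mul_assoc] at h1
    simp only [key, incl_heckeMap_smul, ← mul_smul, ← Finset.sum_smul]
    rw [h1, one_smul]

theorem exists_extension_equiv (h1 : ∑ i, x i * normRing Γ' S * y i = 1)
    (f : GammaInv hS G ≃ₗ[heckeOrder Γ' S] GammaInv hS G') :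
    ∃ F : G ≃ₗ[augRing Γ' S] G', ∀ a, F (GammaInv.incl hS G a) = GammaInv.incl hS G' (f a) := by
  obtain ⟨F, hF⟩ := exists_extension hS h1 f.toLinearMap
  obtain ⟨F', hF'⟩ := exists_extension hS h1 f.symm.toLinearMap
  refine ⟨LinearEquiv.ofLinearMap F F' (ext_of_incl hS h1 fun a => ?_) (ext_of_incl hS h1 fun a => ?_),
    hF⟩
  · simp [hF, hF']
  · simp [hF, hF']

variable (G) in
/-- `Aut_R(G) ≅ Aut_𝔬(^{Γ'}G)`. -/
noncomputable def autEquiv (h1 : ∑ i, x i * normRing Γ' S * y i = 1) :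
    (G ≃ₗ[augRing Γ' S] G) ≃* (GammaInv hS G ≃ₗ[heckeOrder Γ' S] GammaInv hS G) :=
  MulEquiv.ofBijective
    (⟨⟨fun F => GammaInv.congr hS F, rfl⟩, fun _ _ => rfl⟩ :
      (G ≃ₗ[augRing Γ' S] G) →* (GammaInv hS G ≃ₗ[heckeOrder Γ' S] GammaInv hS G)) (by
    constructor
    · intro F F' h
      have : F.toLinearMap = F'.toLinearMap := ext_of_incl hS h1 fun a =>
        congrArg Subtype.val (LinearEquiv.congr_fun h a)
      exact LinearEquiv.toLinearMap_injective this
    · intro f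
      obtain ⟨F, hF⟩ := exists_extension_equiv hS h1 f
      exact ⟨F, LinearEquiv.ext fun a => Subtype.ext (hF a)⟩)

end Modules

/-- Every finite `𝔬`-module is the module of invariants of a finite module. -/
theorem exists_gammaInv_equiv (hfin : S.Finite) (H : Type w) [AddCommGroup H]
    [Module (heckeOrder Γ' S) H] [Finite H] :
    ∃ (G : Type w) (_ : AddCommGroup G) (_ : Module (augRing Γ' S) G), Finite G ∧
      Nonempty (GammaInv hS G ≃ₗ[heckeOrder Γ' S] H) := by
  obtain ⟨ι, _, x, y, h1⟩ := exists_sum_mul_normRing_mul hfin hS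
  obtain ⟨z, hz⟩ := exists_normRing_mul_mul hfin hS
  have hz1 := heckeMap_eq_one hS hz
  have hc := heckeMap_mul hS
  let _ : Module (augRing Γ' S) (matrixModule (heckeMap hS) x y H) := matrixModuleModule H hc h1
  have hsmul : ∀ (r : augRing Γ' S) (h : matrixModule (heckeMap hS) x y H) (j : ι),
      (r • h).1 j = ∑ l, heckeMap hS (y j * r * x l) • h.1 l := fun _ _ _ => rfl
  refine ⟨matrixModule (heckeMap hS) x y H, inferInstance, inferInstance, inferInstance, ⟨?_⟩⟩
  have hmem : ∀ h : H, (fun j => heckeMap hS (y j) • h) ∈ matrixModule (heckeMap hS) x y H := by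
    intro h j
    simp only [smul_smul, ← Finset.sum_smul]
    congr 1
    have := sum_matrix_mul hc h1 (y j) 1
    simpa using this
  have hact : ∀ (r : augRing Γ' S) (h : H),
      (r • (⟨_, hmem h⟩ : matrixModule (heckeMap hS) x y H)).1 =
        fun j => heckeMap hS (y j * r) • h := by
    intro r h
    funext j
    rw [hsmul]
    simp only [smul_smul, ← Finset.sum_smul]
    congr 1
    have := sum_matrix_mul hc h1 (y j * r) 1
    simpa using this
  have hinv : ∀ h : H, (⟨_, hmem h⟩ : matrixModule (heckeMap hS) x y H) ∈
      invSubgroup Γ' S (matrixModule (heckeMap hS) x y H) := by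
    intro h γ hγ
    apply Subtype.ext
    rw [hact]
    funext j
    rw [heckeMap_mul_single hS _ hγ]
  -- In a module G with invariants H, an invariant h has coordinates N y_j h; this is the same
  -- formula.
  let Φ : H →ₗ[heckeOrder Γ' S] GammaInv hS (matrixModule (heckeMap hS) x y H) :=
    { toFun := fun h => ⟨⟨_, hmem h⟩, hinv h⟩
      map_add' := fun a b => Subtype.ext (Subtype.ext (funext fun j => smul_add _ _ _))
      map_smul' := fun s h => by
        obtain ⟨s, rfl⟩ := heckeMap_surjective hS hfin s
        refine Subtype.ext (Eq.trans (Subtype.ext ?_) (heckeMap_smul_val hS s ⟨_, hinv h⟩).symm)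
        refine Eq.trans (funext fun j => ?_) (hact (normRing Γ' S * s) h).symm
        show heckeMap hS (y j) • heckeMap hS s • h = _
        rw [smul_smul, hc, mul_assoc] }
  refine (LinearEquiv.ofBijective Φ ⟨?_, ?_⟩).symm
  · rw [injective_iff_map_eq_zero]
    intro h hh
    have h0 : ∀ j, heckeMap hS (y j) • h = 0 := fun j =>
      congrFun (congrArg (fun g : GammaInv hS (matrixModule (heckeMap hS) x y H) => g.1.1) hh) j
    have : ∑ l, heckeMap hS (z * x l) • heckeMap hS (y l) • h = h := by
      simp only [smul_smul, ← Finset.sum_smul]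
      have := sum_matrix_mul hc h1 z 1
      simp only [mul_one, hz1] at this
      rw [this, one_smul]
    rw [← this]
    exact Finset.sum_eq_zero fun l _ => by rw [h0, smul_zero]
  · intro g
    -- Since N z acts as 1 on invariants, h = N z ∑ x_l h_l recovers h from its coordinates h_l.
    refine ⟨∑ l, heckeMap hS (z * x l) • g.1.1 l, ?_⟩
    apply Subtype.ext
    apply Subtype.ext
    have h2 : (heckeMap hS z • g).1 = g.1 := by rw [hz1, one_smul]
    rw [heckeMap_smul_val] at h2
    refine Eq.trans (funext fun j => ?_) (congrArg Subtype.val h2)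
    rw [hsmul]
    show heckeMap hS (y j) • ∑ l, heckeMap hS (z * x l) • g.1.1 l = _
    simp only [Finset.smul_sum, smul_smul, hc]
    refine Finset.sum_congr rfl fun l _ => ?_
    simp only [mul_assoc]

end Equivalence

/-! ### Cardinalities, simple modules and indices -/

section Counting

variable {R : Type*} [Ring R]

/-- The number of elements of `r G`. -/
noncomputable def smulCard (r : R) (G : Type*) [AddCommGroup G] [Module R G] : ℕ :=
  Nat.card (DistribSMul.toAddMonoidHom G r).range

variable {G : Type*} [AddCommGroup G] [Module R G]

theorem smulCard_one : smulCard (1 : R) G = Nat.card G := by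
  unfold smulCard
  rw [AddMonoidHom.range_eq_top.mpr fun g => ⟨g, one_smul R g⟩]
  exact Nat.card_congr AddSubgroup.topEquiv.toEquiv

theorem smulCard_eq_one {r : R} (h : ∀ g : G, r • g = 0) : smulCard r G = 1 := by
  unfold smulCard
  rw [Nat.card_eq_one_iff_unique]
  refine ⟨⟨?_⟩, ⟨0⟩⟩
  rintro ⟨_, g, rfl⟩ ⟨_, g', rfl⟩
  exact Subtype.ext ((h g).trans (h g').symm)

theorem smulCard_congr {G' : Type*} [AddCommGroup G'] [Module R G'] (f : G ≃ₗ[R] G') (r : R) :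
    smulCard r G = smulCard r G' := by
  refine Nat.card_congr (f.toEquiv.subtypeEquiv fun g => ?_)
  constructor
  · rintro ⟨x, rfl⟩
    exact ⟨f x, by simp⟩
  · rintro ⟨x, hx⟩
    refine ⟨f.symm x, f.injective ?_⟩
    rw [DistribSMul.toAddMonoidHom_apply, map_smul, f.apply_symm_apply]
    exact hx

/-- For an idempotent r the functor G ↦ r G is exact: r fixes r G, so r G ∩ W = r W. -/
theorem smulCard_submodule_quotient [Finite G] {r : R} (hr : r * r = r) (W : Submodule R G) :
    smulCard r G = smulCard r W * smulCard r (G ⧸ W) := by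
  let f : (DistribSMul.toAddMonoidHom G r).range →+ (DistribSMul.toAddMonoidHom (G ⧸ W) r).range :=
    { toFun := fun g => ⟨W.mkQ g.1, by
        obtain ⟨_, g, rfl⟩ := g
        exact ⟨W.mkQ g, by simp⟩⟩
      map_zero' := Subtype.ext (map_zero _)
      map_add' := fun a b => Subtype.ext (map_add W.mkQ a.1 b.1) }
  have hsurj : Function.Surjective f := by
    rintro ⟨_, g, rfl⟩
    obtain ⟨g, rfl⟩ := W.mkQ_surjective g
    exact ⟨⟨_, g, rfl⟩, Subtype.ext (by simp [f])⟩
  have hker : Nat.card f.ker = smulCard r W := by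
    symm
    refine Nat.card_congr ⟨fun w => ⟨⟨w.1.1, ?_⟩, ?_⟩, fun g => ⟨⟨g.1.1, ?_⟩, ?_⟩, ?_, ?_⟩
    · obtain ⟨_, w, rfl⟩ := w
      exact ⟨w.1, rfl⟩
    · exact Subtype.ext (by simp [f])
    · have := congrArg Subtype.val g.2
      simpa [f] using this
    · obtain ⟨⟨_, g, rfl⟩, hg⟩ := g
      refine ⟨⟨r • g, ?_⟩, Subtype.ext ?_⟩
      · have h0 : W.mkQ (r • g) = 0 := congrArg Subtype.val hg
        exact (Submodule.Quotient.mk_eq_zero W).mp h0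
      · show r • r • g = r • g
        rw [← mul_smul, hr]
    · intro w; rfl
    · intro g; rfl
  have h1 := AddSubgroup.card_mul_index f.ker
  rw [hker, AddSubgroup.index_ker, AddMonoidHom.range_eq_top.mpr hsurj] at h1
  rw [smulCard, ← h1]
  congr 1
  exact Nat.card_congr AddSubgroup.topEquiv.toEquiv

/-- A nonzero class r + M in K has r v ≠ 0 for some v ∈ U, so evaluation at v is nonzero on K and
Schur's lemma applies. -/
theorem nonempty_linearEquiv_of_mem_iff {U : Type*} [AddCommGroup U] [Module R U]
    [IsSimpleModule R U] (M : Submodule R R) (hU : ∀ r, r ∈ M ↔ ∀ v : U, r • v = 0)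
    (K : Submodule R (R ⧸ M)) [hK : IsSimpleModule R K] : Nonempty (K ≃ₗ[R] U) := by
  obtain ⟨k, hk, hk0⟩ := Submodule.exists_mem_ne_zero_of_ne_bot (isSimpleModule_iff_isAtom.mp hK).1
  obtain ⟨r, rfl⟩ := M.mkQ_surjective k
  have hr : r ∉ M := fun hr => hk0 ((Submodule.Quotient.mk_eq_zero M).mpr hr)
  rw [hU] at hr
  push Not at hr
  obtain ⟨v, hv⟩ := hr
  let g := (M.liftQ (LinearMap.toSpanSingleton R U v) (fun r hr => (hU r).mp hr v)).comp K.subtype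
  have hg : g ≠ 0 := fun h0 => hv (LinearMap.congr_fun h0 ⟨_, hk⟩)
  exact ⟨LinearEquiv.ofBijective g (LinearMap.bijective_of_ne_zero hg)⟩

/-- Finite simple modules with the same annihilator are isomorphic. -/
theorem nonempty_linearEquiv_of_annihilator_eq {V W : Type*} [AddCommGroup V] [Module R V]
    [Finite V] [IsSimpleModule R V] [AddCommGroup W] [Module R W] [IsSimpleModule R W]
    (h : Module.annihilator R V = Module.annihilator R W) : Nonempty (V ≃ₗ[R] W) := by
  let M : Submodule R R := Module.annihilator R V
  have hM : ∀ r, r ∈ M ↔ ∀ v : V, r • v = 0 := fun r => Module.mem_annihilator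
  have hM' : ∀ r, r ∈ M ↔ ∀ v : W, r • v = 0 := fun r => by
    rw [show M = Module.annihilator R W from h]
    exact Module.mem_annihilator
  -- R/M acts faithfully on the finite set V, so it is finite and has a simple submodule; both V and
  -- W are isomorphic to it.
  have hfin : Finite (R ⧸ M) := by
    refine Finite.of_injective (β := V → V)
      (fun q v => M.liftQ (LinearMap.toSpanSingleton R V v) (fun r hr => (hM r).mp hr v) q) ?_
    intro p q hpq
    obtain ⟨p, rfl⟩ := M.mkQ_surjective p
    obtain ⟨q, rfl⟩ := M.mkQ_surjective q
    rw [← sub_eq_zero, ← map_sub, Submodule.mkQ_apply, Submodule.Quotient.mk_eq_zero, hM]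
    intro v
    rw [sub_smul, sub_eq_zero]
    exact congrFun hpq v
  have hnt : Nontrivial (R ⧸ M) := by
    rw [Submodule.Quotient.nontrivial_iff]
    intro hc
    have := IsSimpleModule.nontrivial R V
    obtain ⟨v, hv⟩ := exists_ne (0 : V)
    have := (hM 1).mp (hc ▸ Submodule.mem_top) v
    rw [one_smul] at this
    exact hv this
  obtain ⟨K, hK⟩ := IsAtomic.exists_atom (Submodule R (R ⧸ M))
  have hKs : IsSimpleModule R K := isSimpleModule_iff_isAtom.mpr hK
  exact ⟨(nonempty_linearEquiv_of_mem_iff M hM K).some.symm.trans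
    (nonempty_linearEquiv_of_mem_iff M hM' K).some⟩

/-- The index of the image of ψ₂ α = α ψ₁ in L₂ is computed in two ways, and the finite factor [L₂ :
α L₁] cancels. -/
theorem index_range_eq {L₁ L₂ : Type*} [AddCommGroup L₁] [AddCommGroup L₂] {α : L₁ →+ L₂}
    {ψ₁ : L₁ →+ L₁} {ψ₂ : L₂ →+ L₂} (hα : Function.Injective α) (hψ : Function.Injective ψ₂)
    (hcomm : ∀ x, ψ₂ (α x) = α (ψ₁ x)) (hfin : α.range.index ≠ 0) :
    ψ₁.range.index = ψ₂.range.index := by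
  have h1 := AddSubgroup.index_map_of_injective α.range hψ
  have h2 := AddSubgroup.index_map_of_injective ψ₁.range hα
  rw [AddMonoidHom.map_range] at h1 h2
  have : ψ₂.comp α = α.comp ψ₁ := AddMonoidHom.ext hcomm
  rw [this, h2, mul_comm] at h1
  exact Nat.eq_of_mul_eq_mul_left (Nat.pos_of_ne_zero hfin) h1

theorem index_ne_zero_of_finite_mod {L : Type*} [AddCommGroup L] {H : AddSubgroup L} {s : Set L}
    (hs : s.Finite) (h : ∀ x, ∃ t ∈ s, x - t ∈ H) : H.index ≠ 0 := by
  have := hs.to_subtype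
  have : Finite (L ⧸ H) := by
    refine Finite.of_surjective (fun t : s => (QuotientAddGroup.mk t.1 : L ⧸ H)) fun q => ?_
    induction q using QuotientAddGroup.induction_on with
    | H x =>
      obtain ⟨t, ht, hxt⟩ := h x
      refine ⟨⟨t, ht⟩, ?_⟩
      rw [QuotientAddGroup.eq, neg_add_eq_sub]
      exact hxt
  rw [AddSubgroup.index]
  exact Nat.card_pos.ne'

end Counting

/-! ### Comparing δ and δε over a semisimple ring -/

section Matrices

variable {B : Type*} [Ring B] [IsSemisimpleRing B]

/-- Right multiplications are endomorphisms of Bδ, so fully invariant submodules are two-sided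
ideals, generated by central idempotents below δ; irreducibility leaves only 0 and Bδ. -/
theorem isIsotypic_span_of_isIrredCentralIdem {δ : B} (hδ : IsIrredCentralIdem δ) :
    IsIsotypic B (Ideal.span {δ}) := by
  have hmem : ∀ x, x ∈ Ideal.span {δ} ↔ x * δ = x := by
    intro x
    rw [Ideal.mem_span_singleton']
    constructor
    · rintro ⟨a, rfl⟩
      rw [mul_assoc, hδ.1.1.eq]
    · exact fun h => ⟨x, h⟩
  rw [isIsotypic_iff_isFullyInvariant_imp_bot_or_top]
  intro N hN
  let I : Ideal B := N.map (Ideal.span {δ}).subtype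
  have hI : I.IsTwoSided := by
    refine ⟨?_⟩
    rintro _ b ⟨x, hx, rfl⟩
    let g : Module.End B (Ideal.span {δ}) :=
      { toFun := fun x => ⟨x.1 * b, by
          rw [hmem, mul_assoc, ← hδ.1.2, ← mul_assoc, (hmem _).mp x.2]⟩
        map_add' := fun x y => Subtype.ext (add_mul _ _ _)
        map_smul' := fun c x => Subtype.ext (mul_assoc _ _ _) }
    exact ⟨g x, hN g hx, rfl⟩
  obtain ⟨ε, hε, hεc, hεI⟩ := exists_centralIdem_of_isTwoSided I
  have hεδ : ε * δ = ε := by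
    obtain ⟨x, hx, rfl⟩ := hε
    exact (hmem _).mp x.2
  rcases hδ.2.2 ε hεc hεδ with h0 | h1
  · left
    rw [eq_bot_iff]
    intro x hx
    have := hεI x.1 ⟨x, hx, rfl⟩
    rw [h0, mul_zero] at this
    exact (Submodule.mem_bot B).mpr (Subtype.ext this.symm)
  · right
    rw [eq_top_iff]
    intro x _
    have h2 : x.1 ∈ I := by
      have h2 := I.mul_mem_left x.1 hε
      rwa [h1, (hmem _).mp x.2] at h2
    obtain ⟨x', hx', h3⟩ := h2
    rwa [← Subtype.ext (a1 := x') (a2 := x) h3]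

/-- `(Bδ)^b` and `(Bδε)^a` are isomorphic for suitable `a` and `b`, and the isomorphisms are given by
matrices. -/
theorem exists_matrices {δ ε : B} (hδ : IsIrredCentralIdem δ) (hε : ε * ε = ε) (hne : δ * ε ≠ 0) :
    ∃ (a b : ℕ) (X : Fin b → Fin a → B) (Y : Fin a → Fin b → B), 0 < a ∧ 0 < b ∧
      (∀ k l, δ * X k l = X k l) ∧ (∀ l k, δ * ε * Y l k = Y l k) ∧
      (∀ k k', ∑ l, X k l * Y l k' = if k = k' then δ else 0) ∧
      (∀ l l', ∑ k, Y l k * X k l' = if l = l' then δ * ε else 0) := by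
  have hle : Ideal.span {δ * ε} ≤ Ideal.span {δ} := by
    rw [Ideal.span_singleton_le_iff_mem, Ideal.mem_span_singleton', hδ.1.2]
    exact ⟨ε, rfl⟩
  have hidem : δ * ε * (δ * ε) = δ * ε := by
    rw [mul_assoc, ← mul_assoc ε, ← hδ.1.2 ε, mul_assoc δ ε ε, hε, ← mul_assoc, hδ.1.1.eq]
  have hmem : ∀ x, x ∈ Ideal.span {δ} ↔ x * δ = x := by
    intro x
    rw [Ideal.mem_span_singleton']
    constructor
    · rintro ⟨a, rfl⟩
      rw [mul_assoc, hδ.1.1.eq]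
    · exact fun h => ⟨x, h⟩
  have hmem' : ∀ x, x ∈ Ideal.span {δ * ε} ↔ x * (δ * ε) = x := by
    intro x
    rw [Ideal.mem_span_singleton']
    constructor
    · rintro ⟨a, rfl⟩
      rw [mul_assoc, hidem]
    · exact fun h => ⟨x, h⟩
  have hδm : δ ∈ Ideal.span {δ} := Ideal.mem_span_singleton_self δ
  have hεm : δ * ε ∈ Ideal.span {δ * ε} := Ideal.mem_span_singleton_self _
  have hiso := isIsotypic_span_of_isIrredCentralIdem hδ
  have hnt' : Nontrivial (Ideal.span {δ * ε}) :=
    ⟨⟨⟨_, hεm⟩, 0, fun h => hne (congrArg Subtype.val h)⟩⟩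
  have hiso' : IsIsotypic B (Ideal.span {δ * ε}) :=
    hiso.of_injective _ (Submodule.inclusion_injective hle)
  obtain ⟨b, hb, T, hT, ⟨g'⟩⟩ := hiso'.linearEquiv_fun
  have hisoT : IsIsotypicOfType B (Ideal.span {δ}) T := by
    have hT' : IsSimpleModule B (T.map (Submodule.inclusion hle)) :=
      IsSimpleModule.congr (T.equivMapOfInjective _ (Submodule.inclusion_injective hle)).symm
    exact (hiso _).of_linearEquiv_type
      (T.equivMapOfInjective _ (Submodule.inclusion_injective hle)).symm
  obtain ⟨a, ⟨g⟩⟩ := hisoT.linearEquiv_fun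
  have ha : 0 < a := by
    rcases Nat.eq_zero_or_pos a with rfl | ha
    · have : Subsingleton (Ideal.span {δ}) := g.toEquiv.subsingleton
      exact absurd (congrArg Subtype.val (Subsingleton.elim (⟨δ, hδm⟩ : Ideal.span {δ}) 0)) hδ.2.1
    · exact ha
  have hswap : (Fin b → Fin a → T) ≃ₗ[B] (Fin a → Fin b → T) :=
    { toFun := fun w l k => w k l
      invFun := fun w k l => w l k
      left_inv := fun _ => rfl
      right_inv := fun _ => rfl
      map_add' := fun _ _ => rfl
      map_smul' := fun _ _ => rfl }
  -- With Bδ ≅ T^a and Bδε ≅ T^b for one simple T, both sides are T^{ab}. The rows of X and Y are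
  -- the images of the standard generators under Θ and its inverse.
  let Θ : (Fin b → Ideal.span {δ}) ≃ₗ[B] (Fin a → Ideal.span {δ * ε}) :=
    (LinearEquiv.piCongrRight fun _ => g).trans
      (hswap.trans (LinearEquiv.piCongrRight fun _ => g'.symm))
  let u : Fin b → Fin b → Ideal.span {δ} := fun k => Pi.single k ⟨δ, hδm⟩
  let v : Fin a → Fin a → Ideal.span {δ * ε} := fun l => Pi.single l ⟨δ * ε, hεm⟩
  have hu : ∀ w : Fin b → Ideal.span {δ}, w = ∑ k, (w k).1 • u k := by
    intro w
    funext k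
    apply Subtype.ext
    rw [Finset.sum_apply, Finset.sum_eq_single k]
    · simp [u, (hmem _).mp (w k).2]
    · intro k' _ hk
      simp [u, Pi.single_eq_of_ne hk.symm]
    · simp
  have hv : ∀ w : Fin a → Ideal.span {δ * ε}, w = ∑ l, (w l).1 • v l := by
    intro w
    funext l
    apply Subtype.ext
    rw [Finset.sum_apply, Finset.sum_eq_single l]
    · simp [v, (hmem' _).mp (w l).2]
    · intro k' _ hk
      simp [v, Pi.single_eq_of_ne hk.symm]
    · simp
  refine ⟨a, b, fun k l => (Θ (u k) l).1, fun l k => (Θ.symm (v l) k).1, ha, Nat.pos_of_neZero b,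
    ?_, ?_, ?_, ?_⟩
  · intro k l
    have : δ • u k = u k := by
      funext k'
      rcases eq_or_ne k' k with rfl | h
      · simp [u, hδ.1.1.eq]
      · simp [u, Pi.single_eq_of_ne h]
    show _ = (Θ (u k) l).1
    conv_rhs => rw [← this, map_smul]
    rfl
  · intro l k
    have : (δ * ε) • v l = v l := by
      funext l'
      rcases eq_or_ne l' l with rfl | h
      · simp [v, hidem]
      · simp [v, Pi.single_eq_of_ne h]
    show _ = (Θ.symm (v l) k).1
    conv_rhs => rw [← this, map_smul]
    rfl
  · intro k k'
    have h1 := congrArg (fun w => (w k').1) (congrArg Θ.symm (hv (Θ (u k))))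
    simp only [LinearEquiv.symm_apply_apply, map_sum, map_smul, Finset.sum_apply] at h1
    have h2 : (u k k').1 = if k = k' then δ else 0 := by
      rcases eq_or_ne k k' with rfl | h
      · simp [u]
      · simp [u, h]
    rw [← h2, h1]
    simp
  · intro l l'
    have h1 := congrArg (fun w => (w l').1) (congrArg Θ (hu (Θ.symm (v l))))
    simp only [LinearEquiv.apply_symm_apply, map_sum, map_smul, Finset.sum_apply] at h1
    have h2 : (v l l').1 = if l = l' then δ * ε else 0 := by
      rcases eq_or_ne l l' with rfl | h
      · simp [v]
      · simp [v, h]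
    rw [← h2, h1]
    simp

end Matrices

/-! ### Dévissage to simple modules -/

section Devissage

variable {R : Type*} [Ring R]

theorem exists_isSimpleModule_submodule {G : Type*} [AddCommGroup G] [Module R G] [Finite G]
    [Nontrivial G] : ∃ W : Submodule R G, IsSimpleModule R W := by
  have : IsArtinian R G := inferInstance
  obtain ⟨W, hW⟩ := IsAtomic.exists_atom (Submodule R G)
  exact ⟨W, isSimpleModule_iff_isAtom.mpr hW⟩

theorem finite_quotient {G : Type*} [AddCommGroup G] [Module R G] [Finite G]
    (W : Submodule R G) : Finite (G ⧸ W) := Finite.of_surjective _ W.mkQ_surjective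

theorem card_quotient_lt {G : Type*} [AddCommGroup G] [Module R G] [Finite G] (W : Submodule R G)
    [IsSimpleModule R W] : Nat.card (G ⧸ W) < Nat.card G := by
  have := IsSimpleModule.nontrivial R W
  rw [W.card_eq_card_quotient_mul_card]
  have := finite_quotient W
  have h1 : 1 < Nat.card W := Finite.one_lt_card
  have h2 : 0 < Nat.card (G ⧸ W) := Nat.card_pos
  nlinarith

/-- Both sides are multiplicative in exact sequences, so induction on |G| by splitting off a simple
submodule suffices. -/
theorem smulCard_pow_eq_pow {δ ε : R} (hδ : δ * δ = δ) (hε : ε * ε = ε) (a b : ℕ)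
    (h : ∀ (V : Type w) [AddCommGroup V] [Module R V] [Finite V] [IsSimpleModule R V],
      smulCard δ V ^ b = smulCard ε V ^ a)
    (G : Type w) [AddCommGroup G] [Module R G] [Finite G] :
    smulCard δ G ^ b = smulCard ε G ^ a := by
  induction hn : Nat.card G using Nat.strong_induction_on generalizing G with
  | _ n ih =>
    rcases subsingleton_or_nontrivial G with hG | hG
    · rw [smulCard_eq_one fun g => Subsingleton.elim _ _,
        smulCard_eq_one fun g => Subsingleton.elim _ _, one_pow, one_pow]
    · obtain ⟨W, hW⟩ := exists_isSimpleModule_submodule (R := R) (G := G)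
      have := finite_quotient W
      rw [smulCard_submodule_quotient hδ W, smulCard_submodule_quotient hε W, mul_pow, mul_pow,
        h W, ih _ (hn ▸ card_quotient_lt W) (G ⧸ W) rfl]

/-- If all composition factors of `D` are isomorphic to `V`, then `|r D|` is a power of `|r V|`. -/
theorem exists_smulCard_eq_pow {V : Type*} [AddCommGroup V] [Module R V] (K : Set R)
    (hK : ∀ (W : Type w) [AddCommGroup W] [Module R W] [Finite W] [IsSimpleModule R W],
      (∀ t ∈ K, ∀ x : W, t • x = 0) → Nonempty (W ≃ₗ[R] V))
    (D : Type w) [AddCommGroup D] [Module R D] [Finite D] (hD : ∀ t ∈ K, ∀ x : D, t • x = 0) :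
    ∃ l, ∀ r : R, r * r = r → smulCard r D = smulCard r V ^ l := by
  induction hn : Nat.card D using Nat.strong_induction_on generalizing D with
  | _ n ih =>
    rcases subsingleton_or_nontrivial D with h0 | h0
    · exact ⟨0, fun r _ => by rw [smulCard_eq_one fun g => Subsingleton.elim _ _, pow_zero]⟩
    · obtain ⟨W, hW⟩ := exists_isSimpleModule_submodule (R := R) (G := D)
      have := finite_quotient W
      obtain ⟨f⟩ := hK W fun t ht x => Subtype.ext (hD t ht x.1)
      obtain ⟨l, hl⟩ := ih _ (hn ▸ card_quotient_lt W) (D ⧸ W) (fun t ht x => by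
        obtain ⟨x, rfl⟩ := W.mkQ_surjective x
        rw [← map_smul, hD t ht, map_zero]) rfl
      refine ⟨l + 1, fun r hr => ?_⟩
      rw [smulCard_submodule_quotient hr W, hl r hr, smulCard_congr f, pow_succ, mul_comm]

end Devissage

/-! ### Indices of right multiplication on commensurable lattices -/

section Lattice

variable {R : Type*} [Ring R]

/-- Right multiplication by `y` on `(r R)^ι`. -/
def rightMulPi (r y : R) (ι : Type*) :
    (ι → (AddMonoidHom.mulLeft r).range) →+ (ι → (AddMonoidHom.mulLeft r).range) where
  toFun w i := ⟨(w i).1 * y, by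
    obtain ⟨x, hx⟩ := (w i).2
    exact ⟨x * y, by rw [← hx]; exact (mul_assoc r x y).symm⟩⟩
  map_zero' := funext fun i => Subtype.ext (zero_mul y)
  map_add' v w := funext fun i => Subtype.ext (add_mul (v i).1 (w i).1 y)

theorem mem_range_mulLeft {r x : R} (hr : r * r = r) :
    x ∈ (AddMonoidHom.mulLeft r).range ↔ r * x = x := by
  constructor
  · rintro ⟨x, rfl⟩
    show r * (r * x) = r * x
    rw [← mul_assoc, hr]
  · exact fun h => ⟨x, h⟩

/-- The cokernel of right multiplication by y on r R is r (R/Ry): if r x = s y, then r x = (r s) y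
by idempotence. -/
theorem index_range_rightMulPi {r : R} (hr : r * r = r) (y : R) (n : ℕ) :
    (rightMulPi r y (Fin n)).range.index = smulCard r (R ⧸ Submodule.span R {y}) ^ n := by
  let f : (Fin n → (AddMonoidHom.mulLeft r).range) →+
      (Fin n → (DistribSMul.toAddMonoidHom (R ⧸ Submodule.span R {y}) r).range) :=
    { toFun := fun w i => ⟨Submodule.mkQ (Submodule.span R {y}) (w i).1, by
        obtain ⟨x, hx⟩ := (w i).2
        rw [← hx]
        exact ⟨Submodule.mkQ _ x, (map_smul (Submodule.mkQ _) r x).symm⟩⟩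
      map_zero' := funext fun i => Subtype.ext (map_zero _)
      map_add' := fun v w => funext fun i => Subtype.ext (map_add _ (v i).1 (w i).1) }
  have hsurj : Function.Surjective f := by
    intro w
    have : ∀ i, ∃ x : R, Submodule.mkQ (Submodule.span R {y}) (r * x) = (w i).1 := by
      intro i
      obtain ⟨q, hq⟩ := (w i).2
      obtain ⟨x, rfl⟩ := Submodule.mkQ_surjective _ q
      exact ⟨x, by rw [← hq]; exact map_smul (Submodule.mkQ _) r x⟩
    choose x hx using this
    exact ⟨fun i => ⟨r * x i, x i, rfl⟩, funext fun i => Subtype.ext (hx i)⟩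
  have hker : f.ker = (rightMulPi r y (Fin n)).range := by
    ext w
    constructor
    · intro hw
      have : ∀ i, ∃ s : R, s * y = (w i).1 := by
        intro i
        have h0 : Submodule.mkQ (Submodule.span R {y}) (w i).1 = 0 :=
          congrArg Subtype.val (congrFun hw i)
        exact Ideal.mem_span_singleton'.mp ((Submodule.Quotient.mk_eq_zero _).mp h0)
      choose s hs using this
      refine ⟨fun i => ⟨r * s i, s i, rfl⟩, funext fun i => Subtype.ext ?_⟩
      show r * s i * y = (w i).1
      rw [mul_assoc, hs, (mem_range_mulLeft hr).mp (w i).2]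
    · rintro ⟨v, rfl⟩
      refine funext fun i => Subtype.ext ?_
      exact (Submodule.Quotient.mk_eq_zero _).mpr (Ideal.mem_span_singleton'.mpr ⟨(v i).1, rfl⟩)
  rw [← hker, AddSubgroup.index_ker, AddMonoidHom.range_eq_top.mpr hsurj]
  rw [Nat.card_congr AddSubgroup.topEquiv.toEquiv, Nat.card_pi]
  simp [smulCard]

/-- If matrices over `R` identify `(R δ)^b` and `(R ε)^a` up to an integer, then
`|δ R/Ry|^b = |ε R/Ry|^a` for every `y` that is not a right zero divisor. -/
theorem smulCard_quotient_pow_eq {δ ε y : R} (hδ : δ * δ = δ) (hε : ε * ε = ε) {m a b : ℕ}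
    (hfin : ∃ s : Set R, s.Finite ∧ ∀ x, ∃ t ∈ s, ∃ z, x - t = m • z)
    (htors : ∀ x : R, m • x = 0 → x = 0) (hy : ∀ x : R, x * y = 0 → x = 0)
    (X : Fin b → Fin a → R) (Y : Fin a → Fin b → R)
    (hX : ∀ k l, δ * X k l = X k l) (hY : ∀ l k, ε * Y l k = Y l k)
    (hXY : ∀ k k', ∑ l, X k l * Y l k' = if k = k' then m • δ else 0)
    (hYX : ∀ l l', ∑ k, Y l k * X k l' = if l = l' then m • ε else 0) :
    smulCard δ (R ⧸ Submodule.span R {y}) ^ b = smulCard ε (R ⧸ Submodule.span R {y}) ^ a := by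
  classical
  rw [← index_range_rightMulPi hδ, ← index_range_rightMulPi hε]
  -- Left multiplication by Y commutes with right multiplication by y. It is injective because X Y =
  -- m δ and R is torsion free, and of finite index because Y X = m ε.
  let α : (Fin b → (AddMonoidHom.mulLeft δ).range) →+ (Fin a → (AddMonoidHom.mulLeft ε).range) :=
    { toFun := fun w l => ⟨∑ k, Y l k * (w k).1, (mem_range_mulLeft hε).mpr (by
        rw [Finset.mul_sum]
        exact Finset.sum_congr rfl fun k _ => by rw [← mul_assoc, hY])⟩
      map_zero' := funext fun l => Subtype.ext (by simp)
      map_add' := fun v w => funext fun l => Subtype.ext (by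
        simp [mul_add, Finset.sum_add_distrib]) }
  have hα : ∀ w l, (α w l).1 = ∑ k, Y l k * (w k).1 := fun _ _ => rfl
  have hXα : ∀ w k, ∑ l, X k l * (α w l).1 = m • (w k).1 := by
    intro w k
    simp only [hα, Finset.mul_sum]
    rw [Finset.sum_comm]
    simp only [← mul_assoc, ← Finset.sum_mul, hXY, ite_mul, zero_mul]
    rw [Finset.sum_ite_eq, if_pos (Finset.mem_univ k), smul_mul_assoc,
      (mem_range_mulLeft hδ).mp (w k).2]
  refine index_range_eq (α := α) ?_ ?_ ?_ ?_
  · rw [injective_iff_map_eq_zero]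
    intro w hw
    funext k
    refine Subtype.ext (htors _ ?_)
    rw [← hXα w k, hw]
    simp
  · rw [injective_iff_map_eq_zero]
    intro w hw
    funext l
    exact Subtype.ext (hy _ (congrArg Subtype.val (congrFun hw l)))
  · intro w
    funext l
    apply Subtype.ext
    show (∑ k, Y l k * (w k).1) * y = ∑ k, Y l k * ((w k).1 * y)
    rw [Finset.sum_mul]
    exact Finset.sum_congr rfl fun k _ => mul_assoc _ _ _
  · obtain ⟨s, hs, hsx⟩ := hfin
    refine index_ne_zero_of_finite_mod (s := Set.pi Set.univ fun _ : Fin a =>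
      (fun t => (⟨ε * t, t, rfl⟩ : (AddMonoidHom.mulLeft ε).range)) '' s)
      (Set.Finite.pi fun _ => hs.image _) fun v => ?_
    choose t ht z hz using fun l => hsx (v l).1
    refine ⟨fun l => ⟨ε * t l, t l, rfl⟩, fun l _ => ⟨t l, ht l, rfl⟩,
      fun k => ⟨∑ l, X k l * z l, (mem_range_mulLeft hδ).mpr (by
        rw [Finset.mul_sum]
        exact Finset.sum_congr rfl fun l _ => by rw [← mul_assoc, hX])⟩, ?_⟩
    funext l
    apply Subtype.ext
    show ∑ k, Y l k * ∑ l', X k l' * z l' = (v l).1 - ε * t l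
    simp only [Finset.mul_sum]
    rw [Finset.sum_comm]
    simp only [← mul_assoc, ← Finset.sum_mul, hYX, ite_mul, zero_mul]
    rw [Finset.sum_ite_eq, if_pos (Finset.mem_univ l), smul_mul_assoc, ← mul_smul_comm, ← hz,
      mul_sub, (mem_range_mulLeft hε).mp (v l).2]

end Lattice

/-! ### Finite R-modules: simple modules and the cardinality relation -/

section AugModules

variable {Γ : Type*} [Group Γ] [Finite Γ] {Γ' : Subgroup Γ} {S : Set ℕ}

/-- As e_i is a central idempotent, R + R e_i is a ring commensurable with R, hence equal to R. So
e_i acts on R-modules. -/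
theorem AugIndex.mem_augLat (hfin : S.Finite) (hS : AllGood Γ' S) (i : AugIndex Γ') :
    i.1 ∈ augLat Γ' S := by
  have h := augLat_isMaxOrder hfin hS
  obtain ⟨⟨hidem, hcen⟩, -, -⟩ := i.2.1
  have hei : augIdem Γ' * i.1 = i.1 := by rw [(augIdem_isCentralIdem Γ').2, i.2.2]
  let L : Submodule ℤ (MonoidAlgebra ℚ Γ) :=
    { carrier := {x | ∃ a ∈ augLat Γ' S, ∃ b ∈ augLat Γ' S, x = a + b * i.1}
      zero_mem' := ⟨0, zero_mem _, 0, zero_mem _, by simp⟩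
      add_mem' := by
        rintro _ _ ⟨a, ha, b, hb, rfl⟩ ⟨c, hc, d, hd, rfl⟩
        exact ⟨a + c, add_mem ha hc, b + d, add_mem hb hd, by rw [add_mul]; abel⟩
      smul_mem' := by
        rintro n _ ⟨a, ha, b, hb, rfl⟩
        exact ⟨n • a, Submodule.smul_mem _ n ha, n • b, Submodule.smul_mem _ n hb, by
          rw [smul_add, smul_mul_assoc]⟩ }
  obtain ⟨n, hn, hni⟩ := exists_nsmul_mem_groupRing S i.1
  refine h.max L (fun x hx => ⟨x, hx, 0, zero_mem _, by simp⟩) ?_ ?_ ?_ n hn ?_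
    ⟨0, zero_mem _, augIdem Γ', h.one_mem, by rw [hei, zero_add]⟩
  · rintro _ ⟨a, ha, b, hb, rfl⟩ _ ⟨c, hc, d, hd, rfl⟩
    refine ⟨a * c, augLat_mul ha hc, a * d + b * c + b * d,
      add_mem (add_mem (augLat_mul ha hd) (augLat_mul hb hc)) (augLat_mul hb hd), ?_⟩
    have h1 : b * i.1 * c = b * c * i.1 := by rw [mul_assoc, hcen, mul_assoc]
    have h2 : b * i.1 * (d * i.1) = b * d * i.1 := by
      rw [mul_assoc, ← mul_assoc i.1, hcen d, mul_assoc d, hidem.eq, ← mul_assoc]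
    rw [mul_add, add_mul, add_mul, h1, h2, ← mul_assoc, add_mul, add_mul]
    abel
  · rintro _ ⟨a, ha, b, hb, rfl⟩
    rw [mul_add, ha.2, ← mul_assoc, hb.2]
  · rintro _ ⟨a, ha, b, hb, rfl⟩
    rw [add_mul, augLat_mul_idem ha, mul_assoc, i.2.2]
  · rintro _ ⟨a, ha, b, hb, rfl⟩
    rw [smul_add, ← mul_smul_comm]
    exact add_mem (nsmul_mem ha n) (augLat_mul_groupRing hb hni)

theorem augRing_exists_finite_mod (hfin : S.Finite) (hS : AllGood Γ' S) {m : ℕ} (hm : m ≠ 0) :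
    ∃ s : Set (augRing Γ' S), s.Finite ∧ ∀ x, ∃ t ∈ s, ∃ z, x - t = m • z := by
  have h := augLat_isMaxOrder hfin hS
  have he := hS.augIdem_mem
  obtain ⟨s, hs, hsx⟩ := h.fin m hm
  refine ⟨(fun r : augRing Γ' S => r.1.1) ⁻¹' s, hs.preimage fun a _ b _ hab => augRing_ext hab,
    fun x => ?_⟩
  obtain ⟨t, ht, hxt⟩ := hsx x.1.1 (augRing_val_mem he x)
  obtain ⟨z, hz, hxz⟩ := mem_scaled.mp hxt
  have htm : t ∈ augLat Γ' S := by
    have : t = x.1.1 - m • z := by rw [hxz]; abel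
    rw [this]
    exact sub_mem (augRing_val_mem he x) (nsmul_mem hz m)
  exact ⟨augMk he htm, ht, augMk he hz, augRing_ext hxz.symm⟩

theorem augRing_eq_zero_of_nsmul {m : ℕ} (hm : m ≠ 0) {x : augRing Γ' S} (h : m • x = 0) :
    x = 0 := by
  refine augRing_ext ?_
  have h1 : m • x.1.1 = 0 := congrArg (fun r : augRing Γ' S => r.1.1) h
  rw [← inv_smul_nsmul hm x.1.1, h1, smul_zero]
  rfl

theorem augRing_val_mul (x y : augRing Γ' S) : (x * y).1.1 = x.1.1 * y.1.1 := rfl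

/-- The annihilator of a module, as a lattice in `ℚ[Γ]`. -/
def annLat (Γ' : Subgroup Γ) (S : Set ℕ) (V : Type*) [AddCommGroup V] [Module (augRing Γ' S) V] :
    Submodule ℤ (MonoidAlgebra ℚ Γ) where
  carrier := {x | ∃ r : augRing Γ' S, r.1.1 = x ∧ ∀ v : V, r • v = 0}
  zero_mem' := ⟨0, rfl, fun v => zero_smul _ v⟩
  add_mem' := by
    rintro _ _ ⟨r, rfl, hr⟩ ⟨s, rfl, hs⟩
    exact ⟨r + s, rfl, fun v => by rw [add_smul, hr, hs, add_zero]⟩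
  smul_mem' := by
    rintro n _ ⟨r, rfl, hr⟩
    exact ⟨n • r, rfl, fun v => by rw [smul_assoc, hr, smul_zero]⟩

theorem val_mem_annLat {V : Type*} [AddCommGroup V] [Module (augRing Γ' S) V] {r : augRing Γ' S} :
    r.1.1 ∈ annLat Γ' S V ↔ ∀ v : V, r • v = 0 :=
  ⟨fun ⟨_, hs, h⟩ => augRing_ext hs ▸ h, fun h => ⟨r, rfl, h⟩⟩

theorem exists_smul_eq {V : Type*} [AddCommGroup V] [Module (augRing Γ' S) V]
    [IsSimpleModule (augRing Γ' S) V] {v : V} (hv : v ≠ 0) (w : V) :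
    ∃ r : augRing Γ' S, r • v = w :=
  IsSimpleModule.toSpanSingleton_surjective (augRing Γ' S) hv w

/-- For v ≠ 0, V ≅ R/X' with X' the annihilator of v, so V is a simple subquotient of R to which
`isMaxIdeal_of_annihilator` applies; |V| R ⊆ X'. -/
theorem annLat_isMaxIdeal (hfin : S.Finite) (hS : AllGood Γ' S) (V : Type*) [AddCommGroup V]
    [Module (augRing Γ' S) V] [Finite V] [IsSimpleModule (augRing Γ' S) V] :
    IsMaxIdeal (augLat Γ' S) (annLat Γ' S V) := by
  have h := augLat_isMaxOrder hfin hS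
  have he := hS.augIdem_mem
  have := IsSimpleModule.nontrivial (augRing Γ' S) V
  obtain ⟨v, hv⟩ := exists_ne (0 : V)
  have hlift : ∀ x ∈ augLat Γ' S, ∃ r : augRing Γ' S, r.1.1 = x := fun x hx => ⟨augMk he hx, rfl⟩
  let X' : Submodule ℤ (MonoidAlgebra ℚ Γ) :=
    { carrier := {x | ∃ r : augRing Γ' S, r.1.1 = x ∧ r • v = 0}
      zero_mem' := ⟨0, rfl, zero_smul _ v⟩
      add_mem' := by
        rintro _ _ ⟨r, rfl, hr⟩ ⟨s, rfl, hs⟩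
        exact ⟨r + s, rfl, by rw [add_smul, hr, hs, add_zero]⟩
      smul_mem' := by
        rintro n _ ⟨r, rfl, hr⟩
        exact ⟨n • r, rfl, by rw [smul_assoc, hr, smul_zero]⟩ }
  have hX' : ∀ r : augRing Γ' S, r.1.1 ∈ X' ↔ r • v = 0 := fun r =>
    ⟨fun ⟨_, hs, h⟩ => augRing_ext hs ▸ h, fun h => ⟨r, rfl, h⟩⟩
  have hle : X' ≤ augLat Γ' S := by
    rintro _ ⟨r, rfl, -⟩
    exact augRing_val_mem he r
  refine isMaxIdeal_of_annihilator h (X := augLat Γ' S) (X' := X') (n := Nat.card V)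
    Nat.card_pos.ne' le_rfl ?_ h.mul_mem ?_ (lt_of_le_of_ne hle ?_) ?_ ?_
  · intro x hx
    obtain ⟨y, hy, rfl⟩ := mem_scaled.mp hx
    obtain ⟨r, rfl⟩ := hlift y hy
    exact ⟨Nat.card V • r, rfl, by rw [smul_assoc, card_nsmul_eq_zero']⟩
  · rintro x hx _ ⟨s, rfl, hs⟩
    obtain ⟨r, rfl⟩ := hlift x hx
    exact ⟨r * s, rfl, by rw [mul_smul, hs, smul_zero]⟩
  · intro hc
    have h1 : ((1 : augRing Γ' S)).1.1 ∈ X' := hc ▸ augRing_val_mem he 1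
    rw [hX', one_smul] at h1
    exact hv h1
  · intro Y hXY hY hst
    by_cases hYX : Y ≤ X'
    · exact Or.inl (le_antisymm hYX hXY)
    · right
      obtain ⟨y, hyY, hyX⟩ := Set.not_subset.mp hYX
      obtain ⟨r, rfl⟩ := hlift y (hY hyY)
      have hr : r • v ≠ 0 := fun h0 => hyX ((hX' r).mpr h0)
      refine le_antisymm hY fun x hx => ?_
      obtain ⟨s, rfl⟩ := hlift x hx
      obtain ⟨t, ht⟩ := exists_smul_eq (Γ' := Γ') (S := S) hr (s • v)
      have h1 : (s - t * r).1.1 ∈ X' := by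
        rw [hX', sub_smul, mul_smul, ht, sub_self]
      have h2 := add_mem (hXY h1) (hst t.1.1 (augRing_val_mem he t) r.1.1 hyY)
      have h3 : (s - t * r).1.1 + t.1.1 * r.1.1 = s.1.1 := sub_add_cancel s.1.1 (t.1.1 * r.1.1)
      rwa [h3] at h2
  · intro x
    constructor
    · rintro ⟨r, rfl, hr⟩
      refine ⟨augRing_val_mem he r, fun y hy => ?_⟩
      obtain ⟨s, rfl⟩ := hlift y hy
      exact ⟨r * s, rfl, by rw [mul_smul, hr]⟩
    · rintro ⟨hx, hxX⟩
      obtain ⟨r, rfl⟩ := hlift x hx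
      refine ⟨r, rfl, fun w => ?_⟩
      obtain ⟨s, rfl⟩ := exists_smul_eq (Γ' := Γ') (S := S) hv w
      rw [← mul_smul, ← hX']
      exact hxX s.1.1 (augRing_val_mem he s)

/-- The kernel of multiplication by ∏ p is a submodule. If it were zero, all powers of ∏ p would be
injective on V, but some power is a ℤ_S-multiple of |V|. -/
theorem primeProd_smul_eq_zero (hfin : S.Finite) (hS : AllGood Γ' S) (V : Type*) [AddCommGroup V]
    [Module (augRing Γ' S) V] [Finite V] [IsSimpleModule (augRing Γ' S) V] (v : V) :
    primeProd S • v = 0 := by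
  have he := hS.augIdem_mem
  let T : Submodule (augRing Γ' S) V :=
    { carrier := {v | primeProd S • v = 0}
      zero_mem' := smul_zero _
      add_mem' := fun {a b} ha hb => by
        show primeProd S • (a + b) = 0
        rw [smul_add, show primeProd S • a = 0 from ha, show primeProd S • b = 0 from hb, add_zero]
      smul_mem' := fun r a ha => by
        show primeProd S • r • a = 0
        rw [smul_comm, show primeProd S • a = 0 from ha, smul_zero] }
  rcases eq_bot_or_eq_top T with hT | hT
  · exfalso
    have hinj : ∀ v : V, primeProd S • v = 0 → v = 0 := fun v hv =>
      (Submodule.mem_bot (augRing Γ' S)).mp (hT ▸ (show v ∈ T from hv))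
    have hinj' : ∀ (k : ℕ) (v : V), primeProd S ^ k • v = 0 → v = 0 := by
      intro k
      induction k with
      | zero => intro v hv; simpa using hv
      | succ k ih => intro v hv; exact hinj v (ih _ (by rw [smul_smul, ← pow_succ, hv]))
    have := IsSimpleModule.nontrivial (augRing Γ' S) V
    obtain ⟨v, hv⟩ := exists_ne (0 : V)
    obtain ⟨k, q, hq, hk⟩ := exists_primeProd_pow (S := S) hfin (Nat.card_pos (α := V)).ne'
    refine hv (hinj' k v ?_)
    have h1 := (augLat_isMaxOrder hfin hS).one_mem
    have h2 : (primeProd S ^ k) • (1 : augRing Γ' S) =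
        Nat.card V • augMk he (smul_mem_augLat hq h1) := by
      refine augRing_ext ?_
      show (primeProd S ^ k) • augIdem Γ' = Nat.card V • (q • augIdem Γ')
      rw [← Nat.cast_smul_eq_nsmul ℚ, ← Nat.cast_smul_eq_nsmul ℚ, smul_smul, ← hk, Nat.cast_pow]
    rw [← one_smul (augRing Γ' S) v, ← smul_assoc, h2, smul_assoc, card_nsmul_eq_zero']
  · exact (hT ▸ Submodule.mem_top : v ∈ T)

/-- Nakayama's lemma over ℤ_S, whose Jacobson radical contains ∏ p; left ideals of R are ℤ_S-modules
because q x = (q e_{Γ/Γ'}) x. -/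
theorem le_of_le_sup_scaled (hfin : S.Finite) (hne : S.Nonempty) (hS : AllGood Γ' S)
    {B L : Submodule ℤ (MonoidAlgebra ℚ Γ)} (hB : IsFullIdeal (augLat Γ' S) B)
    (hst : ∀ r ∈ augLat Γ' S, ∀ x ∈ L, r * x ∈ L) (hL : L ≤ augLat Γ' S)
    (h : B ≤ L ⊔ scaled (primeProd S) B) : B ≤ L := by
  have h1 := (augLat_isMaxOrder hfin hS).one_mem
  have hq : ∀ q ∈ ZS S, ∀ x ∈ augLat Γ' S, q • x = (q • augIdem Γ') * x := fun q _ x hx => by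
    rw [smul_mul_assoc, hx.2]
  let B' : Submodule (ZS S) (MonoidAlgebra ℚ Γ) :=
    { carrier := B
      zero_mem' := zero_mem _
      add_mem' := add_mem
      smul_mem' := fun q x hx => by
        show (q : ℚ) • x ∈ B
        rw [hq q q.2 x (hB.le hx)]
        exact hB.left _ (smul_mem_augLat q.2 h1) x hx }
  let L' : Submodule (ZS S) (MonoidAlgebra ℚ Γ) :=
    { carrier := L
      zero_mem' := zero_mem _
      add_mem' := add_mem
      smul_mem' := fun q x hx => by
        show (q : ℚ) • x ∈ L
        rw [hq q q.2 x (hL hx)]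
        exact hst _ (smul_mem_augLat q.2 h1) x hx }
  have hfg : B'.FG := fg_of_nsmul_mem one_ne_zero fun x hx => by
    rw [one_smul]
    exact (hB.le hx).1
  have hle : B' ≤ L' := by
    refine Submodule.le_of_le_smul_of_le_jacobson_bot hfg
      (I := Ideal.span {(primeProd S : ZS S)})
      ((Ideal.span_singleton_le_iff_mem _).mpr (primeProd_mem_jacobson hfin hne hS.prime)) ?_
    intro x hx
    obtain ⟨l, hl, b', hb', rfl⟩ := Submodule.mem_sup.mp (h hx)
    obtain ⟨b, hb, rfl⟩ := mem_scaled.mp hb'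
    refine Submodule.add_mem_sup hl ?_
    have : primeProd S • b = (primeProd S : ZS S) • b := (Nat.cast_smul_eq_nsmul _ _ _).symm
    rw [this]
    exact Submodule.smul_mem_smul (Ideal.mem_span_singleton_self _) hb
  exact hle

/-- Every finite simple module `V` is the only composition factor of some nonzero finite quotient
`R/Ry`, with `y` not a zero divisor. -/
theorem exists_uniform_quotient (hfin : S.Finite) (hne : S.Nonempty) (hS : AllGood Γ' S)
    (V : Type*) [AddCommGroup V] [Module (augRing Γ' S) V] [Finite V]
    [IsSimpleModule (augRing Γ' S) V] :
    ∃ (y : augRing Γ' S) (K : Set (augRing Γ' S)), (∀ x, x * y = 0 → x = 0) ∧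
      Finite (augRing Γ' S ⧸ Submodule.span (augRing Γ' S) {y}) ∧
      Nontrivial (augRing Γ' S ⧸ Submodule.span (augRing Γ' S) {y}) ∧
      (∀ t ∈ K, ∀ x : augRing Γ' S ⧸ Submodule.span (augRing Γ' S) {y}, t • x = 0) ∧
      ∀ (W : Type w) [AddCommGroup W] [Module (augRing Γ' S) W] [Finite W]
        [IsSimpleModule (augRing Γ' S) W], (∀ t ∈ K, ∀ x : W, t • x = 0) →
        Nonempty (W ≃ₗ[augRing Γ' S] V) := by
  have h := augLat_isMaxOrder hfin hS
  have he := hS.augIdem_mem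
  have hϖ := primeProd_ne_zero hS.prime
  have hM := annLat_isMaxIdeal hfin hS V
  have hlift : ∀ x ∈ augLat Γ' S, ∃ r : augRing Γ' S, r.1.1 = x := fun x hx => ⟨augMk he hx, rfl⟩
  obtain ⟨y, hyM, hyn, a, hya⟩ := hM.exists_generator h hϖ (by
    intro x hx
    obtain ⟨z, hz, rfl⟩ := mem_scaled.mp hx
    obtain ⟨r, rfl⟩ := hlift z hz
    exact ⟨primeProd S • r, rfl, fun v => by
      rw [smul_assoc, primeProd_smul_eq_zero hfin hS]⟩)
    (fun B L hB hst hL hBL => le_of_le_sup_scaled hfin hne hS hB hst hL hBL)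
  have hpow : IsFullIdeal (augLat Γ' S) (annLat Γ' S V ^ a * augLat Γ' S) := by
    have := IsFullIdeal.listProd h (List.replicate a (annLat Γ' S V)) (fun N hN => by
      rwa [List.eq_of_mem_replicate hN])
    rwa [List.prod_replicate] at this
  obtain ⟨y, rfl⟩ := hlift y (hM.le hyM)
  have hspan : ∀ x : augRing Γ' S, x ∈ Submodule.span (augRing Γ' S) {y} ↔
      ∃ s : augRing Γ' S, s * y = x := fun x => Ideal.mem_span_singleton'
  refine ⟨y, {t | t.1.1 ∈ annLat Γ' S V ^ a * augLat Γ' S}, ?_, ?_, ?_, ?_, ?_⟩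
  · intro x hxy
    obtain ⟨s, hs, hsy⟩ := hyn _ h.one_mem
    set e := augIdem Γ'
    have hee : e * e = e := augIdem_idem Γ'
    -- From s y = (∏ p) e, y + (1 - e) has a left inverse in ℚ[Γ], hence a two-sided one there; so x
    -- y = 0 forces x = 0.
    have h1 : (((primeProd S : ℕ) : ℚ)⁻¹ • s + (1 - e)) * (y.1.1 + (1 - e)) = 1 := by
      have h2 : (((primeProd S : ℕ) : ℚ)⁻¹ • s) * y.1.1 = e := by
        rw [smul_mul_assoc, hsy, inv_smul_nsmul hϖ]
      have h3 : (((primeProd S : ℕ) : ℚ)⁻¹ • s) * (1 - e) = 0 := by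
        rw [smul_mul_assoc, mul_sub, mul_one, augLat_mul_idem hs, sub_self, smul_zero]
      have h4 : (1 - e) * y.1.1 = 0 := by
        rw [sub_mul, one_mul, (augRing_val_mem he y).2, sub_self]
      have h5 : (1 - e) * (1 - e) = 1 - e := by
        rw [mul_sub, mul_one, sub_mul, one_mul, hee, sub_self, sub_zero]
      rw [add_mul, mul_add, mul_add, h2, h3, h4, h5]
      abel
    have h6 : x.1.1 * (y.1.1 + (1 - e)) = 0 := by
      rw [mul_add, mul_sub, mul_one, augLat_mul_idem (augRing_val_mem he x), sub_self, add_zero]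
      exact congrArg (fun r : augRing Γ' S => r.1.1) hxy
    refine augRing_ext ?_
    show x.1.1 = 0
    rw [← mul_one x.1.1, ← mul_eq_one_comm.mp h1, ← mul_assoc, h6, zero_mul]
  · obtain ⟨s, hs, hsx⟩ := augRing_exists_finite_mod hfin hS hϖ
    have := hs.to_subtype
    refine Finite.of_surjective (fun t : s => Submodule.mkQ _ t.1) fun q => ?_
    obtain ⟨x, rfl⟩ := Submodule.mkQ_surjective _ q
    obtain ⟨t, ht, z, hxt⟩ := hsx x
    refine ⟨⟨t, ht⟩, ?_⟩
    rw [eq_comm, ← sub_eq_zero, ← map_sub, hxt]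
    refine (Submodule.Quotient.mk_eq_zero _).mpr ((hspan _).mpr ?_)
    obtain ⟨s', hs', hsy⟩ := hyn z.1.1 (augRing_val_mem he z)
    exact ⟨augMk he hs', augRing_ext hsy⟩
  · rw [Submodule.Quotient.nontrivial_iff]
    intro hc
    obtain ⟨s, hs⟩ := (hspan 1).mp (hc ▸ Submodule.mem_top)
    have h1 : s.1.1 * y.1.1 ∈ annLat Γ' S V := hM.left _ (augRing_val_mem he s) _ hyM
    rw [← augRing_val_mul, hs] at h1
    exact hM.ne (hM.1.eq_of_one_mem h h1)
  · intro t ht q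
    obtain ⟨x, rfl⟩ := Submodule.mkQ_surjective _ q
    rw [← map_smul]
    refine (Submodule.Quotient.mk_eq_zero _).mpr ((hspan _).mpr ?_)
    obtain ⟨s, hs, hsy⟩ := hya (t.1.1 * x.1.1) (hpow.right _ (augRing_val_mem he x) _ ht)
    exact ⟨augMk he hs, augRing_ext hsy⟩
  · intro W _ _ _ _ hW
    have hM' := annLat_isMaxIdeal hfin hS W
    -- If M^a kills W, primeness gives M = Ann W, so W and V are simple with the same annihilator.
    have hle : (List.replicate a (annLat Γ' S V)).prod * augLat Γ' S ≤ annLat Γ' S W := by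
      rw [List.prod_replicate]
      intro t ht
      obtain ⟨r, rfl⟩ := hlift t (hpow.le ht)
      exact val_mem_annLat.mpr (hW r ht)
    have heq := List.eq_of_mem_replicate (hM'.mem_of_listProd_le h _ (fun N hN => by
      rwa [List.eq_of_mem_replicate hN]) hle)
    refine nonempty_linearEquiv_of_annihilator_eq ?_
    ext r
    rw [Module.mem_annihilator, Module.mem_annihilator, ← val_mem_annLat, ← val_mem_annLat, heq]

variable (hS : AllGood Γ' S)

/-- `e_i` as an element of `e_{Γ/Γ'} ℤ_S[Γ]`. -/
def AugIndex.toRing (hfin : S.Finite) (hS : AllGood Γ' S) (i : AugIndex Γ') : augRing Γ' S :=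
  augMk hS.augIdem_mem (i.mem_augLat hfin hS)

theorem AugIndex.toRing_mul_self (hfin : S.Finite) (i : AugIndex Γ') :
    i.toRing hfin hS * i.toRing hfin hS = i.toRing hfin hS :=
  augRing_ext i.2.1.1.1.eq

theorem AugIndex.toRing_comm (hfin : S.Finite) (i : AugIndex Γ') (x : augRing Γ' S) :
    i.toRing hfin hS * x = x * i.toRing hfin hS :=
  augRing_ext (i.2.1.1.2 x.1.1)

/-- `η` is an idempotent of `e₁' ℚ[Γ]` with `η e₁' = e_{Γ/Γ'} e₁'`. -/
structure IsNormIdem (η : MonoidAlgebra ℚ Γ) : Prop where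
  mul_self : η * η = η
  avg_mul : avgIdem Γ' * η = η
  mul_avg : η * avgIdem Γ' = augIdem Γ' * avgIdem Γ'

/-- Idempotence comes from η η = η (e₁' η) = (e e₁') η = e η = η. This η projects every R-module
onto its Γ'-invariants. -/
theorem isNormIdem {z : augRing Γ' S}
    (hz : normElt Γ' * z.1.1 * avgIdem Γ' = augIdem Γ' * avgIdem Γ') :
    IsNormIdem (Γ' := Γ') (normRing Γ' S * z).1.1 := by
  have h1 : avgIdem Γ' * (normRing Γ' S * z).1.1 = (normRing Γ' S * z).1.1 := by
    rw [normRing_mul, ← mul_assoc, avgIdem_mul_normElt]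
  have h2 : (normRing Γ' S * z).1.1 * avgIdem Γ' = augIdem Γ' * avgIdem Γ' := by
    rw [normRing_mul, hz]
  refine ⟨?_, h1, h2⟩
  have h3 : ∀ w : MonoidAlgebra ℚ Γ, avgIdem Γ' * w = w → w * avgIdem Γ' = augIdem Γ' * avgIdem Γ' →
      w * w = augIdem Γ' * w := fun w hw hw' => by
    calc w * w = w * (avgIdem Γ' * w) := by rw [hw]
      _ = augIdem Γ' * w := by rw [← mul_assoc, hw', mul_assoc, hw]
  refine (h3 _ h1 h2).trans ?_
  exact ((Subsemigroup.mem_corner_iff (augIdem_idem Γ')).mp (normRing Γ' S * z).1.2).1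

theorem AugIndex.mul_normIdem_ne_zero (i : AugIndex Γ') {η : MonoidAlgebra ℚ Γ}
    (hη : IsNormIdem (Γ' := Γ') η) : i.1 * η ≠ 0 := by
  intro h0
  refine i.mul_avgIdem_ne_zero ?_
  rw [← i.2.2, mul_assoc, ← hη.mul_avg, ← mul_assoc, h0, zero_mul]

theorem exists_nsmul_mem_forall {ι : Type*} [Finite ι] (x : ι → MonoidAlgebra ℚ Γ) :
    ∃ n : ℕ, n ≠ 0 ∧ ∀ i, n • x i ∈ groupRing Γ S := by
  have := Fintype.ofFinite ι
  choose n hn hx using fun i => exists_nsmul_mem_groupRing S (x i)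
  refine ⟨∏ i, n i, Finset.prod_ne_zero_iff.mpr fun i _ => hn i, fun i => ?_⟩
  obtain ⟨m, hm⟩ := Finset.dvd_prod_of_mem n (Finset.mem_univ i)
  rw [hm, mul_comm, mul_smul]
  exact nsmul_mem (hx i) m

/-- After dévissage to a simple V, the relation is proved for a module R/Ry all of whose l > 0
composition factors are V, where it is the l-th power of the relation for V. -/
theorem AugIndex.smulCard_pow_eq (hfin : S.Finite) (hne : S.Nonempty) (i : AugIndex Γ')
    {η : augRing Γ' S} (hη : η * η = η) {a b : ℕ} {X : Fin b → Fin a → MonoidAlgebra ℚ Γ}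
    {Y : Fin a → Fin b → MonoidAlgebra ℚ Γ} (hX : ∀ k l, i.1 * X k l = X k l)
    (hY : ∀ l k, i.1 * η.1.1 * Y l k = Y l k)
    (hXY : ∀ k k', ∑ l, X k l * Y l k' = if k = k' then i.1 else 0)
    (hYX : ∀ l l', ∑ k, Y l k * X k l' = if l = l' then i.1 * η.1.1 else 0)
    (G : Type w) [AddCommGroup G] [Module (augRing Γ' S) G] [Finite G] :
    smulCard (i.toRing hfin hS) G ^ b = smulCard (i.toRing hfin hS * η) G ^ a := by
  have he := hS.augIdem_mem
  have hδ := i.toRing_mul_self hS hfin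
  have hε : i.toRing hfin hS * η * (i.toRing hfin hS * η) = i.toRing hfin hS * η := by
    rw [mul_assoc, ← mul_assoc η, ← i.toRing_comm hS hfin, mul_assoc _ η η, hη, ← mul_assoc, hδ]
  have hei : augIdem Γ' * i.1 = i.1 := by rw [(augIdem_isCentralIdem Γ').2, i.2.2]
  refine smulCard_pow_eq_pow hδ hε a b (fun V _ _ _ _ => ?_) G
  obtain ⟨y, K, hy, hD, hnt, hK, hW⟩ := exists_uniform_quotient hfin hne hS V
  obtain ⟨l, hl⟩ := exists_smulCard_eq_pow K hW _ hK
  have hl0 : l ≠ 0 := by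
    rintro rfl
    have h1 := hl 1 (one_mul 1)
    rw [pow_zero, smulCard_one] at h1
    exact Finite.one_lt_card.ne' h1
  -- Clearing denominators makes the matrices integral at the price of the factor n m in both
  -- products.
  obtain ⟨n, hn, hnX⟩ := exists_nsmul_mem_forall (S := S) fun p : Fin b × Fin a => X p.1 p.2
  obtain ⟨m, hm, hmY⟩ := exists_nsmul_mem_forall (S := S) fun p : Fin a × Fin b => Y p.1 p.2
  have hX' : ∀ k l, n • X k l ∈ augLat Γ' S := fun k l =>
    ⟨hnX (k, l), by rw [mul_smul_comm, ← hX k l, ← mul_assoc, hei]⟩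
  have hY' : ∀ l k, m • Y l k ∈ augLat Γ' S := fun l k =>
    ⟨hmY (l, k), by rw [mul_smul_comm, ← hY l k, ← mul_assoc, ← mul_assoc, hei]⟩
  have hsum : ∀ {ι : Type} (s : Finset ι) (f : ι → augRing Γ' S),
      (∑ j ∈ s, f j).1.1 = ∑ j ∈ s, (f j).1.1 := fun s f =>
    map_sum (⟨⟨fun r : augRing Γ' S => r.1.1, rfl⟩, fun _ _ => rfl⟩ :
      augRing Γ' S →+ MonoidAlgebra ℚ Γ) f s
  have hnm : n * m ≠ 0 := mul_ne_zero hn hm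
  have key := smulCard_quotient_pow_eq (y := y) hδ hε (m := n * m)
    (augRing_exists_finite_mod hfin hS hnm) (fun x => augRing_eq_zero_of_nsmul hnm) hy
    (fun k l => augMk he (hX' k l)) (fun l k => augMk he (hY' l k))
    (fun k l => augRing_ext (by
      show i.1 * (n • X k l) = n • X k l
      rw [mul_smul_comm, hX]))
    (fun l k => augRing_ext (by
      show i.1 * η.1.1 * (m • Y l k) = m • Y l k
      rw [mul_smul_comm, hY]))
    (fun k k' => augRing_ext (by
      rw [hsum]
      show ∑ l, (n • X k l) * (m • Y l k') = _
      simp only [smul_mul_assoc, mul_smul_comm, ← Finset.smul_sum, hXY, smul_smul]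
      rw [mul_comm m n]
      split_ifs
      · rfl
      · exact smul_zero _))
    (fun l l' => augRing_ext (by
      rw [hsum]
      show ∑ k, (m • Y l k) * (n • X k l') = _
      simp only [smul_mul_assoc, mul_smul_comm, ← Finset.smul_sum, hYX, smul_smul]
      split_ifs
      · rfl
      · exact smul_zero _))
  rw [hl _ hδ, hl _ hε, ← pow_mul, ← pow_mul, mul_comm, mul_comm l, pow_mul, pow_mul] at key
  exact Nat.pow_left_injective hl0 key

theorem card_idemPart_aug (hfin : S.Finite) (i : AugIndex Γ') (G : Type*) [AddCommGroup G]
    [Module (augRing Γ' S) G] :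
    Nat.card (idemPart (augRing Γ' S) i.toAug G) = smulCard (i.toRing hfin hS) G := by
  have : idemPart (augRing Γ' S) i.toAug G =
      (DistribSMul.toAddMonoidHom G (i.toRing hfin hS)).range := by
    refine le_antisymm ((AddSubgroup.closure_le _).mpr ?_) ?_
    · rintro _ ⟨r, hr, g, rfl⟩
      have : r = i.toRing hfin hS := Subtype.ext hr
      exact ⟨g, by rw [this]; rfl⟩
    · rintro _ ⟨g, rfl⟩
      exact AddSubgroup.subset_closure ⟨i.toRing hfin hS, rfl, g, rfl⟩
  rw [this]
  rfl

/-- Since ^{Γ'}G = ηG with η = N z, and e_i e₁' = N (e_i z) e₁' acts on it as e_i η, the group in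
question is e_i η G. -/
theorem card_idemPart_hecke (hfin : S.Finite) (i : AugIndex Γ') {z : augRing Γ' S}
    (hz : normElt Γ' * z.1.1 * avgIdem Γ' = augIdem Γ' * avgIdem Γ') (G : Type*) [AddCommGroup G]
    [Module (augRing Γ' S) G] :
    Nat.card (idemPart (heckeOrder Γ' S) i.toHecke (GammaInv hS G)) =
      smulCard (i.toRing hfin hS * (normRing Γ' S * z)) G := by
  have hval : (heckeMap hS (i.toRing hfin hS * z)).1 = i.toHecke := by
    refine Subtype.ext ?_
    show normElt Γ' * (i.1 * z.1.1) * avgIdem Γ' = i.1 * avgIdem Γ'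
    rw [← mul_assoc (normElt Γ'), ← i.2.1.1.2, mul_assoc, mul_assoc, ← mul_assoc (normElt Γ'), hz,
      ← mul_assoc, i.2.2]
  have hact : ∀ g : GammaInv hS G, (heckeMap hS (i.toRing hfin hS * z) • g).1 =
      (i.toRing hfin hS * (normRing Γ' S * z)) • g.1 := by
    intro g
    rw [heckeMap_smul_val, ← mul_assoc, ← i.toRing_comm, mul_assoc]
  have : (DistribSMul.toAddMonoidHom G (i.toRing hfin hS * (normRing Γ' S * z))).range =
      (idemPart (heckeOrder Γ' S) i.toHecke (GammaInv hS G)).map (GammaInv.incl hS G) := by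
    unfold idemPart
    rw [AddMonoidHom.map_closure]
    refine le_antisymm ?_ ((AddSubgroup.closure_le _).mpr ?_)
    · rintro _ ⟨g, rfl⟩
      let g' : GammaInv hS G := normSMul hS z g
      refine AddSubgroup.subset_closure ⟨_, ⟨_, hval, g', rfl⟩, ?_⟩
      refine (hact g').trans ?_
      have h1 : g'.1 = (normRing Γ' S * z) • g := (mul_smul _ _ _).symm
      have h2 : (normRing Γ' S * z) * (normRing Γ' S * z) = normRing Γ' S * z :=
        augRing_ext (isNormIdem hz).mul_self
      rw [h1, ← mul_smul, mul_assoc, h2]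
      rfl
    · rintro _ ⟨_, ⟨x, hx, g, rfl⟩, rfl⟩
      have : x = heckeMap hS (i.toRing hfin hS * z) := Subtype.ext (hx.trans hval.symm)
      exact ⟨g.1, by rw [this]; exact (hact g).symm⟩
  rw [smulCard, this]
  exact Nat.card_congr (AddSubgroup.equivMapOfInjective _ _ (incl_injective hS)).toEquiv

end AugModules

/-! ### Characters of rational representations -/

section RationalCharacters

variable {Γ : Type*} [Group Γ] [Finite Γ]

/-- A matrix representation over `ℚ` preserves a positive definite form, so its character takes the
same value at `γ` and `γ⁻¹`. -/
theorem character_inv_eq {n : ℕ} (ρ : Representation ℚ Γ (Fin n → ℚ)) (γ : Γ) :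
    ρ.character γ⁻¹ = ρ.character γ := by
  classical
  have := Fintype.ofFinite Γ
  let M : Γ → Matrix (Fin n) (Fin n) ℚ := fun g => LinearMap.toMatrix' (ρ g)
  have hmul : ∀ g h, M (g * h) = M g * M h := fun g h => by
    simp only [M, map_mul, LinearMap.toMatrix'_mul]
  have hone : M 1 = 1 := by simp [M]
  have htr : ∀ g, ρ.character g = (M g).trace := fun g => by
    show LinearMap.trace ℚ _ (ρ g) = _
    rw [← Matrix.trace_toLin'_eq, Matrix.toLin'_toMatrix']
  -- The averaged form is positive definite, hence invertible, and invariant; so M γ⁻¹ is conjugate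
  -- to the transpose of M γ.
  let B : Matrix (Fin n) (Fin n) ℚ := ∑ g, (M g).transpose * M g
  have hB : IsUnit B := by
    rw [← Matrix.mulVec_injective_iff_isUnit]
    refine (injective_iff_map_eq_zero B.mulVecLin).mpr fun v hv => ?_
    have h1 : ∑ g, dotProduct ((M g).mulVec v) ((M g).mulVec v) = 0 := by
      have h2 : dotProduct v (B.mulVec v) = 0 := by
        rw [show B.mulVec v = 0 from hv, dotProduct_zero]
      rw [← h2, Matrix.sum_mulVec, dotProduct_sum]
      refine Finset.sum_congr rfl fun g _ => ?_
      rw [← Matrix.mulVec_mulVec, Matrix.dotProduct_mulVec v, Matrix.vecMul_transpose]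
    have h3 := (Finset.sum_eq_zero_iff_of_nonneg fun g _ =>
      Finset.sum_nonneg fun i _ => mul_self_nonneg _).mp h1 1 (Finset.mem_univ _)
    have h4 := dotProduct_self_eq_zero.mp h3
    rwa [hone, Matrix.one_mulVec] at h4
  have hinv : (M γ).transpose * B * M γ = B := by
    simp only [B, Finset.mul_sum, Finset.sum_mul]
    refine Fintype.sum_equiv (Equiv.mulRight γ) _ _ fun g => ?_
    show _ = (M (g * γ)).transpose * M (g * γ)
    rw [hmul, Matrix.transpose_mul]
    simp only [Matrix.mul_assoc]
  obtain ⟨u, hu⟩ := hB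
  have h1 : (M γ).transpose * B = B * M γ⁻¹ := by
    conv_rhs => rw [← hinv]
    rw [Matrix.mul_assoc _ (M γ), ← hmul, mul_inv_cancel, hone, Matrix.mul_one]
  have h2 : M γ⁻¹ = (↑u⁻¹ : Matrix (Fin n) (Fin n) ℚ) * ((M γ).transpose * B) := by
    rw [h1, ← Matrix.mul_assoc, ← hu, Units.inv_mul, Matrix.one_mul]
  rw [htr, htr, h2, Matrix.trace_mul_comm, Matrix.mul_assoc, ← hu, Units.mul_inv, Matrix.mul_one,
    Matrix.trace_transpose]

end RationalCharacters

/-! ### Complex characters and traces of rational idempotents -/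

section ComplexCharacters

variable {Γ : Type*} [Group Γ] [Finite Γ] {V : Type*} [AddCommGroup V] [Module ℂ V]
  (ρ : Representation ℂ Γ V)

/-- The action of `ℚ[Γ]` on a complex representation. -/
noncomputable def ratAction : MonoidAlgebra ℚ Γ →+* Module.End ℂ V :=
  (ρ.asAlgebraHom : MonoidAlgebra ℂ Γ →+* Module.End ℂ V).comp
    (MonoidAlgebra.mapRingHom Γ (algebraMap ℚ ℂ))

theorem ratAction_single (γ : Γ) (a : ℚ) :
    ratAction ρ (MonoidAlgebra.single γ a) = (a : ℂ) • ρ γ := by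
  simp [ratAction]

theorem trace_ratAction [Fintype Γ] (x : MonoidAlgebra ℚ Γ) (γ : Γ) :
    LinearMap.trace ℂ V (ratAction ρ x * ρ γ) = ∑ g, (x.coeff g : ℂ) * ρ.character (g * γ) := by
  induction x using MonoidAlgebra.induction_linear with
  | zero => simp
  | add f g hf hg => simp [add_mul, hf, hg, Finset.sum_add_distrib]
  | single h a =>
    classical
    rw [ratAction_single, Finset.sum_eq_single h]
    · rw [smul_mul_assoc, ← map_mul, map_smul, MonoidAlgebra.coeff_single, Finsupp.single_eq_same]
      rfl
    · intro b _ hb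
      rw [MonoidAlgebra.coeff_single, Finsupp.single_eq_of_ne (by exact hb), Rat.cast_zero, zero_mul]
    · simp

/-- The kernel of a central idempotent is a subrepresentation; it is zero or everything. -/
theorem ratAction_centralIdem [ρ.IsIrreducible] {ε : MonoidAlgebra ℚ Γ} (hε : IsCentralIdem ε) :
    ratAction ρ ε = 0 ∨ ratAction ρ ε = 1 := by
  have hcomm : ∀ γ, ratAction ρ ε * ρ γ = ρ γ * ratAction ρ ε := fun γ => by
    have := congrArg (ratAction ρ) (hε.2 (MonoidAlgebra.single γ 1))
    simpa [ratAction_single] using this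
  have hidem : ratAction ρ ε * ratAction ρ ε = ratAction ρ ε := by rw [← map_mul, hε.1.eq]
  let K : Subrepresentation ρ := ⟨LinearMap.ker (ratAction ρ ε), fun γ v hv => by
    have := LinearMap.congr_fun (hcomm γ) v
    simp only [Module.End.mul_apply] at this
    rw [LinearMap.mem_ker, this, LinearMap.mem_ker.mp hv, map_zero]⟩
  rcases eq_bot_or_eq_top K with hK | hK
  · right
    ext v
    have h1 : ratAction ρ ε v - v ∈ K := by
      show ratAction ρ ε (ratAction ρ ε v - v) = 0
      rw [map_sub, ← Module.End.mul_apply, hidem, sub_self]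
    rw [hK] at h1
    have h2 : ratAction ρ ε v - v = 0 := h1
    exact sub_eq_zero.mp h2
  · left
    ext v
    have h1 : v ∈ K := by rw [hK]; trivial
    exact h1

/-- The character of the permutation representation counts fixed points. -/
theorem character_ofMulAction {Q : Type*} [MulAction Γ Q] [Fintype Q] [DecidableEq Q] (γ : Γ) :
    (Representation.ofMulAction ℂ Γ Q).character γ = ∑ q : Q, if γ • q = q then 1 else 0 := by
  let b : Module.Basis Q ℂ (MonoidAlgebra ℂ Q) := .ofRepr (MonoidAlgebra.coeffLinearEquiv ℂ)
  have hb : ∀ q, b q = MonoidAlgebra.single q 1 := fun q => rfl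
  show LinearMap.trace ℂ _ (Representation.ofMulAction ℂ Γ Q γ) = _
  rw [LinearMap.trace_eq_matrix_trace ℂ b, Matrix.trace]
  refine Finset.sum_congr rfl fun q _ => ?_
  rw [Matrix.diag_apply, LinearMap.toMatrix_apply, hb, Representation.ofMulAction_single]
  show (MonoidAlgebra.single (γ • q) (1 : ℂ)).coeff q = _
  rw [MonoidAlgebra.coeff_single, Finsupp.single_apply]

theorem trace_avgIdem [Fintype Γ] (Δ : Subgroup Γ) [DecidablePred (· ∈ Δ)] :
    (Nat.card Δ : ℂ) * LinearMap.trace ℂ V (ratAction ρ (avgIdem Δ)) =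
      ∑ g, if g ∈ Δ then ρ.character g else 0 := by
  have h1 : ratAction ρ (avgIdem Δ) = (Nat.card Δ : ℂ)⁻¹ • ∑ τ : Δ, ρ τ := by
    unfold avgIdem
    rw [finsum_eq_sum_of_fintype, map_sum, Finset.smul_sum]
    refine Finset.sum_congr rfl fun τ _ => ?_
    rw [ratAction_single, Rat.cast_inv, Rat.cast_natCast]
  rw [h1, map_smul, smul_eq_mul, ← mul_assoc, mul_inv_cancel₀ (by exact_mod_cast Nat.card_pos.ne'),
    one_mul, map_sum, ← Finset.sum_filter, Finset.sum_subtype (p := (· ∈ Δ)) _ (by simp)]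
  rfl

/-- Frobenius reciprocity for the permutation character of `Γ/Δ`. -/
theorem sum_character_mul_perm [Fintype Γ] (Δ : Subgroup Γ) [Fintype (Γ ⧸ Δ)]
    [DecidableEq (Γ ⧸ Δ)] :
    ∑ γ, ρ.character γ * ∑ q : Γ ⧸ Δ, (if γ • q = q then 1 else 0) =
      (Nat.card Γ : ℂ) * LinearMap.trace ℂ V (ratAction ρ (avgIdem Δ)) := by
  classical
  have hΔ : (Nat.card Δ : ℂ) ≠ 0 := by exact_mod_cast Nat.card_pos.ne'
  refine mul_left_cancel₀ hΔ ?_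
  rw [mul_left_comm, trace_avgIdem]
  -- The sum over cosets is replaced by a sum over Γ. As γ fixes xΔ exactly when x⁻¹ γ x ∈ Δ,
  -- conjugation makes the contribution independent of x.
  have h1 : ∀ f : Γ ⧸ Δ → ℂ, (Nat.card Δ : ℂ) * ∑ q, f q = ∑ x : Γ, f (QuotientGroup.mk x) := by
    intro f
    rw [← (Equiv.ofBijective _ (bijective_out_mul Δ)).sum_comp, Fintype.sum_prod_type,
      Finset.mul_sum]
    refine Finset.sum_congr rfl fun q _ => ?_
    have : ∀ τ : Δ, (QuotientGroup.mk (q.out * (τ : Γ)) : Γ ⧸ Δ) = q := fun τ => by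
      rw [QuotientGroup.mk_mul_of_mem _ τ.2, QuotientGroup.out_eq']
    simp [Equiv.ofBijective_apply, this]
  have h2 : ∀ x : Γ, ∑ γ, ρ.character γ * (if γ • (QuotientGroup.mk x : Γ ⧸ Δ) =
      QuotientGroup.mk x then 1 else 0) = ∑ g, if g ∈ Δ then ρ.character g else 0 := by
    intro x
    rw [← (MulAut.conj x).toEquiv.sum_comp]
    refine Finset.sum_congr rfl fun g _ => ?_
    show ρ.character (x * g * x⁻¹) * (if (QuotientGroup.mk (x * g * x⁻¹ * x) : Γ ⧸ Δ) =
      QuotientGroup.mk x then 1 else 0) = _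
    have h3 : (QuotientGroup.mk (x * g * x⁻¹ * x) : Γ ⧸ Δ) = QuotientGroup.mk x ↔ g ∈ Δ := by
      rw [inv_mul_cancel_right, eq_comm, QuotientGroup.eq, inv_mul_cancel_left]
    rw [Representation.char_conj, if_congr h3 rfl rfl, mul_ite, mul_one, mul_zero]
  rw [Finset.mul_sum]
  simp only [mul_left_comm (Nat.card Δ : ℂ), h1]
  simp only [Finset.mul_sum]
  rw [Finset.sum_comm]
  simp only [h2]
  rw [Finset.sum_const, Finset.card_univ, ← Nat.card_eq_fintype_card, nsmul_eq_mul, Finset.mul_sum]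

/-- `⟨φ, a_{Γ/Δ}⟩` is the trace of `e₁'` if the trivial character does not occur in `φ`. -/
theorem charInner_augChar (Δ : Subgroup Γ)
    (h0 : ratAction ρ (avgIdem (⊤ : Subgroup Γ)) = 0) :
    charInner ρ.character (augChar Δ) = LinearMap.trace ℂ V (ratAction ρ (avgIdem Δ)) := by
  classical
  have := Fintype.ofFinite Γ
  have := Fintype.ofFinite (Γ ⧸ Δ)
  have hΓ : (Nat.card Γ : ℂ) ≠ 0 := by exact_mod_cast Nat.card_pos.ne'
  have h1 : ∑ γ, ρ.character γ = 0 := by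
    have h2 := trace_avgIdem ρ (⊤ : Subgroup Γ)
    rw [h0, map_zero, mul_zero] at h2
    simpa using h2.symm
  have h2 : ∀ γ, (starRingEnd ℂ) (augChar Δ γ) =
      -1 + ∑ q : Γ ⧸ Δ, if γ • q = q then 1 else 0 := fun γ => by
    unfold augChar
    rw [character_ofMulAction, map_add, map_neg, map_one, map_sum]
    congr 1
    refine Finset.sum_congr rfl fun q _ => ?_
    split_ifs <;> simp
  unfold charInner
  rw [finsum_eq_sum_of_fintype]
  simp only [h2, mul_add, Finset.sum_add_distrib, sum_character_mul_perm]
  rw [← Finset.sum_mul, h1, zero_mul, mul_zero, zero_add, ← mul_assoc, inv_mul_cancel₀ hΓ, one_mul]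

/-- An idempotent `ε` acts as the identity on every absolutely irreducible constituent of a
rational representation on which it acts as the identity. -/
theorem ratAction_eq_one [ρ.IsIrreducible] {ε : MonoidAlgebra ℚ Γ} (hε : IsCentralIdem ε)
    {χ : Γ → ℚ} (hχ : IsRatCharOf ε χ) (h : charInner ρ.character (fun γ => (χ γ : ℂ)) ≠ 0) :
    ratAction ρ ε = 1 := by
  classical
  have := Fintype.ofFinite Γ
  refine (ratAction_centralIdem ρ hε).resolve_left fun h0 => h ?_
  obtain ⟨n, σ, -, hσ, rfl⟩ := hχ
  -- If ε acted as 0 on ρ, then, since it acts as 1 on σ, it could be moved by convolution from one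
  -- character to the other and the pairing would vanish.
  have hchar : ∀ γ, σ.character γ = ∑ g, ε.coeff g * σ.character (γ * g) := by
    intro γ
    have h1 : ∀ x : MonoidAlgebra ℚ Γ, LinearMap.trace ℚ _ (σ γ * σ.asAlgebraHom x) =
        ∑ g, x.coeff g * σ.character (γ * g) := by
      intro x
      induction x using MonoidAlgebra.induction_linear with
      | zero => simp
      | add f g hf hg => simp [mul_add, add_mul, hf, hg, Finset.sum_add_distrib]
      | single k a =>
        rw [Representation.asAlgebraHom_single, mul_smul_comm, ← map_mul, map_smul,
          Finset.sum_eq_single k]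
        · rw [MonoidAlgebra.coeff_single, Finsupp.single_eq_same]
          rfl
        · intro b _ hb
          rw [MonoidAlgebra.coeff_single, Finsupp.single_eq_of_ne (by exact hb), zero_mul]
        · simp
    rw [← h1, hσ, mul_one]
    rfl
  have hzero : ∀ k, ∑ g, (ε.coeff g : ℂ) * ρ.character (g * k) = 0 := fun k => by
    rw [← trace_ratAction, h0, zero_mul, map_zero]
  -- Conjugation is trivial on the rational values of σ, so `character_inv_eq` is what supplies the
  -- inverse needed for the convolution.
  have hsum : ∑ γ, ρ.character γ * (σ.character γ : ℂ) = 0 := by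
    calc ∑ γ, ρ.character γ * (σ.character γ : ℂ)
        = ∑ γ, ∑ g, (ε.coeff g : ℂ) * (ρ.character γ * (σ.character (γ⁻¹ * g) : ℂ)) := by
          refine Finset.sum_congr rfl fun γ _ => ?_
          rw [← character_inv_eq, hchar γ⁻¹, Rat.cast_sum, Finset.mul_sum]
          refine Finset.sum_congr rfl fun g _ => ?_
          push_cast
          ring
      _ = ∑ g, ∑ k, (ε.coeff g : ℂ) * (ρ.character (g * k) * (σ.character k⁻¹ : ℂ)) := by
          rw [Finset.sum_comm]
          refine Finset.sum_congr rfl fun g _ => ?_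
          rw [← Equiv.sum_comp (Equiv.mulLeft g)]
          refine Finset.sum_congr rfl fun k _ => ?_
          rw [Equiv.coe_mulLeft, mul_inv_rev, inv_mul_cancel_right]
      _ = ∑ k, (∑ g, (ε.coeff g : ℂ) * ρ.character (g * k)) * (σ.character k⁻¹ : ℂ) := by
          rw [Finset.sum_comm]
          refine Finset.sum_congr rfl fun k _ => ?_
          rw [Finset.sum_mul]
          exact Finset.sum_congr rfl fun g _ => by ring
      _ = 0 := by simp [hzero]
  unfold charInner
  rw [finsum_eq_sum_of_fintype]
  simp only [map_ratCast]
  rw [hsum, mul_zero]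

end ComplexCharacters

/-! ### The ratio of multiplicities as a ratio of ranks -/

section Ratio

variable {Γ : Type*} [Group Γ] [Finite Γ] {Γ' : Subgroup Γ}

/-- `⟨φ_i, a_Γ⟩ / ⟨φ_i, a_{Γ/Γ'}⟩ = a / b` if `(ℚ[Γ] e_i)^b` and `(ℚ[Γ] e_i η)^a` are isomorphic. -/
theorem AugIndex.charInner_div_charInner (i : AugIndex Γ') {φ : Γ → ℂ} (hφ : IsAbsIrredCharIn i.1 φ)
    {η : MonoidAlgebra ℚ Γ} (hη : IsNormIdem (Γ' := Γ') η) {a b : ℕ} (ha : 0 < a) (hb : 0 < b)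
    {X : Fin b → Fin a → MonoidAlgebra ℚ Γ} {Y : Fin a → Fin b → MonoidAlgebra ℚ Γ}
    (hXY : ∀ k k', ∑ l, X k l * Y l k' = if k = k' then i.1 else 0)
    (hYX : ∀ l l', ∑ k, Y l k * X k l' = if l = l' then i.1 * η else 0) :
    charInner φ (augChar ⊥) / charInner φ (augChar Γ') = (a : ℂ) / b := by
  obtain ⟨⟨n, ρ, hρ, rfl⟩, χ, hχ, hne⟩ := hφ
  have hone := ratAction_eq_one ρ i.2.1.1 hχ hne
  -- The trivial representation does not occur in ρ, so both inner products are traces of averages: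
  -- over the trivial group, where the average is 1, and over Γ'.
  have htop : ratAction ρ (avgIdem (⊤ : Subgroup Γ)) = 0 := by
    rw [← one_mul (ratAction ρ _), ← hone, ← map_mul, ← i.2.2, mul_assoc, augIdem_mul_avgIdem_top,
      mul_zero, map_zero]
  have havg : ratAction ρ (augIdem Γ' * avgIdem Γ') = ratAction ρ (avgIdem Γ') := by
    rw [← one_mul (ratAction ρ (augIdem Γ' * _)), ← one_mul (ratAction ρ (avgIdem Γ')), ← hone,
      ← map_mul, ← map_mul, ← mul_assoc, i.2.2]
  rw [charInner_augChar ρ _ htop, charInner_augChar ρ _ htop]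
  have hbot : avgIdem (⊥ : Subgroup Γ) = 1 := by
    unfold avgIdem
    have := Fintype.ofFinite (⊥ : Subgroup Γ)
    rw [finsum_eq_sum_of_fintype]
    simp [MonoidAlgebra.one_def, Subgroup.mem_bot.mp (default : (⊥ : Subgroup Γ)).2]
  set T := LinearMap.trace ℂ (Fin n → ℂ)
  have hη' : T (ratAction ρ η) = T (ratAction ρ (avgIdem Γ')) := by
    rw [← havg, ← hη.mul_avg, map_mul, LinearMap.trace_mul_comm, ← map_mul, hη.avg_mul]
  have h1 : ∑ k, ∑ l, T (ratAction ρ (X k l * Y l k)) = (b : ℂ) * T 1 := by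
    have : ∀ k, ∑ l, T (ratAction ρ (X k l * Y l k)) = T 1 := fun k => by
      rw [← map_sum, ← map_sum, hXY, if_pos rfl, hone]
    simp only [this, Finset.sum_const, Finset.card_univ, Fintype.card_fin, nsmul_eq_mul]
  have h2 : ∑ l, ∑ k, T (ratAction ρ (Y l k * X k l)) = (a : ℂ) * T (ratAction ρ (avgIdem Γ')) := by
    have : ∀ l, ∑ k, T (ratAction ρ (Y l k * X k l)) = T (ratAction ρ (avgIdem Γ')) := fun l => by
      rw [← map_sum, ← map_sum, hYX, if_pos rfl, map_mul, hone, one_mul, hη']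
    simp only [this, Finset.sum_const, Finset.card_univ, Fintype.card_fin, nsmul_eq_mul]
  -- Cyclicity of the trace equates the total traces of X Y and Y X; the first consists of b blocks
  -- e_i, the second of a blocks e_i η.
  have h3 : (b : ℂ) * T 1 = (a : ℂ) * T (ratAction ρ (avgIdem Γ')) := by
    rw [← h1, ← h2, Finset.sum_comm]
    refine Finset.sum_congr rfl fun l _ => Finset.sum_congr rfl fun k _ => ?_
    rw [map_mul (ratAction ρ), map_mul (ratAction ρ), LinearMap.trace_mul_comm]
  have hT : T 1 ≠ 0 := by
    rw [LinearMap.trace_one, Nat.cast_ne_zero, Module.finrank_fin_fun]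
    rintro rfl
    have := hρ.toNontrivial
    obtain ⟨K, L, hKL⟩ := this
    refine hKL (Subrepresentation.toSubmodule_injective (Subsingleton.elim _ _))
  have ha' : (a : ℂ) ≠ 0 := by exact_mod_cast ha.ne'
  have hb' : (b : ℂ) ≠ 0 := by exact_mod_cast hb.ne'
  have hT' : T (ratAction ρ (avgIdem Γ')) ≠ 0 := fun h0 => by
    rw [h0, mul_zero] at h3
    exact mul_ne_zero hb' hT h3
  rw [hbot, map_one, div_eq_div_iff hT' hb', mul_comm, h3]

end Ratio

/-! ### Real powers of cardinalities -/

section Powers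

open scoped ENNReal

theorem natCast_rpow_eq {P Q a b : ℕ} (hb : 0 < b) (h : P ^ b = Q ^ a) {u v : ℝ}
    (huv : v = a / b * u) : (P : ℝ≥0∞) ^ u = (Q : ℝ≥0∞) ^ v := by
  have hb' : (b : ℝ) ≠ 0 := by exact_mod_cast hb.ne'
  have h1 : u = b * (u / b) := by field_simp
  have h2 : v = a * (u / b) := by rw [huv]; ring
  rw [h1, h2, ENNReal.rpow_mul, ENNReal.rpow_mul, ENNReal.rpow_natCast, ENNReal.rpow_natCast]
  congr 1
  exact_mod_cast h

theorem eq_of_natCast_rpow_eq {P Q a b : ℕ} (hb : 0 < b) (hP : 1 < P) (h : P ^ b = Q ^ a)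
    {u v : ℝ} (huv : (P : ℝ≥0∞) ^ u = (Q : ℝ≥0∞) ^ v) : v = a / b * u := by
  rw [natCast_rpow_eq hb h rfl] at huv
  have hQ : 1 < Q := by
    by_contra! hQ
    have h1 : 1 < P ^ b := Nat.one_lt_pow hb.ne' hP
    have h2 : Q ^ a ≤ 1 := pow_le_one' hQ a
    omega
  have hQ' : (1 : ℝ≥0∞) < Q := by exact_mod_cast hQ
  rcases lt_trichotomy v ((a : ℝ) / b * u) with hlt | heq | hgt
  · exact absurd huv (ENNReal.rpow_lt_rpow_of_exponent_lt hQ' (ENNReal.natCast_ne_top _) hlt).ne'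
  · exact heq
  · exact absurd huv (ENNReal.rpow_lt_rpow_of_exponent_lt hQ' (ENNReal.natCast_ne_top _) hgt).ne

end Powers

/-! ### Weights of modules with equal automorphism groups -/

section Weights

open scoped ENNReal

variable {B : Type*} [Ring B] (Λ : Subring B) {ι : Type*} [Fintype ι] (ε : ι → B) (u : ι → ℚ)

theorem modWeight_eq_one (G : Type*) [AddCommGroup G] [Module Λ G] [Subsingleton G] :
    modWeight Λ ε u G = 1 := by
  simp [modWeight, cardPow]

/-- The automorphism groups have the same cardinality, finite and nonzero, which can be cancelled.
-/
theorem modWeight_eq_iff {B' : Type*} [Ring B'] (Λ' : Subring B') (ε' : ι → B') (v : ι → ℚ)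
    {G G' : Type*} [AddCommGroup G] [Module Λ G] [Finite G] [AddCommGroup G'] [Module Λ' G']
    (h : (G ≃ₗ[Λ] G) ≃ (G' ≃ₗ[Λ'] G')) :
    modWeight Λ ε u G = modWeight Λ' ε' v G' ↔ cardPow Λ ε u G = cardPow Λ' ε' v G' := by
  have : Finite (G ≃ₗ[Λ] G) := Finite.of_injective (fun f : G ≃ₗ[Λ] G => (f : G → G))
    DFunLike.coe_injective
  unfold modWeight
  rw [inv_inj, ← Nat.card_congr h, ENNReal.mul_left_inj]
  · exact_mod_cast Nat.card_pos.ne'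
  · exact ENNReal.natCast_ne_top _

end Weights

/-! ### Comparing the distributions, and test modules -/

section InvClass

open scoped ENNReal

variable {Γ : Type*} [Group Γ] [Finite Γ] {Γ' : Subgroup Γ} {S : Set ℕ} (hS : AllGood Γ' S)

theorem invClass_bijective (hfin : S.Finite) : Function.Bijective (invClass hS) := by
  obtain ⟨ι, _, x, y, h1⟩ := exists_sum_mul_normRing_mul hfin hS
  constructor
  · intro c d
    induction c using Quotient.inductionOn
    induction d using Quotient.inductionOn
    intro h
    obtain ⟨f⟩ := Quotient.exact h
    obtain ⟨F, -⟩ := exists_extension_equiv hS h1 f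
    exact Quotient.sound ⟨F⟩
  · intro d
    induction d using Quotient.inductionOn with
    | h H =>
      obtain ⟨G, _, _, _, ⟨f⟩⟩ := exists_gammaInv_equiv hS hfin H.carrier
      exact ⟨Quotient.mk _ ⟨G⟩, Quotient.sound ⟨f⟩⟩

/-- Along the bijection of classes, equal distributions mean proportional weights. The zero module
has weight 1 on both sides, so the normalizing sums agree and the weights are equal; conversely,
equal weights carry convergence across. -/
theorem map_randomModule_eq_iff (hfin : S.Finite) (u v : AugIndex Γ' → ℚ)
    (hu : ∑' c, classWeight (augRing Γ' S) AugIndex.toAug u c ≠ ⊤) :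
    (∃ hv : ∑' c, classWeight (heckeOrder Γ' S) AugIndex.toHecke v c ≠ ⊤,
      (randomModule (augRing Γ' S) AugIndex.toAug u hu).map (invClass hS) =
        randomModule (heckeOrder Γ' S) AugIndex.toHecke v hv) ↔
    ∀ G : FinMod (augRing Γ' S), cardPow (augRing Γ' S) AugIndex.toAug u G.carrier =
      cardPow (heckeOrder Γ' S) AugIndex.toHecke v (GammaInv hS G.carrier) := by
  obtain ⟨ι, _, x, y, h1⟩ := exists_sum_mul_normRing_mul hfin hS
  have hbij := invClass_bijective hS hfin
  have hmap : ∀ (p : PMF (FinModClass (augRing Γ' S))) c, p.map (invClass hS) (invClass hS c) =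
      p c := fun p c => by
    classical
    rw [PMF.map_apply, tsum_eq_single c]
    · rw [if_pos rfl]
    · intro d hd
      rw [if_neg fun h => hd (hbij.1 h).symm]
  have hsum : ∑' c, classWeight (heckeOrder Γ' S) AugIndex.toHecke v c =
      ∑' c, classWeight (heckeOrder Γ' S) AugIndex.toHecke v (invClass hS c) :=
    ((Equiv.ofBijective _ hbij).tsum_eq _).symm
  have hiff : (∀ G : FinMod (augRing Γ' S), cardPow (augRing Γ' S) AugIndex.toAug u G.carrier =
      cardPow (heckeOrder Γ' S) AugIndex.toHecke v (GammaInv hS G.carrier)) ↔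
      ∀ c, classWeight (augRing Γ' S) AugIndex.toAug u c =
        classWeight (heckeOrder Γ' S) AugIndex.toHecke v (invClass hS c) := by
    refine (forall_congr' fun G => ?_).trans Quotient.mk_surjective.forall.symm
    exact (modWeight_eq_iff _ _ _ _ _ _ (autEquiv hS G.carrier h1).toEquiv).symm
  rw [hiff]
  constructor
  · rintro ⟨hv, h⟩ c
    have h2 : ∀ c, classWeight (augRing Γ' S) AugIndex.toAug u c *
        (∑' c, classWeight (augRing Γ' S) AugIndex.toAug u c)⁻¹ =
        classWeight (heckeOrder Γ' S) AugIndex.toHecke v (invClass hS c) *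
        (∑' c, classWeight (heckeOrder Γ' S) AugIndex.toHecke v c)⁻¹ := fun c => by
      have h3 := hmap (randomModule (augRing Γ' S) AugIndex.toAug u hu) c
      rw [h, randomModule, randomModule, PMF.normalize_apply, PMF.normalize_apply] at h3
      exact h3.symm
    have h0 : (∑' c, classWeight (augRing Γ' S) AugIndex.toAug u c)⁻¹ =
        (∑' c, classWeight (heckeOrder Γ' S) AugIndex.toHecke v c)⁻¹ := by
      have h4 := h2 (Quotient.mk _ ⟨PUnit⟩)
      have h5 : classWeight (augRing Γ' S) AugIndex.toAug u (Quotient.mk _ ⟨PUnit⟩) = 1 :=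
        modWeight_eq_one _ _ _ PUnit
      have : Subsingleton (GammaInv hS PUnit) := inferInstanceAs
        (Subsingleton (invSubgroup Γ' S PUnit))
      have h6 : classWeight (heckeOrder Γ' S) AugIndex.toHecke v
          (invClass hS (Quotient.mk _ ⟨PUnit⟩)) = 1 :=
        modWeight_eq_one _ _ _ (GammaInv hS PUnit)
      rwa [h5, h6, one_mul, one_mul] at h4
    have h7 := h2 c
    rw [← h0] at h7
    exact (ENNReal.mul_left_inj (ENNReal.inv_ne_zero.mpr hu)
      (ENNReal.inv_ne_top.mpr (tsum_classWeight_ne_zero _ _ _))).mp h7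
  · intro h
    have hs : ∑' c, classWeight (heckeOrder Γ' S) AugIndex.toHecke v c =
        ∑' c, classWeight (augRing Γ' S) AugIndex.toAug u c := by
      rw [hsum]
      exact tsum_congr fun c => (h c).symm
    refine ⟨hs ▸ hu, PMF.ext fun d => ?_⟩
    obtain ⟨c, rfl⟩ := hbij.2 d
    rw [hmap, randomModule, randomModule, PMF.normalize_apply, PMF.normalize_apply, h, hs]

/-- A finite module on which `e_i` acts nontrivially and the other `e_j` act as zero. -/
theorem AugIndex.exists_finite_module (hfin : S.Finite) (hne : S.Nonempty) (i : AugIndex Γ') :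
    ∃ G : FinMod (augRing Γ' S), 1 < smulCard (i.toRing hfin hS) G.carrier ∧
      ∀ j : AugIndex Γ', j ≠ i → smulCard (j.toRing hfin hS) G.carrier = 1 := by
  have h := augLat_isMaxOrder hfin hS
  have he := hS.augIdem_mem
  have hϖ := primeProd_ne_zero hS.prime
  set δ := i.toRing hfin hS
  -- The quotient R/J is e_i R modulo ∏ p, on which every other e_j acts as zero.
  let J : Submodule (augRing Γ' S) (augRing Γ' S) :=
    { carrier := {x | ∃ y, δ * x = primeProd S • y}
      zero_mem' := ⟨0, by simp⟩
      add_mem' := by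
        rintro a b ⟨y, hy⟩ ⟨z, hz⟩
        exact ⟨y + z, by rw [mul_add, hy, hz, smul_add]⟩
      smul_mem' := by
        rintro r a ⟨y, hy⟩
        exact ⟨r * y, by
          rw [smul_eq_mul, ← mul_assoc, i.toRing_comm hS hfin, mul_assoc, hy, mul_smul_comm]⟩ }
  have hJfin : Finite (augRing Γ' S ⧸ J) := by
    obtain ⟨s, hs, hsx⟩ := augRing_exists_finite_mod hfin hS hϖ
    have := hs.to_subtype
    refine Finite.of_surjective (fun t : s => J.mkQ t.1) fun q => ?_
    obtain ⟨x, rfl⟩ := J.mkQ_surjective q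
    obtain ⟨t, ht, z, hxt⟩ := hsx x
    refine ⟨⟨t, ht⟩, ?_⟩
    rw [eq_comm, ← sub_eq_zero, ← map_sub, hxt]
    exact (Submodule.Quotient.mk_eq_zero _).mpr ⟨δ * z, by rw [mul_smul_comm]⟩
  have hδJ : δ ∉ J := by
    rintro ⟨y, hy⟩
    rw [i.toRing_mul_self hS hfin] at hy
    have hval : i.1 = primeProd S • y.1.1 := congrArg (fun r : augRing Γ' S => r.1.1) hy
    -- If e_i were divisible by ∏ p in R, then R = R (1 - e_i) + (∏ p) R, and Nakayama would give R
    -- e_i = 0.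
    let L : Submodule ℤ (MonoidAlgebra ℚ Γ) :=
      { carrier := {x | x ∈ augLat Γ' S ∧ x * i.1 = 0}
        zero_mem' := ⟨zero_mem _, zero_mul _⟩
        add_mem' := fun ha hb => ⟨add_mem ha.1 hb.1, by rw [add_mul, ha.2, hb.2, add_zero]⟩
        smul_mem' := fun n a ha => ⟨Submodule.smul_mem _ n ha.1, by
          rw [smul_mul_assoc, ha.2, smul_zero]⟩ }
    have hle : augLat Γ' S ≤ L := by
      refine le_of_le_sup_scaled hfin hne hS h.isFullIdeal_self (fun r hr x hx =>
        ⟨augLat_mul hr hx.1, by rw [mul_assoc, hx.2, mul_zero]⟩) (fun x hx => hx.1) fun x hx => ?_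
      have h1 : x = (x - x * i.1) + x * i.1 := by abel
      rw [h1]
      refine Submodule.add_mem_sup ⟨sub_mem hx (augLat_mul hx (i.mem_augLat hfin hS)), ?_⟩
        (mem_scaled.mpr ⟨x * y.1.1, augLat_mul hx (augRing_val_mem he y), ?_⟩)
      · rw [sub_mul, mul_assoc, i.2.1.1.1.eq, sub_self]
      · rw [← mul_smul_comm, ← hval]
    have h2 := (hle (i.mem_augLat hfin hS)).2
    rw [i.2.1.1.1.eq] at h2
    exact i.2.1.2.1 h2
  -- The members of `FinMod` live in the lowest universe, while the quotient lives in that of Γ.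
  let f : Shrink.{0} (augRing Γ' S ⧸ J) ≃ₗ[augRing Γ' S] augRing Γ' S ⧸ J :=
    Shrink.linearEquiv (augRing Γ' S) _
  have hfin' : Finite (Shrink.{0} (augRing Γ' S ⧸ J)) := Finite.of_equiv _ f.symm.toEquiv
  refine ⟨⟨Shrink.{0} (augRing Γ' S ⧸ J)⟩, ?_, fun j hj => ?_⟩
  · show 1 < smulCard δ (Shrink.{0} (augRing Γ' S ⧸ J))
    rw [smulCard_congr f]
    have : Nontrivial (DistribSMul.toAddMonoidHom (augRing Γ' S ⧸ J) δ).range :=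
      ⟨⟨⟨_, J.mkQ 1, rfl⟩, 0, fun h0 => hδJ ?_⟩⟩
    · exact Finite.one_lt_card
    · have h1 : δ • J.mkQ 1 = 0 := congrArg Subtype.val h0
      rw [← map_smul, smul_eq_mul, mul_one] at h1
      exact (Submodule.Quotient.mk_eq_zero _).mp h1
  · show smulCard (j.toRing hfin hS) (Shrink.{0} (augRing Γ' S ⧸ J)) = 1
    rw [smulCard_congr f]
    refine smulCard_eq_one fun q => ?_
    obtain ⟨x, rfl⟩ := J.mkQ_surjective q
    rw [← map_smul]
    refine (Submodule.Quotient.mk_eq_zero _).mpr ⟨0, ?_⟩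
    have h1 : δ * j.toRing hfin hS = 0 :=
      augRing_ext (i.2.1.mul_eq_zero j.2.1 fun h => hj (Subtype.ext h).symm)
    rw [smul_eq_mul, ← mul_assoc, h1, zero_mul, smul_zero]

/-- The cardinalities of `e_i G` and `e_i e₁' ^{Γ'}G` are related by the exponent
`⟨φ_i, a_Γ⟩ / ⟨φ_i, a_{Γ/Γ'}⟩`. -/
theorem AugIndex.exists_ratio (hfin : S.Finite) (hne : S.Nonempty) (i : AugIndex Γ') :
    ∃ a b : ℕ, 0 < a ∧ 0 < b ∧
      (∀ φ : Γ → ℂ, IsAbsIrredCharIn i.1 φ →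
        charInner φ (augChar ⊥) / charInner φ (augChar Γ') = (a : ℂ) / b) ∧
      ∀ G : FinMod (augRing Γ' S),
        Nat.card (idemPart (augRing Γ' S) i.toAug G.carrier) ^ b =
          Nat.card (idemPart (heckeOrder Γ' S) i.toHecke (GammaInv hS G.carrier)) ^ a := by
  obtain ⟨z, hz⟩ := exists_normRing_mul_mul hfin hS
  have hη := isNormIdem hz
  obtain ⟨a, b, X, Y, ha, hb, hX, hY, hXY, hYX⟩ :=
    exists_matrices i.2.1 hη.mul_self (i.mul_normIdem_ne_zero hη)
  refine ⟨a, b, ha, hb, fun φ hφ => i.charInner_div_charInner hφ hη ha hb hXY hYX, fun G => ?_⟩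
  rw [card_idemPart_aug hS hfin, card_idemPart_hecke hS hfin i hz]
  exact i.smulCard_pow_eq hS hfin hne (augRing_ext hη.mul_self) hX hY hXY hYX G.carrier

end InvClass

theorem mainTheorem6 {Γ : Type*} [Group Γ] [Finite Γ] (Γ' : Subgroup Γ) (S : Set ℕ)
    (hfin : S.Finite) (hne : S.Nonempty) (hS : AllGood Γ' S) :
    (∀ (H : Type w) [AddCommGroup H] [Module (heckeOrder Γ' S) H] [Finite H],
      ∃ (G : Type w) (_ : AddCommGroup G) (_ : Module (augRing Γ' S) G), Finite G ∧
        Nonempty (GammaInv hS G ≃ₗ[heckeOrder Γ' S] H) ∧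
        (∀ (G' : Type w) [AddCommGroup G'] [Module (augRing Γ' S) G'] [Finite G'],
          Nonempty (GammaInv hS G' ≃ₗ[heckeOrder Γ' S] H) → Nonempty (G' ≃ₗ[augRing Γ' S] G)) ∧
        Nonempty ((G ≃ₗ[augRing Γ' S] G) ≃* (H ≃ₗ[heckeOrder Γ' S] H))) ∧
    (∀ φ : AugIndex Γ' → Γ → ℂ, (∀ i, IsAbsIrredCharIn i.1 (φ i)) →
      ∀ (u v : AugIndex Γ' → ℚ)
        (hu : ∑' c, classWeight (augRing Γ' S) AugIndex.toAug u c ≠ ⊤),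
        ((∃ hv : ∑' c, classWeight (heckeOrder Γ' S) AugIndex.toHecke v c ≠ ⊤,
            (randomModule (augRing Γ' S) AugIndex.toAug u hu).map (invClass hS) =
              randomModule (heckeOrder Γ' S) AugIndex.toHecke v hv) ↔
          ∀ i, (v i : ℂ) =
            charInner (φ i) (augChar ⊥) / charInner (φ i) (augChar Γ') * (u i : ℂ))) := by
  constructor
  · intro H _ _ _
    obtain ⟨ι, _, x, y, h1⟩ := exists_sum_mul_normRing_mul hfin hS
    obtain ⟨G, _, _, hG, ⟨f⟩⟩ := exists_gammaInv_equiv hS hfin H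
    refine ⟨G, _, _, hG, ⟨f⟩, ?_, ?_⟩
    · rintro G' _ _ _ ⟨f'⟩
      obtain ⟨F, -⟩ := exists_extension_equiv hS h1 (f'.trans f.symm)
      exact ⟨F⟩
    · exact ⟨(autEquiv hS G h1).trans
        { toFun := fun a => f.symm.trans (a.trans f)
          invFun := fun b => f.trans (b.trans f.symm)
          left_inv := fun a => by ext; simp
          right_inv := fun b => by ext; simp
          map_mul' := fun a b => by ext; simp }⟩
  · intro φ hφ u v hu
    rw [map_randomModule_eq_iff hS hfin]
    choose a b ha hb hratio hcard using fun i : AugIndex Γ' => i.exists_ratio hS hfin hne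
    -- The ratio of inner products is the rational number a/b, so the complex equation passes
    -- through ℚ to the real exponents.
    have hiff : ∀ i, (v i : ℂ) = charInner (φ i) (augChar ⊥) / charInner (φ i) (augChar Γ') *
        (u i : ℂ) ↔ (v i : ℝ) = a i / b i * u i := fun i => by
      rw [hratio i (φ i) (hφ i)]
      have h1 : ∀ K : Type, ∀ [Field K] [CharZero K],
          (v i : K) = (a i : K) / b i * (u i : K) ↔ v i = a i / b i * u i := fun K _ _ => by
        rw [← (Rat.cast_injective (α := K)).eq_iff]
        push_cast
        rfl
      exact (h1 ℂ).trans (h1 ℝ).symm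
    simp only [hiff]
    constructor
    · intro h i
      -- On this module only the factor at i differs from 1; there |e_i G| > 1, so strict
      -- monotonicity in the exponent determines v_i.
      obtain ⟨G, hGi, hGj⟩ := i.exists_finite_module hS hfin hne
      have h1 := h G
      rw [cardPow, cardPow, Finset.prod_eq_single i, Finset.prod_eq_single i] at h1
      · exact eq_of_natCast_rpow_eq (hb i) (by rwa [card_idemPart_aug hS hfin]) (hcard i G) h1
      · intro j _ hj
        have h2 := hcard j G
        rw [card_idemPart_aug hS hfin, hGj j hj, one_pow, eq_comm,
          Nat.pow_eq_one] at h2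
        rw [h2.resolve_right (ha j).ne', Nat.cast_one, ENNReal.one_rpow]
      · simp
      · intro j _ hj
        rw [card_idemPart_aug hS hfin, hGj j hj, Nat.cast_one, ENNReal.one_rpow]
      · simp
    · intro h G
      exact Finset.prod_congr rfl fun i _ => natCast_rpow_eq (hb i) (hcard i G) (h i)
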